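/- Let $d\ge 0$ and let $S\subset\mathbb{R}^d$ be a finite union of (bounded) rectangles with edges parallel to the axes, that is, of products $I_1\times\dots\times I_d$ of bounded intervals. Then there exists a set $\Sigma\subset\mathbb{R}^d$ such that the family of exponentials $e(\Sigma):=\{e^{2\pi i\langle\sigma,t\rangle}\}_{\sigma\in\Sigma}$ is a Riesz basis in $L^2(S)$, i.e. it is the image of an orthonormal basis of $L^2(S)$ under a bounded invertible operator on $L^2(S)$. Moreover, if $S\subset[0,1]^d$, then $\Sigma$ may be chosen to satisfy $\Sigma\subset\mathbb{Z}^d$. -/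

import Mathlib

open MeasureTheory

/-- A family of vectors in a Hilbert space is a Riesz basis if it is the image of an orthonormal
basis under a bounded invertible operator. -/
def IsRieszBasis {ι H : Type*} [NormedAddCommGroup H] [InnerProductSpace ℂ H] [CompleteSpace H]
    (f : ι → H) : Prop :=
  ∃ (b : HilbertBasis ι ℂ H) (T : H ≃L[ℂ] H), ∀ i, f i = T (b i)

/-- The exponential `t ↦ exp (2 π i ⟨σ, t⟩)` on `ℝ^d`. -/
noncomputable def expFun {d : ℕ} (σ : EuclideanSpace ℝ (Fin d)) (t : EuclideanSpace ℝ (Fin d)) :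
    ℂ :=
  Complex.exp (2 * Real.pi * Complex.I * (inner ℝ σ t : ℝ))

/-- The exponentials with frequencies in `Sig` form a Riesz basis of `L^2(S)`: every one of them,
restricted to `S`, is (the class of) an element of `L^2(S)`, and the family of these elements,
indexed by `Sig`, is a Riesz basis. -/
def IsRieszBasisOfExponentials {d : ℕ} (S Sig : Set (EuclideanSpace ℝ (Fin d))) : Prop :=
  ∃ f : Sig → Lp ℂ 2 (volume.restrict S),
    (∀ σ : Sig, f σ =ᵐ[volume.restrict S] expFun (σ : EuclideanSpace ℝ (Fin d))) ∧ IsRieszBasis f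

/-- A rectangle with edges parallel to the axes: a product of `d` bounded intervals (open, closed
or half-open; the order-connected subsets of `ℝ` are exactly the intervals). -/
def IsRectangle {d : ℕ} (R : Set (EuclideanSpace ℝ (Fin d))) : Prop :=
  ∃ I : Fin d → Set ℝ, (∀ i, (I i).OrdConnected ∧ Bornology.IsBounded (I i)) ∧
    R = {x | ∀ i, x i ∈ I i}

/-- The cube `[0,1]^d`. -/
def unitCube (d : ℕ) : Set (EuclideanSpace ℝ (Fin d)) :=
  {x | ∀ i, x i ∈ Set.Icc (0 : ℝ) 1}

/-- The lattice `ℤ^d` in `ℝ^d`. -/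
def integerLattice (d : ℕ) : Set (EuclideanSpace ℝ (Fin d)) :=
  {x | ∀ i, ∃ n : ℤ, x i = (n : ℝ)}

/-! The problem is moved to the torus. There one seeks integer frequencies `Sig` such that
restriction to the set is a bijection from the `L²` functions with spectrum in `Sig` onto `L²` of
the set (`IsRieszSpectrum`). Such a bijection is an isomorphism of Hilbert spaces, and polar
decomposition turns the exponentials into a Riesz basis in the required sense
(`IsRieszSpectrum.isRieszBasis`). Integer frequencies on the torus become multiples of `1 / M` on a
cube of side `M`, and stay integers on the unit cube.

The engine is a splitting, `exists_isRieszSpectrum_of_levels`. Fix a coordinate and `N`. If the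
orbit of a point under translation by `1 / N` meets the set in `n` points, then values at these
points are interpolated uniquely by the frequency residues `0, …, n - 1` modulo `N` (Vandermonde).
So residue `r` is used exactly on the orbits with at least `r + 1` points. After dilation by `N`
these orbits form a new set, and a Riesz spectrum `Γ` of it contributes `r + N Γ`, in that
coordinate. The contributions are assembled by a triangular argument, descending in the residue
(`exists_of_chain`, `eq_zero_of_chain`). The same argument treats sets whose sections in one
direction are empty, full, or share one spectrum (`exists_isRieszSpectrum_of_sections`).

Coordinates are added one at a time (`exists_isRieszSpectrum_boxPattern`): sections in the new
direction are subsets of the circle with finitely many jumps, depending only on a finite label read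
from the earlier coordinates. Passing to level sets never increases the number of jumps, and if a
section has more than two, some `N` decreases it (`exists_ncard_gridLevel_lt`). Otherwise, for every
`N` the counting function would take only two consecutive values, and Bessel's inequality would
bound the Fourier coefficients determined by the jumps. Their mean square over `N` equals the number
`J` of jumps, whence `5 J / 4 ≤ π² / 2` and `J < 4`; but `J` is even.

Once every section has at most two jumps, simultaneous approximation gives a large `N` for which, at
each level, the nontrivial sections are arcs of one common length close to `0` or `1`
(`exists_isRieszSpectrum_of_ncard_le_two`). An arc of small length `a` has the spectrum `⌊k / a⌋`, a
perturbation of the exact frequencies `k / a` (`isRieszSpectrum_short_arc`); long arcs follow by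
taking complements (`IsRieszSpectrum.compl`). -/

open scoped ENNReal InnerProductSpace


/-! ### Triangular combination of two splittings of a module. -/

section ChainLemma

variable {R M K : Type*} [Ring R] [AddCommGroup M] [Module R M]

/-- A combination principle. The module `M` is split in two commuting ways: by the "spatial"
projections `p k` and by the "spectral" projections `lam j`. The cell `k` carries the level `n k`,
and on it the problem `J F = J f` is well posed within the components `lam j`, `j < n k`, while
agreement on all cells of level `> i` is well posed within the subspace `U i` of the `i`-th
component. Then the problem `J F = J f` has solutions with components in the `U i`. -/
theorem exists_of_chain [Fintype K] [DecidableEq K] (p : K → M →ₗ[R] M) (n : K → ℕ) (m : ℕ)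
    (hp : ∀ k l f, p k (p l f) = if k = l then p l f else 0) (hp1 : ∀ f, ∑ k, p k f = f)
    (lam : ℕ → M →ₗ[R] M) (hlam : ∀ i j f, lam i (lam j f) = if i = j then lam j f else 0)
    (U : ℕ → Submodule R M) (hU : ∀ i < m, ∀ f ∈ U i, lam i f = f)
    (J : M →ₗ[R] M)
    (hA : ∀ i < m, ∀ f, lam i f = f → ∃ F ∈ U i, ∀ k, i < n k → p k F = p k f)
    (hB : ∀ k f, p k f = f → ∃ F, p k F = F ∧ (∀ j < m, n k ≤ j → lam j F = 0) ∧ J F = J f)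
    (f : M) : ∃ F, (∀ i < m, lam i F ∈ U i) ∧ J F = J f := by
  -- Descending construction: `i` is the number of components, counted from the top, that are
  -- already settled.
  have key : ∀ i ≤ m, ∃ W, (∀ j < m, m - i ≤ j → lam j W ∈ U j) ∧
      ∀ k, m - i ≤ n k → J (p k W) = J (p k f) := by
    intro i hi
    induction i with
    | zero => exact ⟨f, fun j hj h => absurd hj (by omega), fun _ _ => rfl⟩
    | succ i ih =>
      obtain ⟨W, hW1, hW2⟩ := ih (by omega)
      set r := m - (i + 1) with hr
      have hri : m - i = r + 1 := by omega
      rw [hri] at hW1 hW2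
      -- Exchanging the `r`-th component for `G` leaves all cells of level above `r` unchanged.
      -- Cells of level `r` may be spoilt; no condition has been imposed on them so far.
      obtain ⟨G, hGU, hG⟩ := hA r (by omega) (lam r W) (by rw [hlam]; simp)
      set W' := W - lam r W + G with hW'
      have hGl : lam r G = G := hU r (by omega) G hGU
      have hW'p : ∀ k, r < n k → p k W' = p k W := by
        intro k hk
        simp [hW', hG k hk]
      choose X hX1 hX2 hX3 using fun k => hB k (p k (f - W')) (by rw [hp]; simp)
      -- The corrections live on cells of level exactly `r` and have only components below `r`, so
      -- they disturb neither the settled components nor the cells of higher level.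
      refine ⟨W' + ∑ k with n k = r, X k, ?_, ?_⟩
      · intro j hj hrj
        have h0 : ∑ k with n k = r, lam j (X k) = 0 :=
          Finset.sum_eq_zero fun k hk => hX2 k j hj (by simp at hk; omega)
        rw [map_add, map_sum, h0, add_zero]
        rcases eq_or_lt_of_le hrj with rfl | hlt
        · have : lam r W' = G := by simp [hW', hlam, hGl]
          rw [this]; exact hGU
        · have : lam j W' = lam j W := by
            rw [hW', map_add, map_sub, hlam, if_neg (by omega), ← hGl, hlam, if_neg (by omega)]
            simp
          rw [this]; exact hW1 j hj (by omega)
      · intro k hk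
        have hpX : ∑ l with n l = r, p k (X l) = if n k = r then X k else 0 := by
          have : ∀ l, p k (X l) = if k = l then X l else 0 := by
            intro l
            rw [← hX1 l, hp]
          simp only [this]
          rw [Finset.sum_ite_eq]
          simp
        rw [map_add, map_sum, hpX]
        split_ifs with h
        · rw [map_add, hX3]
          simp
        · rw [add_zero, hW'p k (by omega), hW2 k (by omega)]
  obtain ⟨W, h1, h2⟩ := key m le_rfl
  refine ⟨W, fun i hi => h1 i hi (by omega), ?_⟩
  rw [← hp1 W, ← hp1 f, map_sum, map_sum]
  exact Finset.sum_congr rfl fun k _ => h2 k (by omega)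

/-- The uniqueness part of the combination principle. -/
theorem eq_zero_of_chain (p : K → M →ₗ[R] M) (n : K → ℕ) (m : ℕ)
    (hpp : ∀ k f, p k (p k f) = p k f)
    (lam : ℕ → M →ₗ[R] M)
    (hlam1 : ∀ f, (∀ j < m, lam j f = 0) → f = 0)
    (hcomm : ∀ i k f, lam i (p k f) = p k (lam i f))
    (U : ℕ → Submodule R M) (J : M →ₗ[R] M) (hJ : ∀ k f, J (p k f) = p k (J f))
    (hA : ∀ i < m, ∀ F ∈ U i, (∀ k, i < n k → p k F = 0) → F = 0)
    (hB : ∀ k F, p k F = F → (∀ j < m, n k ≤ j → lam j F = 0) → J F = 0 → F = 0)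
    (F : M) (hF : ∀ i < m, lam i F ∈ U i) (hJF : J F = 0) : F = 0 := by
  have key : ∀ i ≤ m, ∀ j < m, m - i ≤ j → lam j F = 0 := by
    intro i
    induction i with
    | zero => intro _ j hj h; omega
    | succ i ih =>
      intro hi j hj hij
      -- On a cell of level above `j`, every component of `p k F` with index at least `n k` comes
      -- from a component of `F` already known to vanish. Hence `hB` makes `p k F` vanish
      -- altogether.
      refine hA j hj _ (hF j hj) fun k hk => ?_
      rw [← hcomm, hB k (p k F) (hpp k F) (fun l hl hkl => ?_) (by rw [hJ, hJF, map_zero]),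
        map_zero]
      rw [hcomm, ih (by omega) l hl (by omega), map_zero]
  exact hlam1 F fun j hj => key m le_rfl j hj (by omega)

end ChainLemma

/-! ### Multiplication and restriction operators on `L²`. -/

section MulOp

variable {X : Type*} [MeasurableSpace X] {μ : Measure X}

theorem memLp_bounded_mul {φ : X → ℂ} (hφ : Measurable φ) {C : ℝ} (hC : ∀ x, ‖φ x‖ ≤ C)
    (f : Lp ℂ 2 μ) : MemLp (fun x => φ x * f x) 2 μ :=
  MemLp.of_le_mul (c := C) (Lp.memLp f)
    (hφ.aestronglyMeasurable.mul (Lp.aestronglyMeasurable f))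
    (.of_forall fun x => by
      rw [norm_mul]; exact mul_le_mul_of_nonneg_right (hC x) (norm_nonneg _))

/-- Multiplication by a bounded measurable function, as an operator on `L²`. -/
noncomputable def mulOp (μ : Measure X) (φ : X → ℂ) (hφ : Measurable φ) (C : ℝ)
    (hC : ∀ x, ‖φ x‖ ≤ C) : Lp ℂ 2 μ →L[ℂ] Lp ℂ 2 μ :=
  have hmem := fun f : Lp ℂ 2 μ => memLp_bounded_mul hφ hC f
  LinearMap.mkContinuous
    { toFun := fun f => (hmem f).toLp _
      map_add' := fun f g => by
        rw [← MemLp.toLp_add]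
        refine MemLp.toLp_congr _ _ ?_
        filter_upwards [Lp.coeFn_add f g] with x hx
        simp only [hx, Pi.add_apply, mul_add]
      map_smul' := fun c f => by
        rw [RingHom.id_apply, ← MemLp.toLp_const_smul]
        refine MemLp.toLp_congr _ _ ?_
        filter_upwards [Lp.coeFn_smul c f] with x hx
        simp only [hx, Pi.smul_apply, smul_eq_mul]
        ring }
    C (fun f => by
      refine Lp.norm_le_mul_norm_of_ae_le_mul ?_
      filter_upwards [(hmem f).coeFn_toLp] with x hx
      simp only [LinearMap.coe_mk, AddHom.coe_mk]
      rw [hx, norm_mul]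
      exact mul_le_mul_of_nonneg_right (hC x) (norm_nonneg _))

theorem mulOp_ae {φ : X → ℂ} {hφ : Measurable φ} {C : ℝ} {hC : ∀ x, ‖φ x‖ ≤ C} (f : Lp ℂ 2 μ) :
    mulOp μ φ hφ C hC f =ᵐ[μ] fun x => φ x * f x :=
  (memLp_bounded_mul hφ hC f).coeFn_toLp

theorem norm_mulOp_le {φ : X → ℂ} {hφ : Measurable φ} {C : ℝ} {hC : ∀ x, ‖φ x‖ ≤ C}
    (h0 : 0 ≤ C) : ‖mulOp μ φ hφ C hC‖ ≤ C :=
  ContinuousLinearMap.opNorm_le_bound _ h0 fun f => Lp.norm_le_mul_norm_of_ae_le_mul (by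
    filter_upwards [mulOp_ae (hφ := hφ) (hC := hC) f] with x hx
    rw [hx, norm_mul]
    exact mul_le_mul_of_nonneg_right (hC x) (norm_nonneg _))

/-- Restriction to a measurable set (extended by zero), as an operator on `L²`. -/
noncomputable def restrOp (μ : Measure X) (S : Set X) (hS : MeasurableSet S) :
    Lp ℂ 2 μ →L[ℂ] Lp ℂ 2 μ :=
  mulOp μ (S.indicator 1) (measurable_one.indicator hS) 1 (fun x => by
    by_cases h : x ∈ S <;> simp [h])

theorem restrOp_ae {S : Set X} {hS : MeasurableSet S} (f : Lp ℂ 2 μ) :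
    restrOp μ S hS f =ᵐ[μ] S.indicator f := by
  filter_upwards [mulOp_ae (μ := μ) (φ := S.indicator 1) f] with x hx
  rw [restrOp, hx]
  by_cases h : x ∈ S <;> simp [h]

theorem restrOp_eq_iff {S : Set X} {hS : MeasurableSet S} {f g : Lp ℂ 2 μ} :
    restrOp μ S hS f = restrOp μ S hS g ↔ ∀ᵐ x ∂μ, x ∈ S → f x = g x := by
  rw [Lp.ext_iff]
  constructor <;> intro h
  · filter_upwards [h, restrOp_ae (hS := hS) f, restrOp_ae (hS := hS) g] with x h1 h2 h3 hx
    simpa [h2, h3, hx] using h1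
  · filter_upwards [h, restrOp_ae (hS := hS) f, restrOp_ae (hS := hS) g] with x h1 h2 h3
    by_cases hx : x ∈ S
    · simp [h2, h3, hx, h1 hx]
    · simp [h2, h3, hx]

theorem restrOp_eq_zero_iff {S : Set X} {hS : MeasurableSet S} {f : Lp ℂ 2 μ} :
    restrOp μ S hS f = 0 ↔ ∀ᵐ x ∂μ, x ∈ S → f x = 0 := by
  rw [← map_zero (restrOp μ S hS), restrOp_eq_iff]
  constructor <;> intro h <;> filter_upwards [h, Lp.coeFn_zero ℂ 2 μ] with x h1 h2 hx
  · rw [h1 hx, h2]; rfl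
  · rw [h1 hx, h2]; rfl

theorem restrOp_eq_self_iff {S : Set X} {hS : MeasurableSet S} {f : Lp ℂ 2 μ} :
    restrOp μ S hS f = f ↔ ∀ᵐ x ∂μ, x ∉ S → f x = 0 := by
  rw [Lp.ext_iff]
  constructor <;> intro h
  · filter_upwards [h, restrOp_ae (hS := hS) f] with x h1 h2 hx
    rw [← h1, h2]; simp [hx]
  · filter_upwards [h, restrOp_ae (hS := hS) f] with x h1 h2
    by_cases hx : x ∈ S
    · simp [h2, hx]
    · simp [h2, hx, h1 hx]

theorem restrOp_restrOp {S T : Set X} {hS : MeasurableSet S} {hT : MeasurableSet T}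
    (f : Lp ℂ 2 μ) :
    restrOp μ S hS (restrOp μ T hT f) = restrOp μ (S ∩ T) (hS.inter hT) f := by
  apply Lp.ext
  filter_upwards [restrOp_ae (hS := hS) (restrOp μ T hT f), restrOp_ae (hS := hT) f,
    restrOp_ae (hS := hS.inter hT) f] with x h1 h2 h3
  rw [h1, h3]
  by_cases hx : x ∈ S <;> by_cases hy : x ∈ T <;> simp [hx, hy, h2]

end MulOp

/-- The Haar probability measure on the torus. -/
noncomputable abbrev torusMeasure (d : ℕ) : Measure (UnitAddTorus (Fin d)) :=
  Measure.pi fun _ => AddCircle.haarAddCircle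

/-- The space `L²` of the torus. -/
noncomputable abbrev TorusL2 (d : ℕ) := Lp ℂ 2 (torusMeasure d)

/-- The Fourier basis of `L²` of the torus. -/
noncomputable def expBasis (d : ℕ) : HilbertBasis (Fin d → ℤ) ℂ (TorusL2 d) :=
  UnitAddTorus.mFourierBasis

theorem expBasis_ae {d : ℕ} (n : Fin d → ℤ) :
    expBasis d n =ᵐ[torusMeasure d] UnitAddTorus.mFourier n := by
  have h := UnitAddTorus.coeFn_mFourierLp 2 n
  have h2 : expBasis d n = UnitAddTorus.mFourierLp 2 n := by
    rw [expBasis]; exact congrFun UnitAddTorus.coe_mFourierBasis n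
  rw [h2]; exact h


/-! ### Spectral projections, translations and Riesz spectra on the torus. -/

section Spectral

variable {d : ℕ}

theorem expBasis_ext {f g : TorusL2 d} (h : ∀ n, ⟪expBasis d n, f⟫_ℂ = ⟪expBasis d n, g⟫_ℂ) :
    f = g := by
  apply (expBasis d).repr.injective
  ext n
  simpa [HilbertBasis.repr_apply_apply] using h n

theorem expBasis_inner (m n : Fin d → ℤ) :
    ⟪expBasis d m, expBasis d n⟫_ℂ = if m = n then 1 else 0 :=
  orthonormal_iff_ite.mp (expBasis d).orthonormal m n

theorem clm_ext_expBasis {E : Type*} [NormedAddCommGroup E] [NormedSpace ℂ E]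
    {A B : TorusL2 d →L[ℂ] E} (h : ∀ n, A (expBasis d n) = B (expBasis d n)) : A = B := by
  refine ContinuousLinearMap.ext_on (s := Set.range (expBasis d)) ?_ ?_
  · exact Submodule.dense_iff_topologicalClosure_eq_top.mpr (expBasis d).dense_span
  · rintro _ ⟨n, rfl⟩; exact h n

/-- The functions in `L²` of the torus with spectrum in `Sig`. -/
noncomputable def specSpace (Sig : Set (Fin d → ℤ)) : Submodule ℂ (TorusL2 d) :=
  (Submodule.span ℂ (expBasis d '' Sigᶜ))ᗮ

theorem mem_specSpace {Sig : Set (Fin d → ℤ)} {f : TorusL2 d} :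
    f ∈ specSpace Sig ↔ ∀ n ∉ Sig, ⟪expBasis d n, f⟫_ℂ = 0 := by
  rw [specSpace, Submodule.mem_orthogonal]
  constructor
  · intro h n hn
    exact h _ (Submodule.subset_span ⟨n, hn, rfl⟩)
  · intro h u hu
    induction hu using Submodule.span_induction with
    | mem x hx => obtain ⟨n, hn, rfl⟩ := hx; exact h n hn
    | zero => simp
    | add x y _ _ hx hy => rw [inner_add_left, hx, hy, add_zero]
    | smul a x _ hx => rw [inner_smul_left, hx, mul_zero]

theorem expBasis_mem_specSpace {Sig : Set (Fin d → ℤ)} {n : Fin d → ℤ} (hn : n ∈ Sig) :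
    expBasis d n ∈ specSpace Sig := by
  rw [mem_specSpace]
  intro m hm
  rw [expBasis_inner, if_neg (by rintro rfl; exact hm hn)]

theorem isClosed_specSpace (Sig : Set (Fin d → ℤ)) : IsClosed (specSpace Sig : Set (TorusL2 d)) :=
  Submodule.isClosed_orthogonal _

instance (Sig : Set (Fin d → ℤ)) : CompleteSpace (specSpace Sig) :=
  (isClosed_specSpace Sig).completeSpace_coe

/-- The orthogonal projection onto the functions with spectrum in `Sig`. -/
noncomputable def specProj (Sig : Set (Fin d → ℤ)) : TorusL2 d →L[ℂ] TorusL2 d :=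
  (specSpace Sig).starProjection

theorem specProj_eq_self_iff {Sig : Set (Fin d → ℤ)} {f : TorusL2 d} :
    specProj Sig f = f ↔ f ∈ specSpace Sig :=
  Submodule.starProjection_eq_self_iff

open Classical in
theorem specProj_expBasis (Sig : Set (Fin d → ℤ)) (n : Fin d → ℤ) :
    specProj Sig (expBasis d n) = if n ∈ Sig then expBasis d n else 0 := by
  split_ifs with h
  · exact specProj_eq_self_iff.mpr (expBasis_mem_specSpace h)
  · rw [specProj, Submodule.starProjection_apply_eq_zero_iff, Submodule.mem_orthogonal']
    exact fun u hu => mem_specSpace.mp hu n h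

open Classical in
theorem inner_specProj (Sig : Set (Fin d → ℤ)) (n : Fin d → ℤ) (f : TorusL2 d) :
    ⟪expBasis d n, specProj Sig f⟫_ℂ = if n ∈ Sig then ⟪expBasis d n, f⟫_ℂ else 0 := by
  rw [specProj, ← Submodule.inner_starProjection_left_eq_right]
  change ⟪specProj Sig (expBasis d n), f⟫_ℂ = _
  rw [specProj_expBasis]
  split_ifs <;> simp

theorem specProj_eq_zero_iff {Sig : Set (Fin d → ℤ)} {f : TorusL2 d} :
    specProj Sig f = 0 ↔ ∀ n ∈ Sig, ⟪expBasis d n, f⟫_ℂ = 0 := by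
  classical
  constructor
  · intro h n hn
    have := inner_specProj Sig n f
    rw [h, inner_zero_right, if_pos hn] at this
    exact this.symm
  · intro h
    apply expBasis_ext
    intro n
    rw [inner_specProj, inner_zero_right]
    split_ifs with hn
    · exact h n hn
    · rfl

theorem measurePreserving_add_const (v : UnitAddTorus (Fin d)) :
    MeasurePreserving (fun x => x + v) (torusMeasure d) (torusMeasure d) :=
  measurePreserving_add_right _ v

/-- Translation by `v`, as an operator on `L²` of the torus. -/
noncomputable def translOp (v : UnitAddTorus (Fin d)) : TorusL2 d →ₗᵢ[ℂ] TorusL2 d :=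
  Lp.compMeasurePreservingₗᵢ ℂ (fun x => x + v) (measurePreserving_add_const v)

theorem translOp_ae (v : UnitAddTorus (Fin d)) (f : TorusL2 d) :
    translOp v f =ᵐ[torusMeasure d] fun x => f (x + v) :=
  Lp.coeFn_compMeasurePreserving f (measurePreserving_add_const v)

theorem mFourier_add_right (n : Fin d → ℤ) (x v : UnitAddTorus (Fin d)) :
    UnitAddTorus.mFourier n (x + v) = UnitAddTorus.mFourier n x * UnitAddTorus.mFourier n v := by
  simp [UnitAddTorus.mFourier, fourier_apply, smul_add, AddCircle.toCircle_add,
    Finset.prod_mul_distrib]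

theorem norm_mFourier_apply (n : Fin d → ℤ) (x : UnitAddTorus (Fin d)) :
    ‖UnitAddTorus.mFourier n x‖ = 1 := by
  simp only [UnitAddTorus.mFourier, fourier_apply, ContinuousMap.coe_mk, norm_prod]
  exact Finset.prod_eq_one fun i _ => Circle.norm_coe _

theorem translOp_expBasis (v : UnitAddTorus (Fin d)) (n : Fin d → ℤ) :
    translOp v (expBasis d n) = UnitAddTorus.mFourier n v • expBasis d n := by
  apply Lp.ext
  have h := (measurePreserving_add_const v).quasiMeasurePreserving.ae (expBasis_ae n)
  filter_upwards [translOp_ae v (expBasis d n), h, expBasis_ae n,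
    Lp.coeFn_smul (UnitAddTorus.mFourier n v) (expBasis d n)] with x h1 h2 h3 h4
  rw [h1, h2, h4, Pi.smul_apply, h3, mFourier_add_right, smul_eq_mul, mul_comm]

theorem inner_translOp (v : UnitAddTorus (Fin d)) (n : Fin d → ℤ) (f : TorusL2 d) :
    ⟪expBasis d n, translOp v f⟫_ℂ = UnitAddTorus.mFourier n v * ⟪expBasis d n, f⟫_ℂ := by
  have h1 : ⟪translOp v (expBasis d n), translOp v f⟫_ℂ = ⟪expBasis d n, f⟫_ℂ :=
    LinearIsometry.inner_map_map _ _ _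
  rw [translOp_expBasis, inner_smul_left] at h1
  rw [← h1, ← mul_assoc, Complex.mul_conj, Complex.normSq_eq_norm_sq, norm_mFourier_apply]
  simp

/-- A restriction operator commutes with a spectral projection if the translations preserving the
set separate the frequencies inside the spectrum from those outside. -/
theorem restrOp_specProj_comm {Q : Set (UnitAddTorus (Fin d))} (hQ : MeasurableSet Q)
    {Sig : Set (Fin d → ℤ)}
    (h : ∀ m ∈ Sig, ∀ n ∉ Sig, ∃ v : UnitAddTorus (Fin d), (∀ x, x + v ∈ Q ↔ x ∈ Q) ∧
      UnitAddTorus.mFourier m v ≠ UnitAddTorus.mFourier n v) (f : TorusL2 d) :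
    specProj Sig (restrOp _ Q hQ f) = restrOp _ Q hQ (specProj Sig f) := by
  classical
  suffices H : (specProj Sig).comp (restrOp _ Q hQ) = (restrOp _ Q hQ).comp (specProj Sig) from
    DFunLike.congr_fun H f
  -- Translation by `v` commutes with the restriction and has different eigenvalues on the two
  -- exponentials, so their matrix coefficient is zero.
  have hz : ∀ m n, (∃ v : UnitAddTorus (Fin d), (∀ x, x + v ∈ Q ↔ x ∈ Q) ∧
      UnitAddTorus.mFourier m v ≠ UnitAddTorus.mFourier n v) →
      ⟪expBasis d m, restrOp _ Q hQ (expBasis d n)⟫_ℂ = 0 := by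
    rintro m n ⟨v, hv, hne⟩
    have hc : translOp v (restrOp _ Q hQ (expBasis d n)) =
        restrOp _ Q hQ (translOp v (expBasis d n)) := by
      apply Lp.ext
      have h := (measurePreserving_add_const v).quasiMeasurePreserving.ae
        (restrOp_ae (μ := torusMeasure d) (hS := hQ) (expBasis d n))
      filter_upwards [translOp_ae v (restrOp _ Q hQ (expBasis d n)), h,
        restrOp_ae (hS := hQ) (translOp v (expBasis d n)), translOp_ae v (expBasis d n)]
        with x h1 h2 h3 h4
      rw [h1, h2, h3]
      by_cases hx : x ∈ Q
      · simp [hx, (hv x).mpr hx, h4]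
      · simp [hx, mt (hv x).mp hx]
    have h2 := inner_translOp v m (restrOp _ Q hQ (expBasis d n))
    rw [hc, translOp_expBasis, map_smul, inner_smul_right] at h2
    by_contra h0
    exact hne (mul_right_cancel₀ h0 h2).symm
  apply clm_ext_expBasis
  intro n
  apply expBasis_ext
  intro m
  rw [ContinuousLinearMap.comp_apply, ContinuousLinearMap.comp_apply, inner_specProj,
    specProj_expBasis]
  by_cases hm : m ∈ Sig <;> by_cases hn : n ∈ Sig <;> simp only [hm, hn, if_true, if_false]
  · rw [map_zero, inner_zero_right, hz m n (h m hm n hn)]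
  · obtain ⟨v, hv, hne⟩ := h n hn m hm
    rw [hz m n ⟨v, hv, hne.symm⟩]
  · rw [map_zero, inner_zero_right]

/-- `Sig` is a Riesz spectrum of the subset `S` of the torus: every function in `L²(S)` is the
restriction of exactly one function with spectrum in `Sig`. -/
def IsRieszSpectrum (S : Set (UnitAddTorus (Fin d))) (Sig : Set (Fin d → ℤ)) : Prop :=
  (∀ f : TorusL2 d, ∃ F ∈ specSpace Sig, ∀ᵐ x ∂torusMeasure d, x ∈ S → F x = f x) ∧
  ∀ F ∈ specSpace Sig, (∀ᵐ x ∂torusMeasure d, x ∈ S → F x = 0) → F = 0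

theorem isRieszSpectrum_iff {S : Set (UnitAddTorus (Fin d))} {Sig : Set (Fin d → ℤ)}
    (hS : MeasurableSet S) : IsRieszSpectrum S Sig ↔
      (∀ f, ∃ F ∈ specSpace Sig, restrOp _ S hS F = restrOp _ S hS f) ∧
      ∀ F ∈ specSpace Sig, restrOp _ S hS F = 0 → F = 0 := by
  simp only [IsRieszSpectrum, restrOp_eq_iff, restrOp_eq_zero_iff]

theorem isRieszSpectrum_empty : IsRieszSpectrum (∅ : Set (UnitAddTorus (Fin d))) ∅ := by
  refine ⟨fun f => ⟨0, zero_mem _, by simp⟩, fun F hF _ => expBasis_ext fun n => ?_⟩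
  rw [mem_specSpace.mp hF n (by simp), inner_zero_right]

theorem isRieszSpectrum_univ : IsRieszSpectrum (Set.univ : Set (UnitAddTorus (Fin d))) Set.univ := by
  refine ⟨fun f => ⟨f, mem_specSpace.mpr (by simp), by simp⟩, fun F hF h => ?_⟩
  rw [Lp.eq_zero_iff_ae_eq_zero]
  filter_upwards [h] with x hx using hx trivial

end Spectral

/-! ### Complements of Riesz spectra, and their combination over cells. -/

section Combine

variable {d : ℕ}

/-- Riesz spectra are stable under simultaneous complementation. -/
theorem IsRieszSpectrum.compl {S : Set (UnitAddTorus (Fin d))} {Sig : Set (Fin d → ℤ)}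
    (hS : MeasurableSet S) (h : IsRieszSpectrum S Sig) : IsRieszSpectrum Sᶜ Sigᶜ := by
  rw [isRieszSpectrum_iff hS] at h
  obtain ⟨hex, huniq⟩ := h
  set U := specSpace Sig
  set V : Submodule ℂ (TorusL2 d) := (restrOp (torusMeasure d) S hS).ker with hV
  have hVmem : ∀ f, f ∈ V ↔ restrOp (torusMeasure d) S hS f = 0 := fun f => Iff.rfl
  have hVc : IsClosed (V : Set (TorusL2 d)) := (restrOp (torusMeasure d) S hS).isClosed_ker
  have hc : IsCompl U V := by
    rw [isCompl_iff, Submodule.disjoint_def, Submodule.codisjoint_iff_exists_add_eq]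
    refine ⟨fun F hF h => huniq F hF h, fun f => ?_⟩
    obtain ⟨F, hF, hFf⟩ := hex f
    exact ⟨F, f - F, hF, by rw [hVmem, map_sub, hFf, sub_self], by abel⟩
  -- The Riesz spectrum property says that `U` and the functions vanishing on `S` are complementary.
  -- The oblique projection `E` onto `U` along `V` has as adjoint a projection along the orthogonal
  -- complement of `U` onto that of `V`: this is the dual splitting, the one needed for the
  -- complements.
  set E : TorusL2 d →L[ℂ] TorusL2 d :=
    U.subtypeL ∘L (U.projectionOntoL V (Submodule.IsCompl.isTopCompl_of_isClosed hc (isClosed_specSpace _) hVc))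
    with hE
  have hEU : ∀ u ∈ U, E u = u := by
    intro u hu
    simp [hE, Submodule.projectionOntoL_apply_left _ ⟨u, hu⟩]
  have hEV : ∀ v ∈ V, E v = 0 := by
    intro v hv
    simp [hE, hv]
  have hrestr : ∀ f g : TorusL2 d, ⟪restrOp (torusMeasure d) Sᶜ hS.compl f, g⟫_ℂ =
      ⟪f, restrOp (torusMeasure d) Sᶜ hS.compl g⟫_ℂ := by
    intro f g
    rw [L2.inner_def, L2.inner_def]
    apply integral_congr_ae
    filter_upwards [restrOp_ae (hS := hS.compl) f, restrOp_ae (hS := hS.compl) g] with x h1 h2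
    rw [h1, h2]
    by_cases hx : x ∈ S <;> simp [hx]
  have hrV : ∀ f, restrOp (torusMeasure d) Sᶜ hS.compl f ∈ V := by
    intro f
    rw [hVmem, restrOp_eq_zero_iff]
    filter_upwards [restrOp_ae (hS := hS.compl) f] with x h1 hx
    rw [h1]; simp [hx]
  have hVr : ∀ v ∈ V, restrOp (torusMeasure d) Sᶜ hS.compl v = v := by
    intro v hv
    rw [hVmem, restrOp_eq_zero_iff] at hv
    rw [restrOp_eq_self_iff]
    filter_upwards [hv] with x h hx
    exact h (by simpa using hx)
  rw [isRieszSpectrum_iff hS.compl]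
  constructor
  · intro f
    -- `f - E.adjoint f` is orthogonal to `U`, so its spectrum lies in `Sigᶜ`; `E.adjoint f` is
    -- orthogonal to `V`, so it vanishes on `Sᶜ`.
    refine ⟨f - E.adjoint f, ?_, ?_⟩
    · rw [mem_specSpace]
      intro n hn
      rw [inner_sub_right, ContinuousLinearMap.adjoint_inner_right,
        hEU _ (expBasis_mem_specSpace (not_not.mp hn)), sub_self]
    · rw [map_sub, sub_eq_self]
      refine ext_inner_left ℂ fun g => ?_
      rw [← hrestr, ContinuousLinearMap.adjoint_inner_right, hEV _ (hrV g)]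
      simp
  · intro F hF hF0
    refine ext_inner_left ℂ fun g => ?_
    rw [inner_zero_right]
    -- `F` is orthogonal to `V` because it vanishes on `Sᶜ`, and to `U` because of its spectrum;
    -- together these span.
    obtain ⟨u, v, hu, hv, rfl⟩ := (Submodule.codisjoint_iff_exists_add_eq.mp hc.codisjoint) g
    rw [inner_add_left, ← hVr v hv, hrestr, hF0, inner_zero_right, add_zero]
    have : F ∈ Uᗮ := by
      have hUU : U ≤ (specSpace Sigᶜ)ᗮ := by
        intro w hw
        rw [specSpace, compl_compl]
        have hcl : (specSpace Sigᶜ) = (Submodule.span ℂ (expBasis d '' Sig))ᗮ := by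
          rw [specSpace, compl_compl]
        rw [Submodule.orthogonal_orthogonal_eq_closure, ← SetLike.mem_coe,
          Submodule.topologicalClosure_coe]
        have h2 := (expBasis d).hasSum_repr w
        refine mem_closure_of_tendsto h2 (.of_forall fun s => ?_)
        refine Submodule.sum_mem _ fun n _ => ?_
        by_cases hn : n ∈ Sig
        · exact Submodule.smul_mem _ _ (Submodule.subset_span ⟨n, hn, rfl⟩)
        · rw [HilbertBasis.repr_apply_apply, mem_specSpace.mp hw n hn, zero_smul]
          exact zero_mem _
      rw [Submodule.mem_orthogonal]
      intro w hw
      have := (Submodule.mem_orthogonal' _ _).mp (hUU hw) F hF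
      exact this
    exact (Submodule.mem_orthogonal _ _).mp this u hu

/-- The combination principle for Riesz spectra. The torus is partitioned into the cells of the
labelling `lab`, the frequencies are partitioned by `r`, and `n k` is the level of the cell `k`. -/
theorem isRieszSpectrum_of_chain {K : Type*} [Finite K] (lab : UnitAddTorus (Fin d) → K)
    (hlab : ∀ k, MeasurableSet (lab ⁻¹' {k})) (n : K → ℕ) (m : ℕ)
    (r : (Fin d → ℤ) → ℕ) (hr : ∀ z, r z < m)
    (hcomm : ∀ k j f, specProj {z | r z = j} (restrOp _ (lab ⁻¹' {k}) (hlab k) f) =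
      restrOp _ (lab ⁻¹' {k}) (hlab k) (specProj {z | r z = j} f))
    {S : Set (UnitAddTorus (Fin d))} (hS : MeasurableSet S)
    (Γ : ℕ → Set (Fin d → ℤ)) (hΓ : ∀ i, ∀ z ∈ Γ i, r z = i)
    (hA : ∀ i < m, ∀ f ∈ specSpace {z | r z = i}, ∃ F ∈ specSpace (Γ i),
      ∀ᵐ x ∂torusMeasure d, i < n (lab x) → F x = f x)
    (hA' : ∀ i < m, ∀ F ∈ specSpace (Γ i),
      (∀ᵐ x ∂torusMeasure d, i < n (lab x) → F x = 0) → F = 0)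
    (hB : ∀ k, ∀ f : TorusL2 d, (∀ᵐ x ∂torusMeasure d, lab x ≠ k → f x = 0) →
      ∃ F ∈ specSpace {z | r z < n k}, (∀ᵐ x ∂torusMeasure d, lab x ≠ k → F x = 0) ∧
        ∀ᵐ x ∂torusMeasure d, x ∈ S → F x = f x)
    (hB' : ∀ k, ∀ F ∈ specSpace {z | r z < n k}, (∀ᵐ x ∂torusMeasure d, lab x ≠ k → F x = 0) →
      (∀ᵐ x ∂torusMeasure d, x ∈ S → F x = 0) → F = 0) :
    IsRieszSpectrum S (⋃ i, Γ i) := by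
  classical
  have := Fintype.ofFinite K
  set p : K → TorusL2 d →ₗ[ℂ] TorusL2 d := fun k => (restrOp _ (lab ⁻¹' {k}) (hlab k)).toLinearMap
    with hpdef
  set lam : ℕ → TorusL2 d →ₗ[ℂ] TorusL2 d := fun j => (specProj {z | r z = j}).toLinearMap
    with hlamdef
  have hpself : ∀ k f, p k f = f ↔ ∀ᵐ x ∂torusMeasure d, lab x ≠ k → f x = 0 := fun k f =>
    restrOp_eq_self_iff
  have hp : ∀ k l f, p k (p l f) = if k = l then p l f else 0 := by
    intro k l f
    change restrOp _ _ (hlab k) (restrOp _ _ (hlab l) f) = _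
    split_ifs with h
    · subst h
      change restrOp _ _ (hlab k) (restrOp _ _ (hlab k) f) = restrOp _ _ (hlab k) f
      rw [restrOp_eq_self_iff]
      filter_upwards [restrOp_ae (hS := hlab k) f] with x h1 hx
      rw [h1, Set.indicator_of_notMem hx]
    · rw [restrOp_eq_zero_iff]
      filter_upwards [restrOp_ae (hS := hlab l) f] with x h1 hx
      rw [h1, Set.indicator_of_notMem]
      intro hx'
      exact h (hx.symm.trans hx')
  have hp1 : ∀ f, ∑ k, p k f = f := by
    intro f
    have hsum : (∑ k, p k f : TorusL2 d) =ᵐ[torusMeasure d] fun x => ∑ k, p k f x := by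
      have := Lp.coeFn_finsetSum Finset.univ (fun k => p k f)
      filter_upwards [this] with x hx
      rw [hx, Finset.sum_apply]
    apply Lp.ext
    have hall : ∀ᵐ x ∂torusMeasure d, ∀ k, p k f x = (lab ⁻¹' {k}).indicator f x :=
      ae_all_iff.mpr fun k => restrOp_ae (hS := hlab k) f
    filter_upwards [hsum, hall] with x h1 h2
    rw [h1, Finset.sum_congr rfl fun k _ => h2 k, Finset.sum_eq_single (lab x)]
    · simp
    · intro k _ hk
      rw [Set.indicator_of_notMem]
      intro h; exact hk h.symm
    · simp
  have hlam : ∀ i j f, lam i (lam j f) = if i = j then lam j f else 0 := by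
    intro i j f
    apply expBasis_ext
    intro z
    change ⟪_, specProj _ (specProj _ f)⟫_ℂ = ⟪_, if i = j then specProj _ f else 0⟫_ℂ
    rw [inner_specProj, inner_specProj]
    by_cases hij : i = j
    · subst hij
      rw [if_pos rfl, inner_specProj]
      by_cases hz : r z = i <;> simp [hz]
    · rw [if_neg hij]
      by_cases hz : r z = i
      · have : r z ≠ j := fun h => hij (hz.symm.trans h)
        simp [this]
      · simp [hz]
  have hlamself : ∀ i f, lam i f = f ↔ f ∈ specSpace {z | r z = i} := fun i f =>
    specProj_eq_self_iff
  have hΓle : ∀ i, specSpace (Γ i) ≤ specSpace {z | r z = i} := by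
    intro i f hf
    rw [mem_specSpace] at hf ⊢
    exact fun z hz => hf z fun h => hz (hΓ i z h)
  have hpeq : ∀ k f g, p k f = p k g ↔ ∀ᵐ x ∂torusMeasure d, lab x = k → f x = g x :=
    fun k f g => restrOp_eq_iff
  have hlow : ∀ k F, (∀ j < m, n k ≤ j → lam j F = 0) ↔ F ∈ specSpace {z | r z < n k} := by
    intro k F
    rw [mem_specSpace]
    constructor
    · intro h z hz
      exact specProj_eq_zero_iff.mp (h (r z) (hr z) (by simpa using hz)) z rfl
    · intro h j _ hj
      refine specProj_eq_zero_iff.mpr fun z hz => h z ?_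
      simp only [Set.mem_ofPred_eq] at hz ⊢
      omega
  have hspec : ∀ F, F ∈ specSpace (⋃ i, Γ i) ↔ ∀ i < m, lam i F ∈ specSpace (Γ i) := by
    intro F
    simp only [mem_specSpace, hlamdef, ContinuousLinearMap.coe_coe, inner_specProj,
      Set.mem_iUnion, not_exists]
    constructor
    · intro h i _ z hz
      split_ifs with hzi
      · refine h z fun j hj => hz ?_
        have : j = i := (hΓ j z hj).symm.trans hzi
        rwa [← this]
      · rfl
    · intro h z hz
      have := h (r z) (hr z) z (hz _)
      rwa [if_pos (show z ∈ {w | r w = r z} from rfl)] at this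
  rw [isRieszSpectrum_iff hS]
  constructor
  · intro f
    obtain ⟨F, hF, hFf⟩ := exists_of_chain p n m hp hp1 lam hlam (fun i => specSpace (Γ i))
      (fun i _ f hf => (hlamself i f).mpr (hΓle i hf)) (restrOp _ S hS).toLinearMap
      (fun i hi f hf => by
        obtain ⟨F, hFU, hF⟩ := hA i hi f ((hlamself i f).mp hf)
        refine ⟨F, hFU, fun k hk => (hpeq k F f).mpr ?_⟩
        filter_upwards [hF] with x hx hxk
        exact hx (hxk ▸ hk))
      (fun k f hf => by
        obtain ⟨F, h1, h2, h3⟩ := hB k f ((hpself k f).mp hf)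
        exact ⟨F, (hpself k F).mpr h2, (hlow k F).mpr h1, restrOp_eq_iff.mpr h3⟩) f
    exact ⟨F, (hspec F).mpr hF, hFf⟩
  · intro F hF hF0
    refine eq_zero_of_chain p n m (fun k f => by rw [hp, if_pos rfl]) lam ?_
      (fun i k f => hcomm k i f) (fun i => specSpace (Γ i)) (restrOp _ S hS).toLinearMap ?_ ?_ ?_
      F ((hspec F).mp hF) hF0
    · intro f hf
      apply expBasis_ext
      intro z
      rw [inner_zero_right]
      exact specProj_eq_zero_iff.mp (hf (r z) (hr z)) z rfl
    · intro k f
      change restrOp _ S hS (restrOp _ _ (hlab k) f) = restrOp _ _ (hlab k) (restrOp _ S hS f)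
      rw [restrOp_restrOp, restrOp_restrOp]
      congr 2
      exact Set.inter_comm _ _
    · intro i hi F hFU h
      refine hA' i hi F hFU ?_
      have hall : ∀ᵐ x ∂torusMeasure d, ∀ k, i < n k → lab x = k → F x = 0 := by
        rw [ae_all_iff]
        intro k
        by_cases hk : i < n k
        · have h2 : ∀ᵐ x ∂torusMeasure d, lab x = k → F x = 0 :=
            restrOp_eq_zero_iff (hS := hlab k).mp (h k hk)
          filter_upwards [h2] with x hx _ using hx
        · exact .of_forall fun x h => absurd h hk
      filter_upwards [hall] with x hx hlt
      exact hx (lab x) hlt rfl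
    · intro k F h1 h2 h3
      exact hB' k F ((hlow k F).mp h2) ((hpself k F).mp h1) (restrOp_eq_zero_iff.mp h3)

end Combine

/-! ### Sets described by their sections in one coordinate direction. -/

section Product

variable {d : ℕ}

theorem mFourier_apply_single (n : Fin d → ℤ) (i : Fin d) (s : UnitAddCircle) :
    UnitAddTorus.mFourier n (Pi.single i s : Fin d → UnitAddCircle) = fourier (n i) s := by
  rw [UnitAddTorus.mFourier, ContinuousMap.coe_mk, Finset.prod_eq_single i]
  · simp
  · intro j _ hj
    simp [Pi.single_eq_of_ne hj]
  · simp

/-- At `1 / (2 (a - b))` the quotient of the two characters is `-1`. -/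
theorem exists_fourier_ne {a b : ℤ} (h : a ≠ b) : ∃ s : UnitAddCircle, fourier a s ≠ fourier b s := by
  refine ⟨((1 / (2 * (a - b : ℝ)) : ℝ) : UnitAddCircle), fun he => ?_⟩
  have hab : (a - b : ℝ) ≠ 0 := sub_ne_zero.mpr (by exact_mod_cast h)
  rw [fourier_apply, fourier_apply] at he
  have h1 := AddCircle.injective_toCircle one_ne_zero (Subtype.ext he)
  rw [← sub_eq_zero, ← sub_smul, ← AddCircle.coe_zsmul, AddCircle.coe_eq_zero_iff] at h1
  obtain ⟨n, hn⟩ := h1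
  have h2 : (n : ℝ) = 1 / 2 := by
    rw [zsmul_eq_mul, zsmul_eq_mul, mul_one] at hn
    rw [hn]; push_cast; field_simp
  have h3 : (2 * n : ℤ) = 1 := by
    have : (2 * n : ℝ) = 1 := by rw [h2]; norm_num
    exact_mod_cast this
  omega

/-- A set invariant under translations in the `i`-th coordinate: its restriction operator
commutes with the spectral projections onto sets described by the `i`-th frequency. -/
theorem restrOp_specProj_comm_of_coord {Q : Set (UnitAddTorus (Fin d))} (hQ : MeasurableSet Q)
    (i : Fin d) (hinv : ∀ x v, x + Pi.single i v ∈ Q ↔ x ∈ Q) {Sig : Set (Fin d → ℤ)}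
    (hSig : ∀ m n : Fin d → ℤ, m i = n i → m ∈ Sig → n ∈ Sig) (f : TorusL2 d) :
    specProj Sig (restrOp _ Q hQ f) = restrOp _ Q hQ (specProj Sig f) := by
  refine restrOp_specProj_comm hQ (fun m hm n hn => ?_) f
  obtain ⟨s, hs⟩ := exists_fourier_ne (a := m i) (b := n i) fun h => hn (hSig m n h hm)
  exact ⟨Pi.single i s, fun x => hinv x s, by rwa [mFourier_apply_single, mFourier_apply_single]⟩

theorem specSpace_mono {Sig Sig' : Set (Fin d → ℤ)} (h : Sig ⊆ Sig') :
    specSpace Sig ≤ specSpace Sig' := by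
  intro f hf
  rw [mem_specSpace] at hf ⊢
  exact fun n hn => hf n fun h' => hn (h h')

/-- A Riesz spectrum remains one within the functions with spectrum in `L`, if the spectral
projection onto `L` commutes with the restriction operator. -/
theorem IsRieszSpectrum.exists_mem_inter {Q : Set (UnitAddTorus (Fin d))} {Γ L : Set (Fin d → ℤ)}
    (h : IsRieszSpectrum Q Γ) (hQ : MeasurableSet Q)
    (hcomm : ∀ f, specProj L (restrOp _ Q hQ f) = restrOp _ Q hQ (specProj L f))
    {f : TorusL2 d} (hf : f ∈ specSpace L) :
    ∃ F ∈ specSpace (Γ ∩ L), ∀ᵐ x ∂torusMeasure d, x ∈ Q → F x = f x := by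
  obtain ⟨F, hF, hFf⟩ := h.1 f
  refine ⟨specProj L F, ?_, ?_⟩
  · rw [mem_specSpace]
    intro n hn
    rw [inner_specProj]
    split_ifs with hL
    · exact mem_specSpace.mp hF n fun h => hn ⟨h, hL⟩
    · rfl
  · rw [← restrOp_eq_iff (hS := hQ)] at hFf ⊢
    rw [← hcomm, hFf, hcomm, specProj_eq_self_iff.mpr hf]

/-- If the sections of a set in the `i`-th direction are constant on the cells of a labelling that
does not depend on the `i`-th coordinate, and each section is empty, full, or has the Riesz
spectrum `Lam`, then the set has a Riesz spectrum, provided that the unions of cells have. -/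
theorem exists_isRieszSpectrum_of_sections (i : Fin d) {K : Type*} [Finite K]
    (lab : UnitAddTorus (Fin d) → K) (hlab : ∀ k, MeasurableSet (lab ⁻¹' {k}))
    (hinv : ∀ x v, lab (x + Pi.single i v) = lab x)
    (hcell : ∀ κ : Set K, ∃ Γ, IsRieszSpectrum (lab ⁻¹' κ) Γ)
    (C : K → Set UnitAddCircle) (hC : ∀ k, MeasurableSet (C k)) (Lam : Set ℤ)
    (hsec : ∀ k, C k = ∅ ∨ C k = Set.univ ∨
      IsRieszSpectrum {x : UnitAddTorus (Fin d) | x i ∈ C k} {n | n i ∈ Lam}) :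
    ∃ Sig, IsRieszSpectrum {x | x i ∈ C (lab x)} Sig := by
  classical
  have hlab' : ∀ κ : Set K, MeasurableSet (lab ⁻¹' κ) := by
    intro κ
    have : lab ⁻¹' κ = ⋃ k ∈ κ, lab ⁻¹' {k} := by ext x; simp
    rw [this]
    exact MeasurableSet.biUnion κ.to_countable fun k _ => hlab k
  have hS : MeasurableSet {x | x i ∈ C (lab x)} := by
    have : {x | x i ∈ C (lab x)} = ⋃ k, lab ⁻¹' {k} ∩ {x | x i ∈ C k} := by ext x; simp
    rw [this]
    exact MeasurableSet.iUnion fun k => (hlab k).inter (measurable_pi_apply i (hC k))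
  -- The frequencies fall into two classes, inside and outside `Lam`. The level of a cell is the
  -- number of classes its section needs: none if empty, both if full, and the first alone
  -- otherwise.
  set n : K → ℕ := fun k => if C k = ∅ then 0 else if C k = Set.univ then 2 else 1 with hn
  set r : (Fin d → ℤ) → ℕ := fun z => if z i ∈ Lam then 0 else 1 with hr
  choose Γ' hΓ' using fun j : ℕ => hcell {k | j < n k}
  have hri : ∀ m z : Fin d → ℤ, m i = z i → r m = r z := fun m z h => by simp [hr, h]
  have hcomm : ∀ (κ : Set K) (A : Set ℕ) f, specProj {z | r z ∈ A} (restrOp _ (lab ⁻¹' κ) (hlab' κ) f) =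
      restrOp _ (lab ⁻¹' κ) (hlab' κ) (specProj {z | r z ∈ A} f) := by
    intro κ A f
    refine restrOp_specProj_comm_of_coord _ i (fun x v => by simp [hinv]) (fun m z h hm => ?_) f
    simp only [Set.mem_ofPred_eq] at hm ⊢
    rwa [← hri m z h]
  refine ⟨_, isRieszSpectrum_of_chain lab hlab n 2 r (fun z => ?_) (fun k j f => hcomm {k} {j} f)
    hS (fun j => Γ' j ∩ {z | r z = j}) (fun j z hz => hz.2) ?_ ?_ ?_ ?_⟩
  · simp only [hr]; split_ifs <;> omega
  · intro j _ f hf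
    exact (hΓ' j).exists_mem_inter (hlab' _) (hcomm _ {j}) hf
  · intro j _ F hF h
    exact (hΓ' j).2 F (specSpace_mono Set.inter_subset_left hF) h
  · intro k f hf
    rcases hsec k with h | h | h
    · refine ⟨0, zero_mem _, ?_, ?_⟩
      · filter_upwards [Lp.coeFn_zero ℂ 2 (torusMeasure d)] with x hx _ using hx
      · filter_upwards [Lp.coeFn_zero ℂ 2 (torusMeasure d), hf] with x hx hfx hxS
        rw [hfx, hx]; · rfl
        rintro rfl
        simp [h] at hxS
    · refine ⟨f, mem_specSpace.mpr fun z hz => absurd ?_ hz, hf, by simp⟩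
      have hne : (Set.univ : Set UnitAddCircle) ≠ ∅ := Set.univ_nonempty.ne_empty
      simp only [hn, hr, Set.mem_ofPred_eq, h, if_neg hne, if_true]
      split_ifs <;> omega
    · by_cases h0 : C k = ∅
      · refine ⟨0, zero_mem _, ?_, ?_⟩
        · filter_upwards [Lp.coeFn_zero ℂ 2 (torusMeasure d)] with x hx _ using hx
        · filter_upwards [Lp.coeFn_zero ℂ 2 (torusMeasure d), hf] with x hx hfx hxS
          rw [hfx, hx]; · rfl
          rintro rfl
          simp [h0] at hxS
      obtain ⟨F, hF, hFf⟩ := h.1 f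
      have hsub : ({z | z i ∈ Lam} : Set (Fin d → ℤ)) ⊆ {z | r z < n k} := by
        intro z hz
        simp only [Set.mem_ofPred_eq] at hz
        simp only [hn, hr, Set.mem_ofPred_eq, if_pos hz, if_neg h0]
        split_ifs <;> omega
      -- `F` solves the problem on the whole slab over `C k`. Cutting it down to the cell keeps the
      -- spectrum, because the labels do not depend on the `i`-th coordinate.
      refine ⟨restrOp _ _ (hlab k) F, ?_, ?_, ?_⟩
      · have hF' : F ∈ specSpace {z | r z ∈ {j | j < n k}} := specSpace_mono hsub hF
        have h2 := hcomm {k} {j | j < n k} F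
        rw [specProj_eq_self_iff.mpr hF'] at h2
        exact specProj_eq_self_iff.mp h2
      · filter_upwards [restrOp_ae (hS := hlab k) F] with x hx hxk
        rw [hx, Set.indicator_of_notMem (show x ∉ lab ⁻¹' {k} from hxk)]
      · filter_upwards [restrOp_ae (hS := hlab k) F, hFf, hf] with x hx h1 h2 hxS
        rw [hx]
        by_cases hxk : lab x = k
        · rw [Set.indicator_of_mem (by exact hxk)]
          exact h1 (by simpa [hxk] using hxS)
        · rw [Set.indicator_of_notMem (show x ∉ lab ⁻¹' {k} from hxk), h2 hxk]
  · intro k F hF hFk hFS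
    by_cases h0 : C k = ∅
    · apply expBasis_ext
      intro z
      rw [inner_zero_right]
      refine mem_specSpace.mp hF z ?_
      simp [hn, h0]
    by_cases h1 : C k = Set.univ
    · rw [Lp.eq_zero_iff_ae_eq_zero]
      filter_upwards [hFk, hFS] with x h2 h3
      by_cases hxk : lab x = k
      · exact h3 (by simp [hxk, h1])
      · exact h2 hxk
    · have h := (hsec k).resolve_left h0 |>.resolve_left h1
      refine h.2 F (specSpace_mono (fun z hz => ?_) hF) ?_
      · by_contra hz'
        simp only [Set.mem_ofPred_eq] at hz'
        simp [hn, hr, h0, h1, hz'] at hz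
      · filter_upwards [hFk, hFS] with x h2 h3 hx
        by_cases hxk : lab x = k
        · exact h3 (by simpa [hxk] using hx)
        · exact h2 hxk

end Product

/-! ### Interpolation by low frequencies on `ZMod N`. -/

section Sampling

open ZMod Polynomial
open scoped ZMod

variable {N : ℕ} [NeZero N]

theorem stdAddChar_mul_val (l k : ZMod N) :
    stdAddChar (l * k) = (stdAddChar l : ℂ) ^ k.val := by
  rw [← AddChar.map_nsmul_eq_pow, nsmul_eq_mul, ZMod.natCast_zmod_val, mul_comm]

/-- A function on `ZMod N` with frequencies `< #σ` that vanishes on `σ` is zero. -/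
theorem eq_zero_of_dft_of_vanish (σ : Finset (ZMod N)) (v : ZMod N → ℂ)
    (hv : ∀ k : ZMod N, σ.card ≤ k.val → 𝓕 v k = 0) (h0 : ∀ l ∈ σ, v l = 0) : v = 0 := by
  -- Fourier inversion read as the values of a polynomial at roots of unity. Its degree is below the
  -- number of zeros in `σ`.
  set P : ℂ[X] := ∑ k : ZMod N, monomial k.val ((N : ℂ)⁻¹ * 𝓕 v k) with hP
  have heval : ∀ l, P.eval (stdAddChar l) = v l := by
    intro l
    have h1 : v l = 𝓕⁻ (𝓕 v) l := by simp
    rw [h1, invDFT_apply, hP, eval_finsetSum, smul_eq_mul, Finset.mul_sum]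
    refine Finset.sum_congr rfl fun k _ => ?_
    rw [eval_monomial, mul_comm k l, stdAddChar_mul_val, smul_eq_mul]
    ring
  have hdeg : P.degree < σ.card := by
    refine lt_of_le_of_lt (degree_sum_le _ _) ?_
    rw [Finset.sup_lt_iff (WithBot.bot_lt_coe _)]
    intro k _
    by_cases hk : σ.card ≤ k.val
    · rw [hv k hk]; simp
    · refine lt_of_le_of_lt (degree_monomial_le _ _) ?_
      exact_mod_cast not_le.mp hk
  have hP0 : P = 0 := eq_zero_of_degree_lt_of_eval_index_eq_zero (s := σ)
    (v := fun l : ZMod N => (stdAddChar l : ℂ)) injective_stdAddChar.injOn hdeg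
    (fun l hl => by rw [heval, h0 l hl])
  funext l
  rw [← heval, hP0, eval_zero, Pi.zero_apply]

/-- Interpolation from the nodes `σ` by frequencies `< #σ`. -/
noncomputable def sampleExt (σ : Finset (ZMod N)) (v : ZMod N → ℂ) (l : ZMod N) : ℂ :=
  (Lagrange.interpolate σ (fun l : ZMod N => (stdAddChar l : ℂ)) v).eval (stdAddChar l)

theorem sampleExt_of_mem {σ : Finset (ZMod N)} (v : ZMod N → ℂ) {l : ZMod N} (hl : l ∈ σ) :
    sampleExt σ v l = v l :=
  Lagrange.eval_interpolate_at_node v injective_stdAddChar.injOn hl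

/-- The interpolating polynomial has degree less than `σ.card`, and its powers are characters with
these small frequencies, orthogonal to the frequency `k`. -/
theorem dft_sampleExt (σ : Finset (ZMod N)) (v : ZMod N → ℂ) (k : ZMod N) (hk : σ.card ≤ k.val) :
    𝓕 (sampleExt σ v) k = 0 := by
  set P := Lagrange.interpolate σ (fun l : ZMod N => (stdAddChar l : ℂ)) v with hP
  have hdeg : P.degree < σ.card := Lagrange.degree_interpolate_lt v injective_stdAddChar.injOn
  have hN : σ.card ≤ N := hk.trans (ZMod.val_lt k).le
  by_cases h0 : P = 0
  · have : sampleExt σ v = 0 := funext fun l => by rw [sampleExt, ← hP, h0, eval_zero, Pi.zero_apply]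
    rw [this, map_zero, Pi.zero_apply]
  rw [dft_apply]
  have h1 : ∀ l : ZMod N, stdAddChar (-(l * k)) • sampleExt σ v l =
      ∑ j ∈ Finset.range σ.card, P.coeff j * stdAddChar (l * ((j : ZMod N) - k)) := by
    intro l
    rw [sampleExt, ← hP, eval_eq_sum_range' ((natDegree_lt_iff_degree_lt h0).mpr hdeg), smul_eq_mul,
      Finset.mul_sum]
    refine Finset.sum_congr rfl fun j hj => ?_
    have hj' : ((j : ZMod N)).val = j :=
      ZMod.val_natCast_of_lt (lt_of_lt_of_le (Finset.mem_range.mp hj) hN)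
    have : (stdAddChar l : ℂ) ^ j = stdAddChar (l * (j : ZMod N)) := by
      rw [stdAddChar_mul_val, hj']
    rw [this, mul_sub, sub_eq_add_neg, AddChar.map_add_eq_mul]
    ring
  rw [Finset.sum_congr rfl fun l _ => h1 l, Finset.sum_comm]
  refine Finset.sum_eq_zero fun j hj => ?_
  rw [← Finset.mul_sum, AddChar.sum_mulShift _ (isPrimitive_stdAddChar N), if_neg, Nat.cast_zero, mul_zero]
  rw [sub_eq_zero]
  intro h
  have hj' : ((j : ZMod N)).val = j :=
    ZMod.val_natCast_of_lt (lt_of_lt_of_le (Finset.mem_range.mp hj) hN)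
  have h2 := Finset.mem_range.mp hj
  rw [← h, hj'] at hk
  omega

/-- Interpolation commutes with translations of `ZMod N`. -/
theorem sampleExt_shift (σ σ' : Finset (ZMod N)) (a : ZMod N) (hσ : ∀ l, l ∈ σ' ↔ l + a ∈ σ)
    (v : ZMod N → ℂ) (l : ZMod N) :
    sampleExt σ' (fun m => v (m + a)) l = sampleExt σ v (l + a) := by
  have hcard : σ'.card = σ.card := by
    refine Finset.card_bij (fun l _ => l + a) (fun l hl => (hσ l).mp hl)
      (fun _ _ _ _ h => add_right_cancel h) (fun l hl => ⟨l - a, (hσ _).mpr (by simpa using hl), by simp⟩)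
  have hshift : ∀ (w : ZMod N → ℂ) k, 𝓕 (fun m => w (m + a)) k = stdAddChar (a * k) * 𝓕 w k := by
    intro w k
    rw [dft_apply, dft_apply, Finset.mul_sum, ← Equiv.sum_comp (Equiv.addRight a)
      (fun j => stdAddChar (a * k) * stdAddChar (-(j * k)) • w j)]
    refine Finset.sum_congr rfl fun j _ => ?_
    simp only [Equiv.coe_addRight, smul_eq_mul]
    rw [← mul_assoc, ← AddChar.map_add_eq_mul]
    congr 2
    ring
  -- Both sides have frequencies below the common cardinality and agree on `σ'`; uniqueness of
  -- interpolation does the rest.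
  have := eq_zero_of_dft_of_vanish σ'
    (sampleExt σ' (fun m => v (m + a)) - fun l => sampleExt σ v (l + a)) (fun k hk => ?_) ?_
  · exact sub_eq_zero.mp (congrFun this l)
  · rw [map_sub, Pi.sub_apply, dft_sampleExt _ _ _ hk, hshift, dft_sampleExt _ _ _ (hcard ▸ hk),
      mul_zero, sub_zero]
  · intro l hl
    rw [Pi.sub_apply, sampleExt_of_mem _ hl, sampleExt_of_mem _ ((hσ l).mp hl), sub_self]

/-- Interpolation is linear, with coefficients depending only on `σ` and `l`. This makes
interpolation along orbits a finite combination of translations, hence an operation within `L²`. -/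
theorem sampleExt_eq_sum (σ : Finset (ZMod N)) (l : ZMod N) :
    ∃ c : ZMod N → ℂ, ∀ v, sampleExt σ v l = ∑ j, c j * v j := by
  classical
  refine ⟨fun j => if j ∈ σ then
    (Lagrange.basis σ (fun l : ZMod N => (stdAddChar l : ℂ)) j).eval (stdAddChar l) else 0,
    fun v => ?_⟩
  rw [sampleExt, Lagrange.interpolate_apply, eval_finsetSum]
  simp only [ite_mul, zero_mul, Finset.sum_ite_mem, Finset.univ_inter, eval_mul, eval_C]
  exact Finset.sum_congr rfl fun j _ => mul_comm _ _

end Sampling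

/-! ### Dilation of one coordinate and residues of frequencies. -/

section Splitting

open ZMod
open scoped ZMod

variable {d : ℕ}

theorem norm_mulOp_of_unimodular {X : Type*} [MeasurableSpace X] {μ : Measure X} {φ : X → ℂ}
    {hφ : Measurable φ} {C : ℝ} {hC : ∀ x, ‖φ x‖ ≤ C} (h1 : ∀ x, ‖φ x‖ = 1) (f : Lp ℂ 2 μ) :
    ‖mulOp μ φ hφ C hC f‖ = ‖f‖ := by
  rw [Lp.norm_def, Lp.norm_def]
  congr 1
  apply eLpNorm_congr_norm_ae
  filter_upwards [mulOp_ae (hφ := hφ) (hC := hC) f] with x hx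
  rw [hx, norm_mul, h1, one_mul]

/-- Multiplication by the `N`-fold dilation in the `i`-th coordinate of the torus. -/
def dilation (i : Fin d) (N : ℕ) : UnitAddTorus (Fin d) →+ UnitAddTorus (Fin d) where
  toFun x := Function.update x i (N • x i)
  map_zero' := by simp
  map_add' x y := by
    ext j
    by_cases h : j = i
    · subst h; simp
    · simp [h]

theorem dilation_apply (i : Fin d) (N : ℕ) (x : UnitAddTorus (Fin d)) :
    dilation i N x = Function.update x i (N • x i) := rfl

theorem nsmul_surjective_unitAddCircle {N : ℕ} (hN : N ≠ 0) (s : UnitAddCircle) :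
    ∃ u : UnitAddCircle, N • u = s := by
  induction s using QuotientAddGroup.induction_on with
  | H x =>
    refine ⟨((x / N : ℝ) : UnitAddCircle), ?_⟩
    rw [← AddCircle.coe_nsmul, nsmul_eq_mul, mul_div_cancel₀ _ (by exact_mod_cast hN)]

theorem dilation_surjective (i : Fin d) {N : ℕ} (hN : N ≠ 0) :
    Function.Surjective (dilation i N) := by
  intro y
  obtain ⟨u, hu⟩ := nsmul_surjective_unitAddCircle hN (y i)
  exact ⟨Function.update y i u, by simp [dilation_apply, hu]⟩

theorem measurePreserving_dilation (i : Fin d) {N : ℕ} (hN : N ≠ 0) :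
    MeasurePreserving (dilation i N) (torusMeasure d) (torusMeasure d) := by
  refine AddMonoidHom.measurePreserving ?_ (dilation_surjective i hN) rfl
  change Continuous fun x : UnitAddTorus (Fin d) => Function.update x i (N • x i)
  fun_prop

/-- Multiplication by a monomial, as an operator on `L²` of the torus. -/
noncomputable def monomialOp (n : Fin d → ℤ) : TorusL2 d →L[ℂ] TorusL2 d :=
  mulOp (torusMeasure d) (UnitAddTorus.mFourier n) (UnitAddTorus.mFourier n).continuous.measurable
    1 (fun x => (norm_mFourier_apply n x).le)

/-- The operator `G ↦ e_r · (G ∘ dilation)`, with frequencies in the `i`-th direction moved from `m`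
to `r + N m`. -/
noncomputable def dilationOp (i : Fin d) {N : ℕ} (hN : N ≠ 0) (r : ℕ) :
    TorusL2 d →ₗᵢ[ℂ] TorusL2 d where
  toLinearMap := (monomialOp (Pi.single i (r : ℤ))).toLinearMap ∘ₗ
    (Lp.compMeasurePreservingₗᵢ ℂ (dilation i N) (measurePreserving_dilation i hN)).toLinearMap
  norm_map' f := by
    change ‖monomialOp _ (Lp.compMeasurePreservingₗᵢ ℂ (dilation i N)
      (measurePreserving_dilation i hN) f)‖ = _
    rw [monomialOp, norm_mulOp_of_unimodular (norm_mFourier_apply _), LinearIsometry.norm_map]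

theorem dilationOp_ae (i : Fin d) {N : ℕ} (hN : N ≠ 0) (r : ℕ) (f : TorusL2 d) :
    dilationOp i hN r f =ᵐ[torusMeasure d]
      fun x => UnitAddTorus.mFourier (Pi.single i (r : ℤ)) x * f (dilation i N x) := by
  have h1 : Lp.compMeasurePreservingₗᵢ ℂ (dilation i N) (measurePreserving_dilation i hN) f
      =ᵐ[torusMeasure d] f ∘ dilation i N :=
    Lp.coeFn_compMeasurePreserving f (measurePreserving_dilation i hN)
  have h2 : dilationOp i hN r f =ᵐ[torusMeasure d] _ := mulOp_ae
    (hφ := (UnitAddTorus.mFourier _).continuous.measurable) (hC := fun x => (norm_mFourier_apply _ x).le)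
    (Lp.compMeasurePreservingₗᵢ ℂ (dilation i N) (measurePreserving_dilation i hN) f)
  filter_upwards [h1, h2] with x h1 h2
  rw [h2, h1]; rfl

/-- The frequency map of `dilationOp`. -/
def dilationFreq (i : Fin d) (N r : ℕ) (m : Fin d → ℤ) : Fin d → ℤ :=
  Function.update m i (r + N * m i)

theorem dilationFreq_injective (i : Fin d) {N : ℕ} (hN : N ≠ 0) (r : ℕ) :
    Function.Injective (dilationFreq i N r) := by
  intro m n h
  funext j
  have hj := congrFun h j
  by_cases hji : j = i
  · subst hji
    simpa [dilationFreq, hN] using hj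
  · simpa [dilationFreq, hji] using hj

theorem dilationOp_expBasis (i : Fin d) {N : ℕ} (hN : N ≠ 0) (r : ℕ) (m : Fin d → ℤ) :
    dilationOp i hN r (expBasis d m) = expBasis d (dilationFreq i N r m) := by
  apply Lp.ext
  have h := (measurePreserving_dilation i hN).quasiMeasurePreserving.ae (expBasis_ae m)
  filter_upwards [dilationOp_ae i hN r (expBasis d m), h,
    expBasis_ae (dilationFreq i N r m)] with x h1 h2 h3
  rw [h1, h2, h3]
  simp only [UnitAddTorus.mFourier, ContinuousMap.coe_mk, ← Finset.prod_mul_distrib]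
  refine Finset.prod_congr rfl fun j _ => ?_
  by_cases hj : j = i
  · subst hj
    simp only [Pi.single_eq_same, dilation_apply, Function.update_self, dilationFreq, fourier_add]
    congr 1
    simp only [fourier_apply]
    congr 2
    rw [mul_comm, mul_smul, natCast_zsmul]
  · simp [hj, dilation_apply, dilationFreq]

theorem inner_dilationOp (i : Fin d) {N : ℕ} (hN : N ≠ 0) (r : ℕ) (m : Fin d → ℤ) (f : TorusL2 d) :
    ⟪expBasis d (dilationFreq i N r m), dilationOp i hN r f⟫_ℂ = ⟪expBasis d m, f⟫_ℂ := by
  rw [← dilationOp_expBasis i hN, LinearIsometry.inner_map_map]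

/-- The residue modulo `N` of the `i`-th frequency. -/
def freqResidue (i : Fin d) (N : ℕ) (z : Fin d → ℤ) : ℕ := (z i % N).toNat

theorem freqResidue_lt (i : Fin d) {N : ℕ} (hN : N ≠ 0) (z : Fin d → ℤ) :
    freqResidue i N z < N := by
  have := Int.emod_lt_of_pos (z i) (b := N) (by omega)
  rw [freqResidue]; omega

theorem freqResidue_dilationFreq (i : Fin d) {N r : ℕ} (hr : r < N) (m : Fin d → ℤ) :
    freqResidue i N (dilationFreq i N r m) = r := by
  simp only [freqResidue, dilationFreq, Function.update_self, Int.add_mul_emod_self_left]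
  rw [Int.emod_eq_of_lt (by omega) (by omega)]
  simp

theorem exists_dilationFreq (i : Fin d) {N : ℕ} (hN : N ≠ 0) (z : Fin d → ℤ) :
    ∃ m, dilationFreq i N (freqResidue i N z) m = z := by
  refine ⟨Function.update z i (z i / N), ?_⟩
  have h0 := Int.emod_nonneg (z i) (b := N) (by omega)
  simp only [dilationFreq, freqResidue, Function.update_self, Function.update_idem]
  rw [Int.toNat_of_nonneg h0, Int.emod_add_mul_ediv, Function.update_eq_self]

/-- The range of an isometry is closed, and it contains every exponential of residue `r`, hence all
partial Fourier sums of `f`. -/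
theorem exists_dilationOp_eq (i : Fin d) {N : ℕ} (hN : N ≠ 0) (r : ℕ) {f : TorusL2 d}
    (hf : f ∈ specSpace {z | freqResidue i N z = r}) : ∃ g, dilationOp i hN r g = f := by
  have hcl : IsClosed (Set.range (dilationOp i hN r)) :=
    (dilationOp i hN r).isometry.isClosedEmbedding.isClosed_range
  refine hcl.mem_of_tendsto ((expBasis d).hasSum_repr f) (.of_forall fun s => ?_)
  change _ ∈ (dilationOp i hN r).toLinearMap.range
  refine Submodule.sum_mem _ fun z _ => ?_
  by_cases hz : freqResidue i N z = r
  · obtain ⟨m, hm⟩ := exists_dilationFreq i hN z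
    refine Submodule.smul_mem _ _ ⟨expBasis d m, ?_⟩
    rw [← hm, ← dilationOp_expBasis i hN, hz]; rfl
  · rw [HilbertBasis.repr_apply_apply, mem_specSpace.mp hf z hz, zero_smul]
    exact zero_mem _

theorem dilationOp_mem_specSpace_iff (i : Fin d) {N : ℕ} (hN : N ≠ 0) {r : ℕ} (hr : r < N)
    {Γ : Set (Fin d → ℤ)} {g : TorusL2 d} :
    dilationOp i hN r g ∈ specSpace (dilationFreq i N r '' Γ) ↔ g ∈ specSpace Γ := by
  rw [mem_specSpace, mem_specSpace]
  constructor
  · intro h m hm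
    rw [← inner_dilationOp i hN r]
    refine h _ ?_
    rintro ⟨m', hm', he⟩
    exact hm (dilationFreq_injective i hN r he ▸ hm')
  · intro h z hz
    by_cases hzr : freqResidue i N z = r
    · obtain ⟨m, hm⟩ := exists_dilationFreq i hN z
      rw [hzr] at hm
      subst hm
      rw [inner_dilationOp]
      exact h m fun hm => hz ⟨m, hm, rfl⟩
    · have hd : ∀ f : TorusL2 d, ⟪expBasis d z, dilationOp i hN r f⟫_ℂ = 0 := by
        intro f
        suffices H : (innerSL ℂ (expBasis d z)).comp
            (dilationOp i hN r).toContinuousLinearMap = 0 from DFunLike.congr_fun H f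
        apply clm_ext_expBasis
        intro m
        change ⟪expBasis d z, dilationOp i hN r (expBasis d m)⟫_ℂ = 0
        rw [dilationOp_expBasis, expBasis_inner, if_neg]
        rintro rfl
        exact hzr (freqResidue_dilationFreq i hr m)
      exact hd g

end Splitting

/-! ### The splitting theorem along orbits of the `1 / N` grid. -/

section Splitting

open ZMod
open scoped ZMod

variable {d : ℕ}

/-- The translation by `j / N` in the `i`-th coordinate. -/
noncomputable def gridShift (i : Fin d) {N : ℕ} [NeZero N] (j : ZMod N) : UnitAddTorus (Fin d) :=
  Pi.single i (toAddCircle j)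

theorem gridShift_add (i : Fin d) {N : ℕ} [NeZero N] (j k : ZMod N) :
    gridShift i (j + k) = gridShift i j + gridShift i k := by
  rw [gridShift, map_add, Pi.single_add]; rfl

theorem gridShift_zero (i : Fin d) {N : ℕ} [NeZero N] : gridShift i (0 : ZMod N) = 0 := by
  rw [gridShift, map_zero, Pi.single_zero]

open Classical in
/-- The grid translates of `x` that lie in `S`. -/
noncomputable def gridPattern (i : Fin d) (N : ℕ) [NeZero N] (S : Set (UnitAddTorus (Fin d)))
    (x : UnitAddTorus (Fin d)) : Finset (ZMod N) :=
  {j | x + gridShift i j ∈ S}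

theorem mem_gridPattern {i : Fin d} {N : ℕ} [NeZero N] {S : Set (UnitAddTorus (Fin d))}
    {x : UnitAddTorus (Fin d)} {j : ZMod N} :
    j ∈ gridPattern i N S x ↔ x + gridShift i j ∈ S := by
  simp [gridPattern]

theorem mem_gridPattern_add {i : Fin d} {N : ℕ} [NeZero N] {S : Set (UnitAddTorus (Fin d))}
    {x : UnitAddTorus (Fin d)} {j k : ZMod N} :
    j ∈ gridPattern i N S (x + gridShift i k) ↔ j + k ∈ gridPattern i N S x := by
  rw [mem_gridPattern, mem_gridPattern, gridShift_add, add_comm (gridShift i j), add_assoc]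

theorem card_gridPattern_add (i : Fin d) (N : ℕ) [NeZero N] (S : Set (UnitAddTorus (Fin d)))
    (x : UnitAddTorus (Fin d)) (k : ZMod N) :
    (gridPattern i N S (x + gridShift i k)).card = (gridPattern i N S x).card :=
  Finset.card_bij (fun j _ => j + k) (fun _ hj => mem_gridPattern_add.mp hj)
    (fun _ _ _ _ h => add_right_cancel h)
    (fun l hl => ⟨l - k, mem_gridPattern_add.mpr (by simpa using hl), by simp⟩)

theorem measurableSet_gridPattern_eq (i : Fin d) (N : ℕ) [NeZero N] {S : Set (UnitAddTorus (Fin d))}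
    (hS : MeasurableSet S) (σ : Finset (ZMod N)) : MeasurableSet {x | gridPattern i N S x = σ} := by
  have : {x | gridPattern i N S x = σ} = ⋂ j : ZMod N, {x | x + gridShift i j ∈ S ↔ j ∈ σ} := by
    ext x
    simp only [Set.mem_ofPred_eq, Set.mem_iInter, Finset.ext_iff, mem_gridPattern]
  rw [this]
  refine MeasurableSet.iInter fun j => ?_
  have hm : MeasurableSet {x | x + gridShift i j ∈ S} := (measurable_add_const _) hS
  by_cases hj : j ∈ σ
  · simpa [hj] using hm
  · simp only [hj, iff_false]
    exact hm.compl

theorem fourier_toAddCircle {N : ℕ} [NeZero N] (n : ℤ) (j : ZMod N) :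
    fourier n (toAddCircle j) = stdAddChar ((n : ZMod N) * j) := by
  rw [fourier_apply, stdAddChar_apply, ← zsmul_eq_mul, ← map_zsmul]
  rfl

theorem freqResidue_eq_val (i : Fin d) (N : ℕ) [NeZero N] (z : Fin d → ℤ) :
    freqResidue i N z = ((z i : ZMod N)).val := by
  have h := ZMod.val_intCast (n := N) (z i)
  rw [freqResidue, ← h, Int.toNat_natCast]

theorem ae_translOp_gridShift (i : Fin d) {N : ℕ} [NeZero N] (f : TorusL2 d) :
    ∀ᵐ x ∂torusMeasure d, ∀ j : ZMod N, translOp (gridShift i j) f x = f (x + gridShift i j) :=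
  ae_all_iff.mpr fun j => translOp_ae (gridShift i j) f

theorem ae_forall_gridShift (i : Fin d) (N : ℕ) [NeZero N] {P : UnitAddTorus (Fin d) → Prop}
    (h : ∀ᵐ x ∂torusMeasure d, P x) :
    ∀ᵐ x ∂torusMeasure d, ∀ j : ZMod N, P (x + gridShift i j) :=
  ae_all_iff.mpr fun j => (measurePreserving_add_const (gridShift i j)).quasiMeasurePreserving.ae h

/-- A function has frequencies with residues `< n` in the `i`-th direction if and only if its
restrictions to the orbits of the grid have. -/
theorem mem_specSpace_residue_iff (i : Fin d) {N : ℕ} [NeZero N] (n : ℕ) (F : TorusL2 d) :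
    F ∈ specSpace {z | freqResidue i N z < n} ↔ ∀ᵐ x ∂torusMeasure d, ∀ k : ZMod N, n ≤ k.val →
      𝓕 (fun l : ZMod N => F (x + gridShift i l)) k = 0 := by
  -- `A k` is `N` times the part of `F` whose `i`-th frequency is `k` modulo `N`; pointwise it is a
  -- discrete Fourier coefficient along the orbit.
  set A : ZMod N → TorusL2 d := fun k => ∑ l : ZMod N, (stdAddChar (-(l * k)) : ℂ) •
    translOp (gridShift i l) F with hA
  have hA_ae : ∀ k, A k =ᵐ[torusMeasure d]
      fun x => 𝓕 (fun l : ZMod N => F (x + gridShift i l)) k := by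
    intro k
    have h1 := Lp.coeFn_finsetSum Finset.univ (fun l : ZMod N =>
      (stdAddChar (-(l * k)) : ℂ) • translOp (gridShift i l) F)
    have h2 : ∀ᵐ x ∂torusMeasure d, ∀ l : ZMod N,
        ((stdAddChar (-(l * k)) : ℂ) • translOp (gridShift i l) F : TorusL2 d) x =
          (stdAddChar (-(l * k)) : ℂ) • translOp (gridShift i l) F x :=
      ae_all_iff.mpr fun l => Lp.coeFn_smul _ _
    filter_upwards [h1, h2, ae_translOp_gridShift (N := N) i F] with x h1 h2 h3
    rw [hA, h1, Finset.sum_apply, dft_apply]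
    exact Finset.sum_congr rfl fun l _ => by rw [h2, h3]
  have hA_inner : ∀ k z, ⟪expBasis d z, A k⟫_ℂ =
      (if (z i : ZMod N) = k then (N : ℂ) else 0) * ⟪expBasis d z, F⟫_ℂ := by
    intro k z
    rw [hA, inner_sum]
    simp only [inner_smul_right, inner_translOp, gridShift, mFourier_apply_single,
      fourier_toAddCircle, ← mul_assoc, ← AddChar.map_add_eq_mul]
    rw [← Finset.sum_mul]
    congr 1
    have : ∀ l : ZMod N, (stdAddChar (-(l * k) + (z i : ZMod N) * l) : ℂ) =
        stdAddChar (l * ((z i : ZMod N) - k)) := fun l => by congr 1; ring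
    rw [Finset.sum_congr rfl fun l _ => this l, AddChar.sum_mulShift _ (isPrimitive_stdAddChar N)]
    simp [sub_eq_zero, ZMod.card]
  have hAz : (∀ᵐ x ∂torusMeasure d, ∀ k : ZMod N, n ≤ k.val →
      𝓕 (fun l : ZMod N => F (x + gridShift i l)) k = 0) ↔ ∀ k : ZMod N, n ≤ k.val → A k = 0 := by
    rw [ae_all_iff]
    refine forall_congr' fun k => ?_
    rw [Lp.eq_zero_iff_ae_eq_zero]
    constructor
    · intro h hk
      filter_upwards [h, hA_ae k] with x h1 h2
      rw [h2, h1 hk]; rfl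
    · intro h
      by_cases hk : n ≤ k.val
      · filter_upwards [h hk, hA_ae k] with x h1 h2 _
        rw [← h2, h1]; rfl
      · exact .of_forall fun x h => absurd h hk
  rw [hAz, mem_specSpace]
  constructor
  · intro h k hk
    apply expBasis_ext
    intro z
    rw [hA_inner, inner_zero_right]
    split_ifs with hz
    · rw [h z, mul_zero]
      simp only [Set.mem_ofPred_eq, freqResidue_eq_val, hz]
      omega
    · rw [zero_mul]
  · intro h z hz
    have h1 := hA_inner (z i : ZMod N) z
    rw [h, inner_zero_right, if_pos rfl] at h1
    · have hN : (N : ℂ) ≠ 0 := by exact_mod_cast NeZero.ne N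
      exact (mul_eq_zero.mp h1.symm).resolve_left hN
    · rw [← freqResidue_eq_val]
      simpa using hz

/-- Existence part of the interpolation problem on the orbits of the grid. -/
theorem exists_interpolant (i : Fin d) (N : ℕ) [NeZero N] {S : Set (UnitAddTorus (Fin d))}
    (hS : MeasurableSet S) (n : ℕ) (f : TorusL2 d)
    (hf : ∀ᵐ x ∂torusMeasure d, (gridPattern i N S x).card ≠ n → f x = 0) :
    ∃ F ∈ specSpace {z | freqResidue i N z < n},
      (∀ᵐ x ∂torusMeasure d, (gridPattern i N S x).card ≠ n → F x = 0) ∧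
      ∀ᵐ x ∂torusMeasure d, x ∈ S → F x = f x := by
  classical
  choose c hc using fun σ : Finset (ZMod N) => sampleExt_eq_sum σ 0
  -- At each point `x`, `F` interpolates `f` from the points of the orbit that lie in `S` and
  -- evaluates at `x` itself. Sorting the points by pattern `σ` leaves finitely many combinations of
  -- translates.
  set F : TorusL2 d := ∑ σ : Finset (ZMod N), restrOp _ _ (measurableSet_gridPattern_eq i N hS σ)
    (∑ j : ZMod N, c σ j • translOp (gridShift i j) f) with hF
  have hFx : ∀ᵐ x ∂torusMeasure d,
      F x = sampleExt (gridPattern i N S x) (fun j => f (x + gridShift i j)) 0 := by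
    have h1 := Lp.coeFn_finsetSum Finset.univ (fun σ : Finset (ZMod N) =>
      restrOp (torusMeasure d) _ (measurableSet_gridPattern_eq i N hS σ)
        (∑ j : ZMod N, c σ j • translOp (gridShift i j) f))
    have h2 : ∀ᵐ x ∂torusMeasure d, ∀ σ : Finset (ZMod N),
        restrOp _ _ (measurableSet_gridPattern_eq i N hS σ)
          (∑ j : ZMod N, c σ j • translOp (gridShift i j) f) x =
        Set.indicator {x | gridPattern i N S x = σ}
          (∑ j : ZMod N, c σ j • translOp (gridShift i j) f : TorusL2 d) x :=
      ae_all_iff.mpr fun σ => restrOp_ae _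
    have h3 : ∀ᵐ x ∂torusMeasure d, ∀ σ : Finset (ZMod N),
        (∑ j : ZMod N, c σ j • translOp (gridShift i j) f : TorusL2 d) x =
          ∑ j : ZMod N, (c σ j • translOp (gridShift i j) f : TorusL2 d) x :=
      ae_all_iff.mpr fun σ => by
        filter_upwards [Lp.coeFn_finsetSum Finset.univ (fun j : ZMod N =>
          c σ j • translOp (gridShift i j) f)] with x hx
        rw [hx, Finset.sum_apply]
    have h4 : ∀ᵐ x ∂torusMeasure d, ∀ (σ : Finset (ZMod N)) (j : ZMod N),
        (c σ j • translOp (gridShift i j) f : TorusL2 d) x =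
          c σ j * translOp (gridShift i j) f x :=
      ae_all_iff.mpr fun σ => ae_all_iff.mpr fun j => Lp.coeFn_smul _ _
    filter_upwards [h1, h2, h3, h4, ae_translOp_gridShift (N := N) i f] with x h1 h2 h3 h4 h5
    rw [hF, h1, Finset.sum_apply, Finset.sum_congr rfl fun σ _ => h2 σ,
      Finset.sum_eq_single (gridPattern i N S x), Set.indicator_of_mem (by exact rfl), h3, hc]
    · exact Finset.sum_congr rfl fun j _ => by rw [h4, h5]
    · intro σ _ hσ
      rw [Set.indicator_of_notMem]
      exact fun h => hσ h.symm
    · simp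
  have hF0 : ∀ᵐ x ∂torusMeasure d, (gridPattern i N S x).card ≠ n → F x = 0 := by
    filter_upwards [hFx, ae_forall_gridShift i N hf] with x h1 h2 hx
    rw [h1, hc]
    refine Finset.sum_eq_zero fun j _ => ?_
    rw [h2 j (by rwa [card_gridPattern_add]), mul_zero]
  refine ⟨F, ?_, hF0, ?_⟩
  · rw [mem_specSpace_residue_iff]
    filter_upwards [ae_forall_gridShift i N hFx, ae_forall_gridShift i N hF0] with x h1 h2 k hk
    by_cases hx : (gridPattern i N S x).card = n
    · have : (fun l : ZMod N => F (x + gridShift i l)) =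
          sampleExt (gridPattern i N S x) (fun j => f (x + gridShift i j)) := by
        funext l
        rw [h1 l]
        -- The definition of `F` takes each point of an orbit as base point in turn; shift
        -- equivariance shows that all of them yield the same interpolant.
        have h3 := sampleExt_shift (gridPattern i N S x) (gridPattern i N S (x + gridShift i l)) l
          (fun j => mem_gridPattern_add) (fun j => f (x + gridShift i j)) 0
        rw [zero_add] at h3
        rw [← h3]
        congr 1
        funext j
        rw [gridShift_add, add_comm (gridShift i j), add_assoc]
      rw [this, dft_sampleExt _ _ _ (hx ▸ hk)]
    · have : (fun l : ZMod N => F (x + gridShift i l)) = 0 :=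
        funext fun l => h2 l (by rwa [card_gridPattern_add])
      rw [this, map_zero, Pi.zero_apply]
  · filter_upwards [hFx] with x h1 hx
    rw [h1, sampleExt_of_mem, gridShift_zero, add_zero]
    rwa [mem_gridPattern, gridShift_zero, add_zero]

/-- Uniqueness part of the interpolation problem on the orbits of the grid. -/
theorem interpolant_unique (i : Fin d) (N : ℕ) [NeZero N] {S : Set (UnitAddTorus (Fin d))}
    (n : ℕ) (F : TorusL2 d) (hF : F ∈ specSpace {z | freqResidue i N z < n})
    (hF0 : ∀ᵐ x ∂torusMeasure d, (gridPattern i N S x).card ≠ n → F x = 0)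
    (hFS : ∀ᵐ x ∂torusMeasure d, x ∈ S → F x = 0) : F = 0 := by
  rw [mem_specSpace_residue_iff] at hF
  rw [Lp.eq_zero_iff_ae_eq_zero]
  filter_upwards [hF, hF0, ae_forall_gridShift i N hFS] with x h1 h2 h3
  by_cases hx : (gridPattern i N S x).card = n
  · have := eq_zero_of_dft_of_vanish (gridPattern i N S x) (fun l => F (x + gridShift i l))
      (fun k hk => h1 k (hx ▸ hk)) (fun l hl => h3 l (mem_gridPattern.mp hl))
    have h0 := congrFun this 0
    simpa [gridShift_zero] using h0
  · exact h2 hx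

/-- The splitting theorem: if the set `T n` describes, after dilation by `N` in the `i`-th
coordinate, the orbits of the grid that meet `S` at least `n` times, and all `T n` have Riesz
spectra, then so has `S`. -/
theorem exists_isRieszSpectrum_of_levels (i : Fin d) {N : ℕ} (hN : N ≠ 0) [NeZero N]
    {S : Set (UnitAddTorus (Fin d))} (hS : MeasurableSet S)
    (T : ℕ → Set (UnitAddTorus (Fin d))) (hT : ∀ n, MeasurableSet (T n))
    (hTS : ∀ n x, dilation i N x ∈ T n ↔ n ≤ (gridPattern i N S x).card)
    (hex : ∀ n, ∃ Γ, IsRieszSpectrum (T n) Γ) : ∃ Sig, IsRieszSpectrum S Sig := by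
  classical
  choose Γ hΓ using hex
  have hcard : ∀ x, (gridPattern i N S x).card < N + 1 := by
    intro x
    have := Finset.card_le_univ (gridPattern i N S x)
    rw [ZMod.card] at this
    omega
  set lab : UnitAddTorus (Fin d) → Fin (N + 1) := fun x => ⟨(gridPattern i N S x).card, hcard x⟩
    with hlab_def
  have hlab : ∀ k, MeasurableSet (lab ⁻¹' {k}) := by
    intro k
    have : lab ⁻¹' {k} = ⋃ σ ∈ {σ : Finset (ZMod N) | σ.card = k.val},
        {x | gridPattern i N S x = σ} := by
      ext x
      simp [hlab_def, Fin.ext_iff]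
    rw [this]
    exact MeasurableSet.biUnion (Set.to_countable _) fun σ _ =>
      measurableSet_gridPattern_eq i N hS σ
  have hlabne : ∀ k x, lab x ≠ k ↔ (gridPattern i N S x).card ≠ k.val := by
    intro k x
    rw [Ne, Fin.ext_iff]
  have hcomp : ∀ {P : UnitAddTorus (Fin d) → Prop}, (∀ᵐ y ∂torusMeasure d, P y) →
      ∀ᵐ x ∂torusMeasure d, P (dilation i N x) := fun h =>
    (measurePreserving_dilation i hN).quasiMeasurePreserving.ae h
  have hmono : ∀ r, dilationFreq i N r '' Γ (r + 1) ∩ {z | freqResidue i N z = r} ⊆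
    {z | freqResidue i N z = r} := fun r => Set.inter_subset_right
  have himg : ∀ r < N, dilationFreq i N r '' Γ (r + 1) ∩ {z | freqResidue i N z = r} =
      dilationFreq i N r '' Γ (r + 1) := by
    intro r hr
    rw [Set.inter_eq_left]
    rintro _ ⟨m, _, rfl⟩
    exact freqResidue_dilationFreq i hr m
  -- The spectrum collects `r + N Γ (r + 1)` in the `i`-th direction. Intersecting with the residue
  -- class changes nothing for `r < N`, and gives the empty set for the other `r`.
  refine ⟨_, isRieszSpectrum_of_chain lab hlab (fun k => k.val) N (freqResidue i N)
    (freqResidue_lt i hN) (fun k j f => ?_) hS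
    (fun r => dilationFreq i N r '' Γ (r + 1) ∩ {z | freqResidue i N z = r})
    (fun r z hz => hz.2) ?_ ?_ ?_ ?_⟩
  -- Translation by `1 / N` preserves the orbit counts, and its eigenvalue at a frequency determines
  -- the residue.
  · refine restrOp_specProj_comm (hlab k) (fun m hm n hn => ⟨gridShift i (1 : ZMod N), ?_, ?_⟩) f
    · intro x
      simp [hlab_def, Fin.ext_iff, card_gridPattern_add]
    · rw [gridShift, mFourier_apply_single, mFourier_apply_single, fourier_toAddCircle,
        fourier_toAddCircle, mul_one, mul_one, injective_stdAddChar.ne_iff]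
      intro h
      simp only [Set.mem_ofPred_eq, freqResidue_eq_val] at hm hn
      rw [h] at hm
      exact hn hm
  · intro r hr f hf
    obtain ⟨g, rfl⟩ := exists_dilationOp_eq i hN r hf
    obtain ⟨G, hG, hGg⟩ := (hΓ (r + 1)).1 g
    refine ⟨dilationOp i hN r G, ?_, ?_⟩
    · rw [himg r hr]
      exact (dilationOp_mem_specSpace_iff i hN hr).mpr hG
    · filter_upwards [hcomp hGg, dilationOp_ae i hN r G, dilationOp_ae i hN r g] with x h1 h2 h3 hx
      rw [h2, h3, h1 ((hTS _ x).mpr hx)]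
  · intro r hr F hF hF0
    obtain ⟨G, rfl⟩ := exists_dilationOp_eq i hN r (specSpace_mono (hmono r) hF)
    rw [himg r hr, dilationOp_mem_specSpace_iff i hN hr] at hF
    rw [(hΓ (r + 1)).2 G hF, map_zero]
    -- Measurability is needed to pass from almost every `x` to almost every value of the dilation.
    have hmeas : MeasurableSet {y | y ∈ T (r + 1) → G y = 0} := by
      have : {y | y ∈ T (r + 1) → G y = 0} = (T (r + 1))ᶜ ∪ G ⁻¹' {0} := by
        ext y; simp [imp_iff_not_or]
      rw [this]
      exact (hT _).compl.union ((Lp.stronglyMeasurable G).measurable (measurableSet_singleton 0))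
    have hmap := (measurePreserving_dilation i hN).map_eq
    suffices H : ∀ᵐ y ∂(torusMeasure d).map (dilation i N), y ∈ T (r + 1) → G y = 0 by
      rwa [hmap] at H
    refine (ae_map_iff (measurePreserving_dilation i hN).measurable.aemeasurable hmeas).mpr ?_
    filter_upwards [hF0, dilationOp_ae i hN r G] with x h1 h2 hx
    have h3 := h1 ((hTS _ x).mp hx)
    rw [h2, mul_eq_zero] at h3
    refine h3.resolve_left fun h => ?_
    have := norm_mFourier_apply (Pi.single i (r : ℤ)) x
    rw [h, norm_zero] at this
    exact zero_ne_one this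
  · intro k f hf
    simp only [hlabne] at hf ⊢
    exact exists_interpolant i N hS k.val f hf
  · intro k F hF hF0 hFS
    simp only [hlabne] at hF0
    exact interpolant_unique i N k.val F hF hF0 hFS

end Splitting

/-! ### Subsets of the circle with finitely many jumps, and their level sets. -/

section Tame

open ZMod Filter Topology

/-- A subset `A` of the circle, continuous from the right, with left limits given by the set `B`,
and with finitely many jumps. -/
structure IsTame (A B : Set UnitAddCircle) : Prop where
  right : ∀ u, ∀ᶠ ε : ℝ in 𝓝[>] (0 : ℝ), (u + (ε : UnitAddCircle) ∈ A ↔ u ∈ A)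
  left : ∀ u, ∀ᶠ ε : ℝ in 𝓝[>] (0 : ℝ), (u - (ε : UnitAddCircle) ∈ A ↔ u ∈ B)
  finite : (symmDiff A B).Finite

theorem eventually_nhds_circle {P : UnitAddCircle → Prop} {u : UnitAddCircle} (h0 : P u)
    (hr : ∀ᶠ ε : ℝ in 𝓝[>] (0 : ℝ), P (u + (ε : UnitAddCircle)))
    (hl : ∀ᶠ ε : ℝ in 𝓝[>] (0 : ℝ), P (u - (ε : UnitAddCircle))) : ∀ᶠ v in 𝓝 u, P v := by
  have h1 : ∀ᶠ ε : ℝ in 𝓝 (0 : ℝ), P (u + (ε : UnitAddCircle)) := by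
    rw [← nhdsNE_sup_pure, ← nhdsLT_sup_nhdsGT, eventually_sup, eventually_sup]
    refine ⟨⟨?_, hr⟩, by simpa using h0⟩
    have hneg : Tendsto (fun ε : ℝ => -ε) (𝓝[<] 0) (𝓝[>] 0) := by
      simpa using tendsto_neg_nhdsLT (a := (0 : ℝ))
    filter_upwards [hneg.eventually hl] with ε hε
    simpa using hε
  induction u using QuotientAddGroup.induction_on with
  | H x =>
    rw [QuotientAddGroup.nhds_eq, eventually_map, ← map_add_left_nhds_zero x, eventually_map]
    exact h1

/-- Off the jumps the left and right limits of the indicator coincide with its value. -/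
theorem IsTame.eventually_mem_iff {A B : Set UnitAddCircle} (h : IsTame A B) {u : UnitAddCircle}
    (hu : u ∉ symmDiff A B) : ∀ᶠ v in 𝓝 u, (v ∈ A ↔ u ∈ A) := by
  refine eventually_nhds_circle Iff.rfl (h.right u) ?_
  filter_upwards [h.left u] with ε hε
  rw [hε]
  simp only [Set.mem_symmDiff] at hu
  tauto

theorem IsTame.measurableSet {A B : Set UnitAddCircle} (h : IsTame A B) : MeasurableSet A := by
  have h1 : IsOpen (A \ symmDiff A B) := by
    rw [isOpen_iff_mem_nhds]
    rintro u ⟨huA, huJ⟩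
    have h2 : ∀ᶠ v in 𝓝 u, v ∉ symmDiff A B := h.finite.isClosed.isOpen_compl.mem_nhds huJ
    filter_upwards [h.eventually_mem_iff huJ, h2] with v hv hvJ
    exact ⟨hv.mpr huA, hvJ⟩
  rw [← Set.sdiff_union_inter A (symmDiff A B)]
  exact h1.measurableSet.union (h.finite.subset Set.inter_subset_right).measurableSet

/-- Without jumps the set is clopen, and the circle is connected. -/
theorem IsTame.eq_empty_or_univ {A B : Set UnitAddCircle} (h : IsTame A B)
    (hJ : symmDiff A B = ∅) : A = ∅ ∨ A = Set.univ := by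
  have ho : ∀ u, ∀ᶠ v in 𝓝 u, (v ∈ A ↔ u ∈ A) := fun u => h.eventually_mem_iff (by simp [hJ])
  refine isClopen_iff.mp ⟨⟨?_⟩, ?_⟩
  · rw [isOpen_iff_mem_nhds]
    intro u hu
    filter_upwards [ho u] with v hv using fun hvA => hu (hv.mp hvA)
  · rw [isOpen_iff_mem_nhds]
    intro u hu
    filter_upwards [ho u] with v hv using hv.mpr hu

open Classical in
/-- The number of `j` modulo `N` such that `u + j / N` lies in `A`. -/
noncomputable def gridCount (N : ℕ) [NeZero N] (A : Set UnitAddCircle) (u : UnitAddCircle) : ℕ :=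
  (Finset.univ.filter fun j : ZMod N => u + toAddCircle j ∈ A).card

/-- The `N`-fold dilates of the points whose orbit under translation by `1 / N` meets `A` at least
`n` times. -/
def gridLevel (N : ℕ) [NeZero N] (n : ℕ) (A : Set UnitAddCircle) : Set UnitAddCircle :=
  {s | ∃ u, N • u = s ∧ n ≤ gridCount N A u}

variable {N : ℕ} [NeZero N]

theorem nsmul_toAddCircle (j : ZMod N) : N • toAddCircle j = (0 : UnitAddCircle) := by
  rw [← map_nsmul, nsmul_eq_mul, ZMod.natCast_self, zero_mul, map_zero]

theorem gridCount_add (A : Set UnitAddCircle) (u : UnitAddCircle) (k : ZMod N) :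
    gridCount N A (u + toAddCircle k) = gridCount N A u := by
  classical
  refine Finset.card_bij (fun j _ => k + j) (fun j hj => ?_)
    (fun _ _ _ _ h => add_left_cancel h) (fun l hl => ⟨l - k, ?_, by simp⟩)
  · simp only [Finset.mem_filter, Finset.mem_univ, true_and] at hj ⊢
    rwa [map_add, ← add_assoc]
  · simp only [Finset.mem_filter, Finset.mem_univ, true_and] at hl ⊢
    rwa [map_sub, add_assoc, add_sub_cancel]

theorem nsmul_eq_nsmul_iff {u v : UnitAddCircle} :
    N • u = N • v ↔ ∃ j : ZMod N, u = v + toAddCircle j := by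
  constructor
  · intro h
    have h1 : N • (u - v) = 0 := by rw [nsmul_sub, h, sub_self]
    obtain ⟨m, hm⟩ := (AddCircle.nsmul_eq_zero_iff (NeZero.pos N)).mp h1
    refine ⟨(m : ZMod N), ?_⟩
    rw [toAddCircle_natCast, ← sub_eq_iff_eq_add', ← hm.2]
    simp
  · rintro ⟨j, rfl⟩
    rw [nsmul_add, nsmul_toAddCircle, add_zero]

theorem mem_gridLevel {n : ℕ} {A : Set UnitAddCircle} {u : UnitAddCircle} :
    N • u ∈ gridLevel N n A ↔ n ≤ gridCount N A u := by
  constructor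
  · rintro ⟨v, hv, hn⟩
    obtain ⟨j, rfl⟩ := nsmul_eq_nsmul_iff.mp hv
    rwa [gridCount_add] at hn
  · exact fun h => ⟨u, rfl, h⟩

theorem gridCount_congr {A B : Set UnitAddCircle} {u v : UnitAddCircle}
    (h : ∀ j : ZMod N, u + toAddCircle j ∈ A ↔ v + toAddCircle j ∈ B) :
    gridCount N A u = gridCount N B v := by
  classical
  unfold gridCount
  congr 1
  ext j
  simp [h]

/-- An orbit containing no jump has the same count for the set and for its left limits. So every
jump of a level set is the dilate of a jump of `A`, and jumps cannot multiply. -/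
theorem symmDiff_gridLevel_subset (n : ℕ) (A B : Set UnitAddCircle) :
    symmDiff (gridLevel N n A) (gridLevel N n B) ⊆ (fun u => N • u) '' symmDiff A B := by
  intro s hs
  obtain ⟨u, rfl⟩ := nsmul_surjective_unitAddCircle (NeZero.ne N) s
  by_contra hcon
  have : gridCount N A u = gridCount N B u := by
    refine gridCount_congr fun j => ?_
    by_contra h
    refine hcon ⟨u + toAddCircle j, ?_, ?_⟩
    · simp only [Set.mem_symmDiff]; tauto
    · simp only [nsmul_add, nsmul_toAddCircle, add_zero]
  simp only [Set.mem_symmDiff, mem_gridLevel, this] at hs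
  tauto

theorem tendsto_div_nhdsGT (N : ℕ) [NeZero N] :
    Tendsto (fun ε : ℝ => ε / N) (𝓝[>] 0) (𝓝[>] 0) := by
  have hN : (0 : ℝ) < N := by exact_mod_cast NeZero.pos N
  refine tendsto_nhdsWithin_iff.mpr ⟨?_, ?_⟩
  · have : Tendsto (fun ε : ℝ => ε / N) (𝓝 0) (𝓝 (0 / N)) := (continuous_id.div_const _).tendsto 0
    rw [zero_div] at this
    exact this.mono_left nhdsWithin_le_nhds
  · filter_upwards [self_mem_nhdsWithin] with ε hε using div_pos hε hN

/-- One-sided limits hold simultaneously at the finitely many points of an orbit; a step `ε` after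
dilation is a step `ε / N` before it. -/
theorem IsTame.gridLevel {A B : Set UnitAddCircle} (h : IsTame A B) (n : ℕ) :
    IsTame (gridLevel N n A) (gridLevel N n B) where
  right s := by
    obtain ⟨u, rfl⟩ := nsmul_surjective_unitAddCircle (NeZero.ne N) s
    have h1 : ∀ᶠ ε : ℝ in 𝓝[>] (0 : ℝ), ∀ j : ZMod N,
        (u + toAddCircle j + (ε : UnitAddCircle) ∈ A ↔ u + toAddCircle j ∈ A) :=
      eventually_all.mpr fun j => h.right _
    have h2 : Tendsto (fun ε : ℝ => ε / N) (𝓝[>] 0) (𝓝[>] 0) := tendsto_div_nhdsGT N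
    filter_upwards [h2.eventually h1] with ε hε
    have h3 : N • u + (ε : UnitAddCircle) = N • (u + ((ε / N : ℝ) : UnitAddCircle)) := by
      rw [nsmul_add, ← AddCircle.coe_nsmul, nsmul_eq_mul, mul_div_cancel₀ _ (NeZero.ne _)]
    rw [h3, mem_gridLevel, mem_gridLevel, gridCount_congr (v := u) (B := A) fun j => ?_]
    rw [add_right_comm, hε]
  left s := by
    obtain ⟨u, rfl⟩ := nsmul_surjective_unitAddCircle (NeZero.ne N) s
    have h1 : ∀ᶠ ε : ℝ in 𝓝[>] (0 : ℝ), ∀ j : ZMod N,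
        (u + toAddCircle j - (ε : UnitAddCircle) ∈ A ↔ u + toAddCircle j ∈ B) :=
      eventually_all.mpr fun j => h.left _
    have h2 : Tendsto (fun ε : ℝ => ε / N) (𝓝[>] 0) (𝓝[>] 0) := tendsto_div_nhdsGT N
    filter_upwards [h2.eventually h1] with ε hε
    have h3 : N • u - (ε : UnitAddCircle) = N • (u - ((ε / N : ℝ) : UnitAddCircle)) := by
      rw [nsmul_sub, ← AddCircle.coe_nsmul, nsmul_eq_mul, mul_div_cancel₀ _ (NeZero.ne _)]
    rw [h3, mem_gridLevel, mem_gridLevel, gridCount_congr (v := u) (B := B) fun j => ?_]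
    rw [sub_add_eq_add_sub, hε]
  finite := (h.finite.image _).subset (symmDiff_gridLevel_subset n A B)

theorem ncard_symmDiff_gridLevel_le {A B : Set UnitAddCircle} (h : IsTame A B) (n : ℕ) :
    (symmDiff (gridLevel N n A) (gridLevel N n B)).ncard ≤ (symmDiff A B).ncard :=
  (Set.ncard_le_ncard (symmDiff_gridLevel_subset n A B) (h.finite.image _)).trans
    (Set.ncard_image_le h.finite)

/-- If dilation merges no jumps, `p` is the only jump in its orbit, so the count changes there by
exactly one. -/
theorem gridCount_of_injOn {A B : Set UnitAddCircle}
    (hinj : Set.InjOn (fun u : UnitAddCircle => N • u) (symmDiff A B)) {p : UnitAddCircle}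
    (hp : p ∈ symmDiff A B) :
    (gridCount N A p = gridCount N B p + 1) ∨ (gridCount N B p = gridCount N A p + 1) := by
  classical
  have hother : ∀ j : ZMod N, j ≠ 0 → (p + toAddCircle j ∈ A ↔ p + toAddCircle j ∈ B) := by
    intro j hj
    by_contra hcon
    have hmem : p + toAddCircle j ∈ symmDiff A B := by simp only [Set.mem_symmDiff]; tauto
    have := hinj hmem hp (by simp only [nsmul_add, nsmul_toAddCircle, add_zero])
    rw [add_eq_left, toAddCircle_eq_zero] at this
    exact hj this
  have key : ∀ A B : Set UnitAddCircle,
      (∀ j : ZMod N, j ≠ 0 → (p + toAddCircle j ∈ A ↔ p + toAddCircle j ∈ B)) →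
      p ∈ A → p ∉ B → gridCount N A p = gridCount N B p + 1 := by
    intro A B hAB hA hB
    have : (Finset.univ.filter fun j : ZMod N => p + toAddCircle j ∈ A) =
        insert 0 (Finset.univ.filter fun j : ZMod N => p + toAddCircle j ∈ B) := by
      ext j
      by_cases hj : j = 0
      · subst hj; simp [hA]
      · simp [hj, hAB j hj]
    unfold gridCount
    rw [this, Finset.card_insert_of_notMem (by simp [hB])]
  rcases hp with ⟨h1, h2⟩ | ⟨h1, h2⟩
  · exact Or.inl (key A B hother h1 h2)
  · exact Or.inr (key B A (fun j hj => (hother j hj).symm) h1 h2)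

/-- If one level set has as many jumps as `A`, then no jumps are merged and the other level sets
have no jumps. -/
theorem gridLevel_of_ncard_le {A B : Set UnitAddCircle} (h : IsTame A B) {n : ℕ}
    (hn : (symmDiff A B).ncard ≤ (symmDiff (gridLevel N n A) (gridLevel N n B)).ncard) :
    Set.InjOn (fun u : UnitAddCircle => N • u) (symmDiff A B) ∧
      ∀ m, m ≠ n → symmDiff (gridLevel N m A) (gridLevel N m B) = ∅ := by
  have himg : symmDiff (gridLevel N n A) (gridLevel N n B) = (fun u => N • u) '' symmDiff A B :=
    Set.eq_of_subset_of_ncard_le (symmDiff_gridLevel_subset n A B)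
      ((Set.ncard_image_le h.finite).trans hn) (h.finite.image _)
  have hinj : Set.InjOn (fun u : UnitAddCircle => N • u) (symmDiff A B) := by
    refine Set.injOn_of_ncard_image_eq ?_ h.finite
    refine le_antisymm (Set.ncard_image_le h.finite) ?_
    rwa [← himg]
  refine ⟨hinj, fun m hm => Set.eq_empty_of_forall_notMem fun s hs => hm ?_⟩
  obtain ⟨p, hp, rfl⟩ := symmDiff_gridLevel_subset m A B hs
  have hs' : N • p ∈ symmDiff (gridLevel N n A) (gridLevel N n B) := by
    rw [himg]; exact ⟨p, hp, rfl⟩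
  -- A change of the count by one crosses a single threshold. The threshold `n` is crossed at every
  -- jump, so no other one is.
  have := gridCount_of_injOn hinj hp
  simp only [Set.mem_symmDiff, mem_gridLevel] at hs hs'
  omega

/-- If one level set has as many jumps as `A`, and these are not zero in number, then the counting
function takes only two consecutive values. -/
theorem gridCount_mem_of_ncard_le {A B : Set UnitAddCircle} (h : IsTame A B)
    (h0 : (symmDiff A B).Nonempty) {n : ℕ}
    (hn : (symmDiff A B).ncard ≤ (symmDiff (gridLevel N n A) (gridLevel N n B)).ncard)
    (u : UnitAddCircle) : gridCount N A u = n ∨ gridCount N A u + 1 = n := by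
  obtain ⟨hinj, htriv⟩ := gridLevel_of_ncard_le h hn
  have hpos : 0 < (symmDiff (gridLevel N n A) (gridLevel N n B)).ncard :=
    lt_of_lt_of_le ((Set.ncard_pos h.finite).mpr h0) hn
  -- An empty or full set has the same left limits, hence no jumps. The levels `n + 1` and `n - 1`
  -- have no jumps; since level `n` lies strictly between empty and full, the former must be empty
  -- and, for `n > 0`, the latter full.
  have hne : ¬ (gridLevel N n A = ∅ ∨ gridLevel N n A = Set.univ) := by
    have hconst : ∀ C D : Set UnitAddCircle, IsTame C D → (C = ∅ ∨ C = Set.univ) →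
        symmDiff C D = ∅ := by
      rintro C D hCD (rfl | rfl)
      · have : D = ∅ := Set.eq_empty_of_forall_notMem fun v hv => by
          obtain ⟨ε, hε⟩ := (hCD.left v).exists
          simp at hε; exact hε hv
        simp [this]
      · have : D = Set.univ := Set.eq_univ_of_forall fun v => by
          obtain ⟨ε, hε⟩ := (hCD.left v).exists
          simpa using hε
        simp [this]
    intro hcon
    rw [hconst _ _ (h.gridLevel n) hcon] at hpos
    simp at hpos
  push Not at hne
  obtain ⟨hne1, hne2⟩ := hne
  have hup : gridLevel N (n + 1) A = ∅ := by
    refine ((h.gridLevel (n + 1)).eq_empty_or_univ (htriv _ (by omega))).resolve_right fun hu => ?_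
    refine hne2 (Set.eq_univ_of_forall fun s => ?_)
    obtain ⟨u, hu', hs⟩ : s ∈ gridLevel N (n + 1) A := by rw [hu]; trivial
    exact ⟨u, hu', by omega⟩
  have hlow : n ≤ gridCount N A u + 1 := by
    rcases Nat.eq_zero_or_pos n with rfl | hn0
    · omega
    have : gridLevel N (n - 1) A = Set.univ := by
      refine ((h.gridLevel (n - 1)).eq_empty_or_univ (htriv _ (by omega))).resolve_left fun hu => ?_
      refine hne1.ne_empty (Set.eq_empty_of_forall_notMem fun s hs => ?_)
      obtain ⟨u, hu', hs⟩ := hs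
      have : s ∈ gridLevel N (n - 1) A := ⟨u, hu', by omega⟩
      rw [hu] at this
      exact this
    have h1 : N • u ∈ gridLevel N (n - 1) A := by rw [this]; trivial
    rw [mem_gridLevel] at h1
    omega
  have hhigh : ¬ n + 1 ≤ gridCount N A u := by
    rw [← mem_gridLevel, hup]
    exact fun h => h
  omega

end Tame

/-! ### Fourier coefficients of an indicator function in terms of its jumps. -/

section Jumps

open Filter Topology

open Classical in
/-- The height of the jump at `p` of the indicator function of `A`. -/
noncomputable def jumpSign (A : Set UnitAddCircle) (p : UnitAddCircle) : ℂ :=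
  if p ∈ A then 1 else -1

/-- The Fourier transform of the derivative of the indicator function of `A`. -/
noncomputable def jumpSum (A B : Set UnitAddCircle) (k : ℤ) : ℂ :=
  ∑ᶠ p ∈ symmDiff A B, jumpSign A p * fourier k p

/-- The representative in `(0, 1]` of a point of the circle. -/
noncomputable def circleRep (p : UnitAddCircle) : ℝ := (AddCircle.equivIoc 1 0 p : ℝ)

theorem circleRep_mem (p : UnitAddCircle) : circleRep p ∈ Set.Ioc (0 : ℝ) 1 := by
  have h : circleRep p ∈ Set.Ioc (0 : ℝ) (0 + 1) := (AddCircle.equivIoc (1 : ℝ) 0 p).2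
  rwa [zero_add] at h

theorem coe_circleRep (p : UnitAddCircle) : ((circleRep p : ℝ) : UnitAddCircle) = p :=
  (AddCircle.equivIoc 1 0).symm_apply_apply p

theorem circleRep_coe {x : ℝ} (hx : x ∈ Set.Ioc (0 : ℝ) 1) : circleRep x = x := by
  have := (AddCircle.equivIoc (1 : ℝ) 0).apply_symm_apply ⟨x, by simpa using hx⟩
  exact congrArg Subtype.val this

theorem eventually_real_right {A B : Set UnitAddCircle} (h : IsTame A B) (x : ℝ) :
    ∀ᶠ y : ℝ in 𝓝[>] x, ((y : UnitAddCircle) ∈ A ↔ (x : UnitAddCircle) ∈ A) := by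
  have : Tendsto (fun y : ℝ => y - x) (𝓝[>] x) (𝓝[>] 0) := by
    refine tendsto_nhdsWithin_iff.mpr ⟨?_, ?_⟩
    · have : Tendsto (fun y : ℝ => y - x) (𝓝 x) (𝓝 (x - x)) :=
        (continuous_id.sub continuous_const).tendsto x
      rw [sub_self] at this
      exact this.mono_left nhdsWithin_le_nhds
    · filter_upwards [self_mem_nhdsWithin] with y hy using sub_pos.mpr (by simpa using hy)
  filter_upwards [this.eventually (h.right x)] with y hy
  rw [← hy, ← AddCircle.coe_add, add_sub_cancel]

theorem eventually_real_left {A B : Set UnitAddCircle} (h : IsTame A B) (x : ℝ) :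
    ∀ᶠ y : ℝ in 𝓝[<] x, ((y : UnitAddCircle) ∈ A ↔ (x : UnitAddCircle) ∈ B) := by
  have : Tendsto (fun y : ℝ => x - y) (𝓝[<] x) (𝓝[>] 0) := by
    refine tendsto_nhdsWithin_iff.mpr ⟨?_, ?_⟩
    · have : Tendsto (fun y : ℝ => x - y) (𝓝 x) (𝓝 (x - x)) :=
        (continuous_const.sub continuous_id).tendsto x
      rw [sub_self] at this
      exact this.mono_left nhdsWithin_le_nhds
    · filter_upwards [self_mem_nhdsWithin] with y hy using sub_pos.mpr (by simpa using hy)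
  filter_upwards [this.eventually (h.left x)] with y hy
  rw [← hy, ← AddCircle.coe_sub, sub_sub_cancel]

-- Integration by parts. Subtracting from the indicator times the character the step function of its
-- jumps gives `G`, continuous on `[0, 1]` and differentiable off the jumps. By periodicity the
-- first term has equal values at both ends, so only the sum of the jumps remains.
open Classical in
theorem integral_indicator_fourier {A B : Set UnitAddCircle} (h : IsTame A B) (k : ℤ) :
    2 * Real.pi * Complex.I * k *
      ∫ u, A.indicator (fun _ => (1 : ℂ)) u * fourier k u ∂AddCircle.haarAddCircle =
    - jumpSum A B k := by
  set J := h.finite.toFinset with hJ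
  have hjs : jumpSum A B k = ∑ p ∈ J, jumpSign A p * fourier k p :=
    finsum_mem_eq_finite_toFinset_sum _ h.finite
  set E : ℝ → ℂ := fun y => fourier k (y : UnitAddCircle) with hE
  have hEc : Continuous E := (fourier k).continuous.comp (AddCircle.continuous_mk' 1)
  let st : Set UnitAddCircle → ℝ → ℂ := fun C x => C.indicator (fun _ => (1 : ℂ)) (x : UnitAddCircle)
  let G : ℝ → ℂ := fun x => st A x * E x -
    ∑ p ∈ J, if circleRep p ≤ x then jumpSign A p * fourier k p else 0
  have hst : ∀ C D : Set UnitAddCircle, ∀ x y : ℝ,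
      ((x : UnitAddCircle) ∈ C ↔ (y : UnitAddCircle) ∈ D) → st C x = st D y := by
    intro C D x y hxy
    simp only [st, Set.indicator, hxy]
  have hright : ∀ x, Tendsto G (𝓝[>] x) (𝓝 (G x)) := by
    intro x
    have h1 : ∀ᶠ y in 𝓝[>] x, ∀ p ∈ J, (circleRep p ≤ y ↔ circleRep p ≤ x) := by
      refine (Finset.eventually_all J).mpr fun p _ => ?_
      by_cases hp : circleRep p ≤ x
      · filter_upwards [self_mem_nhdsWithin] with y hy
        exact ⟨fun _ => hp, fun _ => hp.trans (le_of_lt hy)⟩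
      · push Not at hp
        filter_upwards [nhdsWithin_le_nhds (Iio_mem_nhds hp)] with y hy
        simp only [Set.mem_Iio] at hy
        constructor <;> intro <;> linarith
    have h2 : G =ᶠ[𝓝[>] x] fun y => st A x * E y -
        ∑ p ∈ J, if circleRep p ≤ x then jumpSign A p * fourier k p else 0 := by
      filter_upwards [h1, eventually_real_right h x] with y hy1 hy2
      simp only [G, hst A A y x hy2]
      congr 1
      exact Finset.sum_congr rfl fun p hp => by simp only [hy1 p hp]
    refine Tendsto.congr' h2.symm (Tendsto.mono_left ?_ nhdsWithin_le_nhds)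
    exact ((continuous_const.mul hEc).sub continuous_const).tendsto x
  have hleft : ∀ x ∈ Set.Ioc (0 : ℝ) 1, Tendsto G (𝓝[<] x) (𝓝 (G x)) := by
    intro x hx
    have h1 : ∀ᶠ y in 𝓝[<] x, ∀ p ∈ J, (circleRep p ≤ y ↔ circleRep p < x) := by
      refine (Finset.eventually_all J).mpr fun p _ => ?_
      by_cases hp : circleRep p < x
      · filter_upwards [nhdsWithin_le_nhds (Ioi_mem_nhds hp)] with y hy
        exact ⟨fun _ => hp, fun _ => le_of_lt hy⟩
      · push Not at hp
        filter_upwards [self_mem_nhdsWithin] with y hy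
        simp only [Set.mem_Iio] at hy
        constructor <;> intro <;> linarith
    have h2 : G =ᶠ[𝓝[<] x] fun y => st B x * E y -
        ∑ p ∈ J, if circleRep p < x then jumpSign A p * fourier k p else 0 := by
      filter_upwards [h1, eventually_real_left h x] with y hy1 hy2
      simp only [G, hst A B y x hy2]
      congr 1
      exact Finset.sum_congr rfl fun p hp => by simp only [hy1 p hp]
    -- If `x` is itself a jump, the change from `B` to `A` is cancelled by the summand that enters
    -- at `x`.
    have h3 : G x = st B x * E x -
        ∑ p ∈ J, if circleRep p < x then jumpSign A p * fourier k p else 0 := by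
      have h4 : ∀ p ∈ J, (if circleRep p ≤ x then jumpSign A p * fourier k p else 0) =
          (if circleRep p < x then jumpSign A p * fourier k p else 0) +
          if p = (x : UnitAddCircle) then jumpSign A p * fourier k p else 0 := by
        intro p _
        by_cases hp : p = (x : UnitAddCircle)
        · subst hp
          simp [circleRep_coe hx]
        · have : circleRep p ≠ x := fun h => hp (by rw [← h, coe_circleRep])
          simp [hp, le_iff_lt_or_eq, this]
      simp only [G]
      rw [Finset.sum_congr rfl h4, Finset.sum_add_distrib, Finset.sum_ite_eq']
      have h5 : st A x = st B x + if (x : UnitAddCircle) ∈ J then jumpSign A x else 0 := by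
        simp only [st, hJ, Set.Finite.mem_toFinset, Set.mem_symmDiff, jumpSign, Set.indicator]
        by_cases hA : (x : UnitAddCircle) ∈ A <;> by_cases hB : (x : UnitAddCircle) ∈ B <;>
          simp [hA, hB]
      rw [h5]
      simp only [hE]
      split_ifs <;> ring
    rw [h3]
    refine Tendsto.congr' h2.symm (Tendsto.mono_left ?_ nhdsWithin_le_nhds)
    exact ((continuous_const.mul hEc).sub continuous_const).tendsto x
  have hcont : ContinuousOn G (Set.Icc 0 1) := by
    intro x hx
    rcases eq_or_lt_of_le hx.1 with h0 | h0
    · have h1 : ContinuousWithinAt G (Set.Ici x) x :=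
        continuousWithinAt_Ioi_iff_Ici.mp (hright x)
      exact h1.mono fun y hy => by rw [← h0]; exact hy.1
    · exact (continuousAt_iff_continuous_left'_right'.mpr
        ⟨hleft x ⟨h0, hx.2⟩, hright x⟩).continuousWithinAt
  have hder : ∀ x ∈ Set.Ioo (0 : ℝ) 1 \ (J.image circleRep : Set ℝ),
      HasDerivAt G (2 * Real.pi * Complex.I * k * (st A x * E x)) x := by
    rintro x ⟨hx, hxJ⟩
    have hx' : x ∈ Set.Ioc (0 : ℝ) 1 := ⟨hx.1, hx.2.le⟩
    have hxA : (x : UnitAddCircle) ∉ symmDiff A B := fun hmem => hxJ (by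
      rw [Finset.coe_image]
      exact ⟨x, by simpa [hJ] using hmem, circleRep_coe hx'⟩)
    have h1 : ∀ᶠ y in 𝓝 x, ∀ p ∈ J, (circleRep p ≤ y ↔ circleRep p ≤ x) := by
      refine (Finset.eventually_all J).mpr fun p hpJ => ?_
      rcases lt_trichotomy (circleRep p) x with hp | hp | hp
      · filter_upwards [Ioi_mem_nhds hp] with y hy
        exact ⟨fun _ => hp.le, fun _ => le_of_lt hy⟩
      · exact absurd (by rw [Finset.coe_image]; exact ⟨p, hpJ, hp⟩) hxJ
      · filter_upwards [Iio_mem_nhds hp] with y hy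
        simp only [Set.mem_Iio] at hy
        constructor <;> intro <;> linarith
    have h2 : G =ᶠ[𝓝 x] fun y => st A x * E y -
        ∑ p ∈ J, if circleRep p ≤ x then jumpSign A p * fourier k p else 0 := by
      have h3 := (AddCircle.continuous_mk' (1 : ℝ)).continuousAt (x := x)
        |>.eventually (h.eventually_mem_iff hxA)
      filter_upwards [h1, h3] with y hy1 hy2
      simp only [G, hst A A y x hy2]
      congr 1
      exact Finset.sum_congr rfl fun p hp => by simp only [hy1 p hp]
    refine HasDerivAt.congr_of_eventuallyEq ?_ h2
    have := ((hasDerivAt_fourier 1 k x).const_mul (st A x)).sub_const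
      (∑ p ∈ J, if circleRep p ≤ x then jumpSign A p * fourier k p else 0)
    convert this using 1
    simp only [hE]
    push_cast
    ring
  have hint : IntervalIntegrable (fun x => 2 * Real.pi * Complex.I * k * (st A x * E x))
      volume 0 1 := by
    rw [intervalIntegrable_iff]
    have hm : Measurable fun x : ℝ => 2 * Real.pi * Complex.I * k * (st A x * E x) := by
      refine (Measurable.mul ?_ hEc.measurable).const_mul _
      exact (measurable_const.indicator h.measurableSet).comp AddCircle.measurable_mk'
    refine Measure.integrableOn_of_bounded (M := ‖2 * Real.pi * Complex.I * k‖) (by simp)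
      hm.aestronglyMeasurable (ae_of_all _ fun x => ?_)
    rw [norm_mul]
    refine mul_le_of_le_one_right (norm_nonneg _) ?_
    rw [norm_mul]
    have h1 : ‖E x‖ = 1 := by simp only [hE, fourier_apply]; exact Circle.norm_coe _
    rw [h1, mul_one]
    simp only [st, Set.indicator]
    split_ifs <;> simp
  have key := integral_eq_of_hasDerivAt_off_countable_of_le G _ zero_le_one
    (J.image circleRep).countable_toSet hcont hder hint
  have h6 : (∫ x in (0 : ℝ)..1, 2 * Real.pi * Complex.I * k * (st A x * E x)) =
      2 * Real.pi * Complex.I * k *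
        ∫ u, A.indicator (fun _ => (1 : ℂ)) u * fourier k u ∂AddCircle.haarAddCircle := by
    rw [intervalIntegral.integral_const_mul, AddCircle.integral_haarAddCircle]
    congr 1
    have := UnitAddCircle.intervalIntegral_preimage 0
      (fun u => A.indicator (fun _ => (1 : ℂ)) u * fourier k u)
    rw [zero_add] at this
    rw [this]; simp
  rw [← h6, key, hjs]
  have h7 : st A 1 * E 1 = st A 0 * E 0 := by
    have : ((1 : ℝ) : UnitAddCircle) = ((0 : ℝ) : UnitAddCircle) := by
      rw [AddCircle.coe_period, AddCircle.coe_zero]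
    simp only [st, hE, this]
  -- With representatives in `(0, 1]`, all jumps are counted at `1` and none at `0`.
  have h8 : ∑ p ∈ J, (if circleRep p ≤ 1 then jumpSign A p * fourier k p else 0) =
      ∑ p ∈ J, jumpSign A p * fourier k p :=
    Finset.sum_congr rfl fun p _ => if_pos (circleRep_mem p).2
  have h9 : ∑ p ∈ J, (if circleRep p ≤ 0 then jumpSign A p * fourier k p else 0) = 0 :=
    Finset.sum_eq_zero fun p _ => if_neg (not_le.mpr (circleRep_mem p).1)
  simp only [G, h7, h8, h9]
  ring

end Jumps

/-! ### Lowering the number of jumps by an averaging argument. -/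

section Averaging

open Filter Topology ComplexConjugate

theorem jumpSum_eq_sum {A B : Set UnitAddCircle} (h : IsTame A B) (k : ℤ) :
    jumpSum A B k = ∑ p ∈ h.finite.toFinset, jumpSign A p * fourier k p :=
  finsum_mem_eq_finite_toFinset_sum _ h.finite

theorem jumpSum_zero {A B : Set UnitAddCircle} (h : IsTame A B) : jumpSum A B 0 = 0 := by
  have := integral_indicator_fourier h 0
  simpa using this.symm

/-- `jumpSum` at frequency `0` is the number of upward jumps minus the number of downward ones, and
it vanishes. -/
theorem even_ncard_symmDiff {A B : Set UnitAddCircle} (h : IsTame A B) :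
    Even (symmDiff A B).ncard := by
  classical
  rw [Set.ncard_eq_toFinset_card _ h.finite]
  have h0 := jumpSum_zero h
  rw [jumpSum_eq_sum h] at h0
  simp only [fourier_zero, mul_one, jumpSign, Finset.sum_ite, Finset.sum_const] at h0
  rw [← Finset.card_filter_add_card_filter_not (s := h.finite.toFinset) (· ∈ A)]
  have h1 : ((h.finite.toFinset.filter (· ∈ A)).card : ℂ) =
      ((h.finite.toFinset.filter (fun p => ¬ p ∈ A)).card : ℂ) := by
    simp at h0
    linear_combination h0
  rw [Nat.cast_injective h1]
  exact Even.add_self _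

theorem exists_mem_notMem_of_ncard_eq_two {A B : Set UnitAddCircle} (h : IsTame A B)
    (h2 : (symmDiff A B).ncard = 2) : ∃ p q, p ∈ A ∧ q ∉ A ∧ symmDiff A B = {p, q} := by
  classical
  obtain ⟨p, q, hpq, hJ⟩ := Set.ncard_eq_two.mp h2
  have h0 := jumpSum_zero h
  rw [jumpSum_eq_sum h] at h0
  have hf : h.finite.toFinset = {p, q} := by ext x; simp [hJ]
  rw [hf, Finset.sum_pair hpq] at h0
  simp only [fourier_zero, mul_one, jumpSign] at h0
  by_cases hp : p ∈ A <;> by_cases hq : q ∈ A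
  · rw [if_pos hp, if_pos hq] at h0; norm_num at h0
  · exact ⟨p, q, hp, hq, hJ⟩
  · exact ⟨q, p, hq, hp, by rw [hJ, Set.pair_comm]⟩
  · rw [if_neg hp, if_neg hq] at h0; norm_num at h0

theorem conj_jumpSum {A B : Set UnitAddCircle} (h : IsTame A B) (k : ℤ) :
    conj (jumpSum A B k) = jumpSum A B (-k) := by
  rw [jumpSum_eq_sum h, jumpSum_eq_sum h, map_sum]
  refine Finset.sum_congr rfl fun p _ => ?_
  rw [map_mul, fourier_neg]
  congr 1
  unfold jumpSign; split_ifs <;> simp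

theorem norm_jumpSum_neg {A B : Set UnitAddCircle} (h : IsTame A B) (k : ℤ) :
    ‖jumpSum A B (-k)‖ = ‖jumpSum A B k‖ := by
  rw [← conj_jumpSum h, RCLike.norm_conj]

theorem tendsto_average_pow {z : ℂ} (hz : ‖z‖ = 1) (hz1 : z ≠ 1) :
    Tendsto (fun M : ℕ => (M : ℂ)⁻¹ * ∑ n ∈ Finset.range M, z ^ (n + 1)) atTop (𝓝 0) := by
  have hz0 : z - 1 ≠ 0 := sub_ne_zero.mpr hz1
  refine squeeze_zero_norm (a := fun M : ℕ => (M : ℝ)⁻¹ * (2 / ‖z - 1‖)) (fun M => ?_) ?_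
  · rw [norm_mul, norm_inv, Complex.norm_natCast]
    gcongr
    have h1 : ∑ n ∈ Finset.range M, z ^ (n + 1) = z * ((z ^ M - 1) / (z - 1)) := by
      rw [← geom_sum_eq hz1, Finset.mul_sum]
      exact Finset.sum_congr rfl fun n _ => pow_succ' z n
    rw [h1, norm_mul, hz, one_mul, norm_div]
    gcongr
    refine (norm_sub_le _ _).trans ?_
    rw [norm_pow, hz]; norm_num
  · have := (tendsto_inv_atTop_nhds_zero_nat (𝕜 := ℝ)).mul_const (2 / ‖z - 1‖)
    rwa [zero_mul] at this

theorem tendsto_average_one :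
    Tendsto (fun M : ℕ => (M : ℂ)⁻¹ * ∑ n ∈ Finset.range M, (1 : ℂ) ^ (n + 1)) atTop (𝓝 1) := by
  refine tendsto_const_nhds.congr' ?_
  filter_upwards [eventually_gt_atTop 0] with M hM
  have : (M : ℂ) ≠ 0 := by exact_mod_cast hM.ne'
  simp [this]

theorem fourier_one_eq_one_iff {t : UnitAddCircle} : fourier 1 t = (1 : ℂ) ↔ t = 0 := by
  constructor
  · intro h
    rw [fourier_one] at h
    have h1 : AddCircle.toCircle t = AddCircle.toCircle (0 : UnitAddCircle) := by
      apply Circle.ext; rw [h]; simp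
    exact AddCircle.injective_toCircle one_ne_zero h1
  · rintro rfl; simp

theorem fourier_natCast_mul (m n : ℕ) (t : UnitAddCircle) :
    fourier ((m * n : ℕ) : ℤ) t = (fourier 1 (m • t) : ℂ) ^ n := by
  simp only [fourier_apply, ← Circle.coe_pow, ← AddCircle.toCircle_nsmul]
  congr 2
  rw [one_smul, natCast_zsmul, smul_smul, mul_comm]

theorem fourier_apply_sub (n : ℤ) (x y : UnitAddCircle) :
    (fourier n (x - y) : ℂ) = fourier n x * fourier (-n) y := by
  rw [fourier_apply, fourier_apply, fourier_apply, neg_smul, smul_sub, sub_eq_add_neg,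
    AddCircle.toCircle_add, Circle.coe_mul]

/-- The mean square of the jump sums along multiples of `m`. -/
theorem tendsto_average_sq_jumpSum {A B : Set UnitAddCircle} (h : IsTame A B) (m : ℕ)
    (hinj : Set.InjOn (fun u : UnitAddCircle => m • u) (symmDiff A B)) :
    Tendsto (fun M : ℕ => (M : ℝ)⁻¹ * ∑ n ∈ Finset.range M,
      ‖jumpSum A B ((m * (n + 1) : ℕ) : ℤ)‖ ^ 2) atTop (𝓝 ((symmDiff A B).ncard : ℝ)) := by
  classical
  set J := h.finite.toFinset with hJ
  have hsq : ∀ n : ℕ, ((‖jumpSum A B ((m * (n + 1) : ℕ) : ℤ)‖ ^ 2 : ℝ) : ℂ) =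
      ∑ p ∈ J, ∑ q ∈ J, jumpSign A p * jumpSign A q * (fourier 1 (m • (p - q)) : ℂ) ^ (n + 1) := by
    intro n
    rw [Complex.ofReal_pow, ← Complex.mul_conj', conj_jumpSum h, jumpSum_eq_sum h, jumpSum_eq_sum h,
      Finset.sum_mul_sum]
    refine Finset.sum_congr rfl fun p _ => Finset.sum_congr rfl fun q _ => ?_
    rw [← fourier_natCast_mul, fourier_apply_sub]
    ring
  have hlim : Tendsto (fun M : ℕ => ∑ p ∈ J, ∑ q ∈ J, jumpSign A p * jumpSign A q *
      ((M : ℂ)⁻¹ * ∑ n ∈ Finset.range M, (fourier 1 (m • (p - q)) : ℂ) ^ (n + 1))) atTop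
      -- Only the diagonal survives: for `p ≠ q` injectivity of multiplication by `m` makes the
      -- ratio of the geometric progression different from `1`.
      (𝓝 (∑ p ∈ J, ∑ q ∈ J, jumpSign A p * jumpSign A q * if p = q then 1 else 0)) := by
    refine tendsto_finsetSum _ fun p hp => tendsto_finsetSum _ fun q hq =>
      Tendsto.const_mul _ ?_
    by_cases hpq : p = q
    · subst hpq
      simpa using tendsto_average_one
    · rw [if_neg hpq]
      refine tendsto_average_pow ?_ ?_
      · rw [fourier_apply]; exact Circle.norm_coe _
      · rw [Ne, fourier_one_eq_one_iff, nsmul_sub, sub_eq_zero]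
        exact fun h' => hpq (hinj (by simpa [hJ] using hp) (by simpa [hJ] using hq) h')
  have hval : (∑ p ∈ J, ∑ q ∈ J, jumpSign A p * jumpSign A q * if p = q then 1 else 0) =
      (((symmDiff A B).ncard : ℝ) : ℂ) := by
    rw [Set.ncard_eq_toFinset_card _ h.finite]
    simp only [mul_ite, mul_one, mul_zero, Finset.sum_ite_eq]
    rw [Finset.sum_congr rfl (g := fun _ => (1 : ℂ))]
    · simp [hJ]
    · intro p hp
      rw [if_pos hp]
      unfold jumpSign; split_ifs <;> simp
  rw [hval] at hlim
  have hre := (Complex.continuous_re.tendsto _).comp hlim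
  rw [Complex.ofReal_re] at hre
  refine hre.congr fun M => ?_
  have : (((M : ℝ)⁻¹ * ∑ n ∈ Finset.range M, ‖jumpSum A B ((m * (n + 1) : ℕ) : ℤ)‖ ^ 2 : ℝ) : ℂ) =
      ∑ p ∈ J, ∑ q ∈ J, jumpSign A p * jumpSign A q *
      ((M : ℂ)⁻¹ * ∑ n ∈ Finset.range M, (fourier 1 (m • (p - q)) : ℂ) ^ (n + 1)) := by
    rw [Complex.ofReal_mul, Complex.ofReal_sum, Finset.sum_congr rfl fun n _ => hsq n,
      Finset.sum_comm, Finset.mul_sum]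
    refine Finset.sum_congr rfl fun p _ => ?_
    rw [Finset.sum_comm, Finset.mul_sum]
    refine Finset.sum_congr rfl fun q _ => ?_
    rw [← Finset.mul_sum]
    push_cast
    ring
  rw [Function.comp_apply, ← this, Complex.ofReal_re]

/-- The count is a sum of `N` translates of the indicator by multiples of `1 / N`, and these
translations fix characters whose frequency is a multiple of `N`. -/
theorem integral_gridCount_fourier {A B : Set UnitAddCircle} (h : IsTame A B) (N : ℕ) [NeZero N]
    (k : ℤ) :
    ∫ u, (gridCount N A u : ℂ) * fourier (k * N) u ∂AddCircle.haarAddCircle =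
      N * ∫ u, A.indicator (fun _ => (1 : ℂ)) u * fourier (k * N) u ∂AddCircle.haarAddCircle := by
  classical
  have hbd : ∀ (C : Set UnitAddCircle), MeasurableSet C → ∀ m : ℤ,
      Integrable (fun u => C.indicator (fun _ => (1 : ℂ)) u * fourier m u)
        AddCircle.haarAddCircle := by
    intro C hC m
    refine Integrable.of_bound ((measurable_const.indicator hC).mul
      (fourier m).continuous.measurable).aestronglyMeasurable 1 (ae_of_all _ fun u => ?_)
    rw [norm_mul, fourier_apply, Circle.norm_coe, mul_one]
    simp only [Set.indicator]
    split_ifs <;> simp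
  have hsum : ∀ u, (gridCount N A u : ℂ) * fourier (k * N) u =
      ∑ j : ZMod N, A.indicator (fun _ => (1 : ℂ)) (u + ZMod.toAddCircle j) *
        fourier (k * N) (u + ZMod.toAddCircle j) := by
    intro u
    have hper : ∀ j : ZMod N, (fourier (k * N) (u + ZMod.toAddCircle j) : ℂ) =
        fourier (k * N) u := by
      intro j
      simp only [fourier_apply]
      rw [smul_add, mul_smul k (N : ℤ) (ZMod.toAddCircle j), natCast_zsmul,
        nsmul_toAddCircle, smul_zero, add_zero]
    simp only [hper, ← Finset.sum_mul, gridCount, Set.indicator, Finset.sum_boole]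
  simp only [hsum]
  rw [integral_finsetSum _ fun j _ => ?_]
  · simp only [integral_add_right_eq_self
      (fun u => A.indicator (fun _ => (1 : ℂ)) u * fourier (k * N) u)]
    simp
  · exact (hbd A h.measurableSet _).comp_add_right _

theorem measurable_gridCount {A B : Set UnitAddCircle} (h : IsTame A B) (N : ℕ) [NeZero N] :
    Measurable fun u => (gridCount N A u : ℂ) := by
  classical
  have : (fun u => (gridCount N A u : ℂ)) = fun u => ∑ j : ZMod N,
      A.indicator (fun _ => (1 : ℂ)) (u + ZMod.toAddCircle j) := by
    ext u; simp [gridCount, Set.indicator, Finset.sum_boole]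
  rw [this]
  exact Finset.measurable_sum _ fun j _ =>
    (measurable_const.indicator h.measurableSet).comp (measurable_add_const _)

theorem integral_fourier_of_ne_zero {m : ℤ} (hm : m ≠ 0) :
    ∫ u : UnitAddCircle, (fourier m u : ℂ) ∂AddCircle.haarAddCircle = 0 :=
  integral_eq_zero_of_add_right_eq_neg (μ := AddCircle.haarAddCircle)
    (fourier_add_half_inv_index (T := (1 : ℝ)) hm one_pos)

/-- The constant `c` has no coefficient at a nonzero frequency, and the factor `N` from summing
translates cancels the `N` in the denominator `2 π k N`. -/
theorem norm_integral_gridCount_sub_fourier {A B : Set UnitAddCircle} (h : IsTame A B) (N : ℕ)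
    [NeZero N] (c : ℂ) (k : ℤ) (hk : k ≠ 0) :
    ‖∫ u, fourier (-(k * N)) u • ((gridCount N A u : ℂ) - c) ∂AddCircle.haarAddCircle‖ =
      ‖jumpSum A B (k * N)‖ / (2 * Real.pi * |(k : ℝ)|) := by
  have hkN : -(k * (N : ℤ)) ≠ 0 := neg_ne_zero.mpr (mul_ne_zero hk (by simpa using NeZero.ne N))
  have hint : Integrable (fun u => (gridCount N A u : ℂ) * fourier (-(k * N)) u)
      AddCircle.haarAddCircle := by
    refine Integrable.of_bound ((measurable_gridCount h N).mul
      (fourier _).continuous.measurable).aestronglyMeasurable (N : ℝ) (ae_of_all _ fun u => ?_)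
    rw [norm_mul, fourier_apply, Circle.norm_coe, mul_one, Complex.norm_natCast]
    exact_mod_cast (Finset.card_le_univ _).trans_eq (ZMod.card N)
  have hint' : Integrable (fun u : UnitAddCircle => c * fourier (-(k * N)) u)
      AddCircle.haarAddCircle := by
    refine Integrable.const_mul ?_ _
    exact Integrable.of_bound (fourier _).continuous.measurable.aestronglyMeasurable 1
      (ae_of_all _ fun u => by rw [fourier_apply, Circle.norm_coe])
  have h1 : ∫ u, fourier (-(k * N)) u • ((gridCount N A u : ℂ) - c) ∂AddCircle.haarAddCircle =
      ∫ u, (gridCount N A u : ℂ) * fourier (-(k * N)) u ∂AddCircle.haarAddCircle := by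
    have h2 : ∀ u, fourier (-(k * (N : ℤ))) u • ((gridCount N A u : ℂ) - c) =
        (gridCount N A u : ℂ) * fourier (-(k * N)) u - c * fourier (-(k * N)) u := by
      intro u; rw [smul_eq_mul]; ring
    simp only [h2]
    rw [integral_sub hint hint', integral_const_mul, integral_fourier_of_ne_zero hkN, mul_zero,
      sub_zero]
  rw [h1, ← neg_mul, integral_gridCount_fourier h]
  have h3 := congrArg norm (integral_indicator_fourier h (-k * N))
  rw [norm_neg, neg_mul, norm_jumpSum_neg h] at h3
  simp only [norm_mul, Complex.norm_I, Complex.norm_real, Complex.norm_two, Int.cast_neg,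
    Int.cast_mul, Int.cast_natCast, norm_neg, Complex.norm_natCast, Complex.norm_intCast,
    Real.norm_eq_abs, abs_of_pos Real.pi_pos, mul_one] at h3
  rw [norm_mul, Complex.norm_natCast, ← h3, neg_mul]
  have : |(k : ℝ)| ≠ 0 := by simpa using hk
  have := Real.pi_pos.ne'
  field_simp

theorem sum_sq_fourierCoeff_le {g : UnitAddCircle → ℂ} (hg : MemLp g 2 AddCircle.haarAddCircle)
    (s : Finset ℤ) :
    ∑ k ∈ s, ‖fourierCoeff g k‖ ^ 2 ≤ ∫ t, ‖g t‖ ^ 2 ∂AddCircle.haarAddCircle := by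
  have h1 := sum_le_hasSum s (fun i _ => sq_nonneg _) (hasSum_sq_fourierCoeff hg.toLp)
  rw [fourierCoeff_congr_ae hg.coeFn_toLp] at h1
  refine h1.trans_eq (integral_congr_ae ?_)
  filter_upwards [hg.coeFn_toLp] with u hu
  rw [hu]

/-- Centred at `n - 1 / 2`, the count has modulus exactly `1 / 2`. Bessel's inequality at the four
frequencies `±N`, `±2N` bounds the sum of the squared coefficients by `1 / 4`. -/
theorem sq_jumpSum_le {A B : Set UnitAddCircle} (h : IsTame A B) (N : ℕ) [NeZero N] (n : ℕ)
    (hn : ∀ u, gridCount N A u = n ∨ gridCount N A u + 1 = n) :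
    ‖jumpSum A B (N : ℤ)‖ ^ 2 + ‖jumpSum A B ((2 * N : ℕ) : ℤ)‖ ^ 2 / 4 ≤ Real.pi ^ 2 / 2 := by
  set g : UnitAddCircle → ℂ := fun u => (gridCount N A u : ℂ) - (n - 1 / 2) with hg
  have hgn : ∀ u, ‖g u‖ = 1 / 2 := by
    intro u
    rcases hn u with h1 | h1
    · simp [hg, h1]
    · have : g u = -(1 / 2) := by simp only [hg, ← h1]; push_cast; ring
      rw [this]; simp
  have hgm : Measurable g := (measurable_gridCount h N).sub_const _
  have hgL : MemLp g 2 AddCircle.haarAddCircle :=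
    MemLp.of_bound hgm.aestronglyMeasurable (1 / 2) (ae_of_all _ fun u => (hgn u).le)
  have hcoef : ∀ k : ℤ, k ≠ 0 → ‖fourierCoeff g (k * N)‖ =
      ‖jumpSum A B (k * N)‖ / (2 * Real.pi * |(k : ℝ)|) := fun k hk =>
    norm_integral_gridCount_sub_fourier h N _ k hk
  have hN : (N : ℤ) ≠ 0 := by simpa using NeZero.ne N
  have hle := sum_sq_fourierCoeff_le hgL (({1, -1, 2, -2} : Finset ℤ).image
    (fun k : ℤ => k * (N : ℤ)))
  rw [Finset.sum_image (fun a _ b _ hab => mul_right_cancel₀ hN hab)] at hle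
  simp only [hgn, integral_const] at hle
  rw [Finset.sum_insert (by decide), Finset.sum_insert (by decide), Finset.sum_insert (by decide),
    Finset.sum_singleton, hcoef 1 (by norm_num), hcoef (-1) (by norm_num), hcoef 2 (by norm_num),
    hcoef (-2) (by norm_num), neg_mul, neg_mul, norm_jumpSum_neg h, norm_jumpSum_neg h] at hle
  have e1 : ((2 * N : ℕ) : ℤ) = 2 * N := by push_cast; ring
  rw [one_mul] at hle
  rw [e1]
  norm_num at hle
  have hpi := Real.pi_pos
  set a := ‖jumpSum A B N‖
  set b := ‖jumpSum A B (2 * N)‖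
  have e2 : (a / (2 * Real.pi)) ^ 2 = a ^ 2 / (4 * Real.pi ^ 2) := by ring
  have e3 : (b / (2 * Real.pi * 2)) ^ 2 = b ^ 2 / 4 / (4 * Real.pi ^ 2) := by ring
  rw [e2, e3] at hle
  have : (a ^ 2 + b ^ 2 / 4) / (4 * Real.pi ^ 2) ≤ 1 / 8 := by
    rw [add_div]; linarith
  rw [div_le_iff₀ (by positivity)] at this
  linarith

/-- A set with more than two jumps has level sets with fewer jumps. -/
theorem exists_ncard_gridLevel_lt {A B : Set UnitAddCircle} (h : IsTame A B)
    (h3 : 3 ≤ (symmDiff A B).ncard) : ∃ (N : ℕ) (_ : NeZero N), ∀ n,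
      (symmDiff (gridLevel N n A) (gridLevel N n B)).ncard < (symmDiff A B).ncard := by
  by_contra! hcon
  have h4 : (4 : ℝ) ≤ (symmDiff A B).ncard := by
    have := even_ncard_symmDiff h
    have : 4 ≤ (symmDiff A B).ncard := by
      rcases this with ⟨r, hr⟩; omega
    exact_mod_cast this
  have hne : (symmDiff A B).Nonempty := by
    rw [← Set.ncard_pos h.finite]; omega
  have hbound : ∀ n : ℕ, ‖jumpSum A B ((1 * (n + 1) : ℕ) : ℤ)‖ ^ 2 +
      ‖jumpSum A B ((2 * (n + 1) : ℕ) : ℤ)‖ ^ 2 / 4 ≤ Real.pi ^ 2 / 2 := by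
    intro n
    obtain ⟨m, hm⟩ := hcon (n + 1) inferInstance
    have := sq_jumpSum_le h (n + 1) m fun u => gridCount_mem_of_ncard_le h hne hm u
    rw [one_mul]
    exact this
  -- Failure at `m` itself shows that multiplication by `m` merges no jumps, so the means along
  -- multiples of `1` and of `2` both equal the number of jumps.
  have hinj : ∀ m : ℕ, m ≠ 0 → Set.InjOn (fun u : UnitAddCircle => m • u) (symmDiff A B) := by
    intro m hm
    obtain ⟨l, hl⟩ := hcon m ⟨hm⟩
    have := @gridLevel_of_ncard_le m ⟨hm⟩ A B h l hl
    exact this.1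
  have t1 := tendsto_average_sq_jumpSum h 1 (hinj 1 one_ne_zero)
  have t2 := tendsto_average_sq_jumpSum h 2 (hinj 2 two_ne_zero)
  have t3 := t1.add (t2.div_const 4)
  have hle : ((symmDiff A B).ncard : ℝ) + (symmDiff A B).ncard / 4 ≤ Real.pi ^ 2 / 2 := by
    refine le_of_tendsto t3 ?_
    filter_upwards [eventually_gt_atTop 0] with M hM
    have hM' : (0 : ℝ) < M := by exact_mod_cast hM
    rw [mul_div_assoc, ← mul_add, Finset.sum_div, ← Finset.sum_add_distrib]
    have := Finset.sum_le_card_nsmul (Finset.range M) _ _ fun n _ => hbound n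
    rw [Finset.card_range, nsmul_eq_mul] at this
    calc (M : ℝ)⁻¹ * _ ≤ (M : ℝ)⁻¹ * (M * (Real.pi ^ 2 / 2)) := by gcongr
      _ = _ := by field_simp
  -- Four jumps would give `5 ≤ π² / 2 < 4.97`. The frequencies `±N` alone give only `4 ≤ π² / 2`,
  -- which is no contradiction; hence the second harmonic.
  have hpi := Real.pi_lt_d2
  have := Real.pi_pos
  nlinarith

end Averaging

/-! ### Arcs, and sets with exactly two jumps. -/

section Arcs

open Filter Topology

/-- The image on the circle of the interval `[α, β)`. -/
def circleArc (α β : ℝ) : Set UnitAddCircle := (fun x : ℝ => (x : UnitAddCircle)) '' Set.Ico α β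

theorem coe_mem_circleArc {α β x : ℝ} (hβ : β ≤ α + 1) (hx : x ∈ Set.Ico α (α + 1)) :
    (x : UnitAddCircle) ∈ circleArc α β ↔ x < β := by
  constructor
  · rintro ⟨y, hy, hyx⟩
    have := (AddCircle.coe_eq_coe_iff_of_mem_Ico ⟨hy.1, hy.2.trans_le hβ⟩ hx).mp hyx
    exact this ▸ hy.2
  · exact fun h => ⟨x, ⟨hx.1, h⟩, rfl⟩

theorem coe_mem_image_Ioc {α β x : ℝ} (hβ : β ≤ α + 1) (hx : x ∈ Set.Ioc α (α + 1)) :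
    (x : UnitAddCircle) ∈ (fun x : ℝ => (x : UnitAddCircle)) '' Set.Ioc α β ↔ x ≤ β := by
  constructor
  · rintro ⟨y, hy, hyx⟩
    have := (AddCircle.coe_eq_coe_iff_of_mem_Ioc ⟨hy.1, hy.2.trans hβ⟩ hx).mp hyx
    exact this ▸ hy.2
  · exact fun h => ⟨x, ⟨hx.1, h⟩, rfl⟩

theorem exists_coe_eq_Ico (α : ℝ) (u : UnitAddCircle) :
    ∃ x ∈ Set.Ico α (α + 1), (x : UnitAddCircle) = u :=
  ⟨_, (AddCircle.equivIco 1 α u).2, (AddCircle.equivIco 1 α).symm_apply_apply u⟩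

theorem exists_coe_eq_Ioc (α : ℝ) (u : UnitAddCircle) :
    ∃ x ∈ Set.Ioc α (α + 1), (x : UnitAddCircle) = u :=
  ⟨_, (AddCircle.equivIoc 1 α u).2, (AddCircle.equivIoc 1 α).symm_apply_apply u⟩

theorem isTame_circleArc {α β : ℝ} (hαβ : α ≤ β) (hβ : β ≤ α + 1) :
    IsTame (circleArc α β) ((fun x : ℝ => (x : UnitAddCircle)) '' Set.Ioc α β) where
  right u := by
    obtain ⟨x, hx, rfl⟩ := exists_coe_eq_Ico α u
    rw [coe_mem_circleArc hβ hx]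
    have h0 : (0 : ℝ) < if x < β then β - x else α + 1 - x := by
      split_ifs with h
      · linarith
      · linarith [hx.2]
    filter_upwards [Ioo_mem_nhdsGT h0] with ε hε
    rw [← AddCircle.coe_add, coe_mem_circleArc hβ]
    · split_ifs at hε with h
      · exact ⟨fun _ => h, fun _ => by linarith [hε.2]⟩
      · exact ⟨fun _ => by linarith [hε.1], fun h' => absurd h' h⟩
    · refine ⟨by linarith [hx.1, hε.1], ?_⟩
      split_ifs at hε <;> linarith [hε.2]
  left u := by
    obtain ⟨x, hx, rfl⟩ := exists_coe_eq_Ioc α u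
    rw [coe_mem_image_Ioc hβ hx]
    have h0 : (0 : ℝ) < if x ≤ β then x - α else x - β := by
      split_ifs with h
      · linarith [hx.1]
      · linarith
    filter_upwards [Ioo_mem_nhdsGT h0] with ε hε
    rw [← AddCircle.coe_sub, coe_mem_circleArc hβ]
    · split_ifs at hε with h
      · exact ⟨fun _ => h, fun _ => by linarith [hε.1]⟩
      · exact ⟨fun h' => by linarith [hε.2], fun h' => absurd h' h⟩
    · refine ⟨?_, by linarith [hx.2, hε.1]⟩
      split_ifs at hε <;> linarith [hε.2]
  finite := by
    refine ((Set.finite_singleton (β : UnitAddCircle)).insert (α : UnitAddCircle)).subset ?_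
    rintro u (⟨⟨x, hx, rfl⟩, h2⟩ | ⟨⟨x, hx, rfl⟩, h2⟩)
    · rcases eq_or_lt_of_le hx.1 with rfl | h
      · simp
      · exact absurd ⟨x, ⟨h, hx.2.le⟩, rfl⟩ h2
    · rcases eq_or_lt_of_le hx.2 with rfl | h
      · simp
      · exact absurd ⟨x, ⟨hx.1.le, h⟩, rfl⟩ h2

/-- Membership is locally constant on the interval, at its left end by continuity from the right,
and the interval is connected. -/
theorem IsTame.mem_iff_of_Ico {A B : Set UnitAddCircle} (h : IsTame A B) {c e : ℝ}
    (hce : ∀ x ∈ Set.Ioo c e, (x : UnitAddCircle) ∉ symmDiff A B) {x : ℝ} (hx : x ∈ Set.Ico c e) :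
    (x : UnitAddCircle) ∈ A ↔ (c : UnitAddCircle) ∈ A := by
  refine isPreconnected_Ico.induction₂
    (fun x y : ℝ => ((x : UnitAddCircle) ∈ A ↔ (y : UnitAddCircle) ∈ A)) ?_
    (fun _ _ _ _ _ _ h1 h2 => h1.trans h2) (fun _ _ _ _ h1 => h1.symm) hx
    ⟨le_rfl, hx.1.trans_lt hx.2⟩
  intro y hy
  rcases eq_or_lt_of_le hy.1 with rfl | hlt
  · have h1 : ∀ᶠ z : ℝ in 𝓝[≥] c, ((z : UnitAddCircle) ∈ A ↔ (c : UnitAddCircle) ∈ A) := by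
      rw [← Set.Ioi_insert, nhdsWithin_insert, eventually_sup]
      exact ⟨by simp, eventually_real_right h c⟩
    have h2 : 𝓝[Set.Ico c e] c ≤ 𝓝[≥] c := nhdsWithin_mono _ fun z hz => hz.1
    filter_upwards [h2 h1] with z hz using hz.symm
  · have h1 := (AddCircle.continuous_mk' (1 : ℝ)).continuousAt (x := y)
      |>.eventually (h.eventually_mem_iff (hce y ⟨hlt, hy.2⟩))
    filter_upwards [nhdsWithin_le_nhds h1] with z hz using hz.symm

/-- A set with exactly two jumps is an arc. -/
theorem IsTame.eq_circleArc {A B : Set UnitAddCircle} (h : IsTame A B)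
    (h2 : (symmDiff A B).ncard = 2) :
    ∃ α β : ℝ, α < β ∧ β < α + 1 ∧ A = circleArc α β := by
  obtain ⟨p, q, hp, hq, hJ⟩ := exists_mem_notMem_of_ncard_eq_two h h2
  obtain ⟨α, rfl⟩ := QuotientAddGroup.mk_surjective p
  obtain ⟨β, hβ, rfl⟩ := exists_coe_eq_Ico α q
  have hαβ : α < β := lt_of_le_of_ne hβ.1 (by rintro rfl; exact hq hp)
  have hnot : ∀ x, x ∈ Set.Ioo α (α + 1) → x ≠ β → (x : UnitAddCircle) ∉ symmDiff A B := by
    intro x hx hxβ hmem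
    have hxI : x ∈ Set.Ico α (α + 1) := ⟨hx.1.le, hx.2⟩
    rw [hJ] at hmem
    rcases hmem with hmem | hmem
    · exact hx.1.ne' ((AddCircle.coe_eq_coe_iff_of_mem_Ico hxI ⟨le_rfl, by linarith⟩).mp hmem)
    · exact hxβ ((AddCircle.coe_eq_coe_iff_of_mem_Ico hxI hβ).mp hmem)
  refine ⟨α, β, hαβ, hβ.2, Set.ext fun u => ?_⟩
  obtain ⟨x, hx, rfl⟩ := exists_coe_eq_Ico α u
  rw [coe_mem_circleArc hβ.2.le hx]
  by_cases hxβ : x < β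
  · have := h.mem_iff_of_Ico (c := α) (e := β)
      (fun y hy => hnot y ⟨hy.1, hy.2.trans hβ.2⟩ hy.2.ne) ⟨hx.1, hxβ⟩
    simp only [this, hxβ, iff_true]
    exact hp
  · have := h.mem_iff_of_Ico (c := β) (e := α + 1)
      (fun y hy => hnot y ⟨hαβ.trans hy.1, hy.2⟩ hy.1.ne') ⟨not_lt.mp hxβ, hx.2⟩
    simp only [this, hxβ, iff_false]
    exact hq

theorem volume_circleArc {α β : ℝ} (hαβ : α ≤ β) (hβ : β ≤ α + 1) :
    AddCircle.haarAddCircle.real (circleArc α β) = β - α := by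
  have hm := (isTame_circleArc hαβ hβ).measurableSet
  have h1 := UnitAddCircle.measurePreserving_mk α
  have h2 : (volume : Measure UnitAddCircle) = AddCircle.haarAddCircle := by
    rw [AddCircle.volume_eq_smul_haarAddCircle]; simp
  rw [measureReal_def, ← h2, ← h1.measure_preimage hm.nullMeasurableSet, Measure.restrict_apply
    (h1.measurable hm)]
  have h3 : ((fun x : ℝ => (x : UnitAddCircle)) ⁻¹' circleArc α β ∩ Set.Ioc α (α + 1) : Set ℝ)
      =ᵐ[volume] (Set.Ico α β : Set ℝ) := by
    have h4 : ∀ᵐ x : ℝ, x ≠ α ∧ x ≠ α + 1 := by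
      rw [eventually_and]
      exact ⟨Measure.ae_ne _ _, Measure.ae_ne _ _⟩
    filter_upwards [h4] with x hx
    refine propext ?_
    change ((x : UnitAddCircle) ∈ circleArc α β ∧ x ∈ Set.Ioc α (α + 1)) ↔ x ∈ Set.Ico α β
    constructor
    · rintro ⟨hx1, hx2⟩
      exact ⟨hx2.1.le, (coe_mem_circleArc hβ ⟨hx2.1.le, lt_of_le_of_ne hx2.2 hx.2⟩).mp hx1⟩
    · intro hx'
      exact ⟨⟨x, hx', rfl⟩, lt_of_le_of_ne hx'.1 hx.1.symm, hx'.2.le.trans hβ⟩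
  refine (congrArg ENNReal.toReal (measure_congr h3)).trans ?_
  rw [Real.volume_Ico, ENNReal.toReal_ofReal (by linarith)]

/-- If the counting function takes only the values `n - 1` and `n`, then the measure of its upper
level set is determined. -/
theorem volume_gridLevel {A B : Set UnitAddCircle} (h : IsTame A B) (N : ℕ) [NeZero N] {n : ℕ}
    (hn : ∀ u, gridCount N A u = n ∨ gridCount N A u + 1 = n) :
    N * AddCircle.haarAddCircle.real A =
      n - 1 + AddCircle.haarAddCircle.real (gridLevel N n A) := by
  have h1 := integral_gridCount_fourier h N 0
  have h2 := (h.gridLevel (N := N) n).measurableSet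
  simp only [zero_mul, fourier_zero, mul_one] at h1
  rw [integral_indicator_const _ h.measurableSet] at h1
  have hmp : MeasurePreserving (fun u : UnitAddCircle => N • u) AddCircle.haarAddCircle
      AddCircle.haarAddCircle := by
    have := AddMonoidHom.measurePreserving (f := nsmulAddMonoidHom (α := UnitAddCircle) N)
      (μ := AddCircle.haarAddCircle) (ν := AddCircle.haarAddCircle) (by
        change Continuous fun u : UnitAddCircle => N • u
        fun_prop) (nsmul_surjective_unitAddCircle (NeZero.ne N)) (by simp)
    exact this
  have h3 : ∀ u, (gridCount N A u : ℂ) =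
      (n - 1 : ℂ) + (((fun u : UnitAddCircle => N • u) ⁻¹' gridLevel N n A).indicator
        (fun _ => (1 : ℂ)) u) := by
    intro u
    simp only [Set.indicator, Set.mem_preimage, mem_gridLevel]
    rcases hn u with h4 | h4
    · simp [h4]
    · have : ¬ n ≤ gridCount N A u := by omega
      rw [if_neg this, ← h4]
      push_cast
      ring
  simp only [h3] at h1
  rw [integral_add (integrable_const _) ((integrable_const _).indicator (hmp.measurable h2)),
    integral_indicator_const _ (hmp.measurable h2), measureReal_def,
    hmp.measure_preimage h2.nullMeasurableSet, ← measureReal_def] at h1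
  simp only [integral_const, probReal_univ, one_smul, Complex.real_smul, mul_one] at h1
  exact_mod_cast h1.symm

end Arcs

/-! ### Composition operators between `L²` spaces. -/

section Composition

open scoped NNReal

variable {X Y : Type*} [MeasurableSpace X] [MeasurableSpace Y] {μ : Measure X} {ν : Measure Y}

theorem ae_comp_of_map_eq {θ : X → Y} (hθ : Measurable θ) {c : ℝ≥0} {J : Set Y}
    (hJ : MeasurableSet J) (hmap : μ.map θ = c • ν.restrict J) {p : Y → Prop}
    (hp : ∀ᵐ y ∂ν, y ∈ J → p y) : ∀ᵐ x ∂μ, p (θ x) := by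
  refine ae_of_ae_map hθ.aemeasurable ?_
  rw [hmap]
  exact Measure.ae_smul_measure ((ae_restrict_iff' hJ).mpr hp) c

/-- Composition with a measurable map which transports a measure to a multiple of the restriction
of another one, and which has a left inverse, is a surjective bounded operator between the `L²`
spaces. Its kernel consists of the functions vanishing on the image. -/
theorem exists_compOp {θ : X → Y} (hθ : Measurable θ) {c : ℝ≥0} (hc : c ≠ 0) {J : Set Y}
    (hJ : MeasurableSet J) (hmap : μ.map θ = c • ν.restrict J) {ρ : Y → X} (hρ : Measurable ρ)
    (hinv : ∀ᵐ x ∂μ, ρ (θ x) = x) :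
    ∃ W : Lp ℂ 2 ν →L[ℂ] Lp ℂ 2 μ, (∀ f, W f =ᵐ[μ] fun x => f (θ x)) ∧
      Function.Surjective W ∧ ∀ f, W f = 0 ↔ ∀ᵐ y ∂ν, y ∈ J → f y = 0 := by
  have hle : μ.map θ ≤ (c : ℝ≥0∞) • ν := by
    rw [hmap]
    exact Measure.le_intro fun s _ _ => by
      simp only [Measure.smul_apply, Measure.nnreal_smul_coe_apply, smul_eq_mul]
      gcongr
      exact Measure.restrict_le_self
  have hmem : ∀ f : Lp ℂ 2 ν, MemLp (fun x => f (θ x)) 2 μ := fun f =>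
    ((Lp.memLp f).of_measure_le_smul ENNReal.coe_ne_top hle).comp_of_map hθ.aemeasurable
  have hae : ∀ {p : Y → Prop}, (∀ᵐ y ∂ν, p y) → ∀ᵐ x ∂μ, p (θ x) := fun hp =>
    ae_comp_of_map_eq hθ hJ hmap (hp.mono fun _ h _ => h)
  have hnorm : ∀ f : Lp ℂ 2 ν, ‖(hmem f).toLp‖ ≤ (c : ℝ) ^ ((1 : ℝ) / 2) * ‖f‖ := by
    intro f
    have h1 : eLpNorm (fun x => f (θ x)) 2 μ ≤ (c : ℝ≥0∞) ^ ((1 : ℝ) / 2) * eLpNorm f 2 ν := by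
      have h2 := eLpNorm_map_measure (p := 2) (f := θ) (μ := μ) (g := f)
        ((Lp.stronglyMeasurable f).aestronglyMeasurable) hθ.aemeasurable
      change eLpNorm (f ∘ θ) 2 μ ≤ _
      rw [← h2]
      refine (eLpNorm_mono_measure f hle).trans ?_
      rw [eLpNorm_smul_measure_of_ne_top (by norm_num)]
      simp
    rw [Lp.norm_toLp, Lp.norm_def]
    refine (ENNReal.toReal_mono ?_ h1).trans_eq ?_
    · exact ENNReal.mul_ne_top (by simp) (Lp.memLp f).2.ne
    · rw [ENNReal.toReal_mul, ← ENNReal.toReal_rpow, ENNReal.coe_toReal]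
  let W₀ : Lp ℂ 2 ν →ₗ[ℂ] Lp ℂ 2 μ :=
    { toFun := fun f => (hmem f).toLp
      map_add' := fun f g => by
        refine Lp.ext ?_
        filter_upwards [(hmem (f + g)).coeFn_toLp, Lp.coeFn_add (hmem f).toLp (hmem g).toLp,
          (hmem f).coeFn_toLp, (hmem g).coeFn_toLp, hae (Lp.coeFn_add f g)] with x h1 h2 h3 h4 h5
        rw [h1, h2, Pi.add_apply, h3, h4, h5, Pi.add_apply]
      map_smul' := fun a f => by
        refine Lp.ext ?_
        filter_upwards [(hmem (a • f)).coeFn_toLp, Lp.coeFn_smul a (hmem f).toLp,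
          (hmem f).coeFn_toLp, hae (Lp.coeFn_smul a f)] with x h1 h2 h3 h5
        rw [h1, RingHom.id_apply, h2, Pi.smul_apply, h3, h5, Pi.smul_apply] }
  refine ⟨W₀.mkContinuous _ hnorm, fun f => (hmem f).coeFn_toLp, fun g => ?_, fun f => ?_⟩
  · have hgρ : StronglyMeasurable fun y => g (ρ y) :=
      (Lp.stronglyMeasurable g).comp_measurable hρ
    have h1 : MemLp (fun y => g (ρ y)) 2 (μ.map θ) := by
      rw [memLp_map_measure_iff hgρ.aestronglyMeasurable hθ.aemeasurable]
      refine (Lp.memLp g).ae_eq ?_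
      filter_upwards [hinv] with x hx
      rw [Function.comp_apply, hx]
    have h2 : MemLp (fun y => g (ρ y)) 2 (ν.restrict J) := by
      refine h1.of_measure_le_smul (c := (c⁻¹ : ℝ≥0)) ENNReal.coe_ne_top ?_
      rw [hmap]
      refine le_of_eq (Measure.ext fun s _ => ?_)
      simp only [Measure.smul_apply, Measure.nnreal_smul_coe_apply, smul_eq_mul]
      rw [← mul_assoc, ← ENNReal.coe_mul, inv_mul_cancel₀ hc, ENNReal.coe_one, one_mul]
    -- The preimage of `g` is `g ∘ ρ` cut off outside `J`: only on `J` is `ν` controlled by the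
    -- image of `μ`.
    have h3 : MemLp (J.indicator fun y => g (ρ y)) 2 ν := (memLp_indicator_iff_restrict hJ).mpr h2
    refine ⟨h3.toLp, Lp.ext ?_⟩
    have h4 : ∀ᵐ x ∂μ, θ x ∈ J := ae_comp_of_map_eq hθ hJ hmap (ae_of_all _ fun _ h => h)
    filter_upwards [(hmem h3.toLp).coeFn_toLp, hae h3.coeFn_toLp, h4, hinv] with x h5 h6 h7 h8
    refine h5.trans ?_
    rw [h6, Set.indicator_of_mem h7, h8]
  · change (hmem f).toLp = 0 ↔ _
    constructor
    · intro h
      have h1 : ∀ᵐ x ∂μ, f (θ x) = 0 := by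
        have h2 := (hmem f).coeFn_toLp
        rw [h] at h2
        filter_upwards [h2, Lp.coeFn_zero ℂ 2 μ] with x h3 h4
        rw [← h3, h4, Pi.zero_apply]
      have h2 : ∀ᵐ y ∂(μ.map θ), f y = 0 := by
        rw [ae_map_iff hθ.aemeasurable]
        · exact h1
        · exact measurableSet_eq_fun (Lp.stronglyMeasurable f).measurable measurable_const
      rw [hmap] at h2
      rw [← ae_restrict_iff' hJ]
      have h3 : ae (c • ν.restrict J) = ae (ν.restrict J) := by
        change ae ((c : ℝ≥0∞) • ν.restrict J) = _
        exact Measure.ae_ennreal_smul_measure_eq (by exact_mod_cast hc) _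
      rwa [h3] at h2
    · intro h
      refine Lp.ext ?_
      filter_upwards [(hmem f).coeFn_toLp, Lp.coeFn_zero ℂ 2 μ,
        ae_comp_of_map_eq hθ hJ hmap h] with x h1 h2 h3
      rw [h1, h2, h3, Pi.zero_apply]

theorem pi_nnreal_smul {ι : Type*} [Fintype ι] {Z : ι → Type*} [∀ j, MeasurableSpace (Z j)]
    (m : ∀ j, Measure (Z j)) [∀ j, SigmaFinite (m j)] (c : ι → ℝ≥0) :
    Measure.pi (fun j => c j • m j) = (∏ j, c j) • Measure.pi m := by
  refine (Measure.pi_eq fun s _ => ?_)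
  simp only [Measure.smul_apply, ENNReal.smul_def, smul_eq_mul, Measure.pi_pi,
    Finset.prod_mul_distrib]
  push_cast
  rfl

/-- A product of maps, each of which transports a measure to a multiple of the restriction of
another one, has the same property. -/
theorem map_pi_eq_smul_restrict {ι : Type*} [Fintype ι] {Z Z' : ι → Type*}
    [∀ j, MeasurableSpace (Z j)] [∀ j, MeasurableSpace (Z' j)] (m : ∀ j, Measure (Z j))
    [∀ j, SigmaFinite (m j)] (m' : ∀ j, Measure (Z' j)) [∀ j, SigmaFinite (m' j)]
    (θ : ∀ j, Z j → Z' j) (hθ : ∀ j, Measurable (θ j)) (c : ι → ℝ≥0) (J : ∀ j, Set (Z' j))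
    (hmap : ∀ j, (m j).map (θ j) = c j • (m' j).restrict (J j)) :
    (Measure.pi m).map (fun x j => θ j (x j)) =
      (∏ j, c j) • (Measure.pi m').restrict (Set.univ.pi J) := by
  rw [Measure.restrict_pi_pi, ← pi_nnreal_smul]
  exact (measurePreserving_pi _ _ fun j => ⟨hθ j, hmap j⟩).map_eq

end Composition

/-! ### Transport of measure between intervals, arcs and the circle. -/

section Circle

open scoped NNReal

theorem map_affine_restrict_Ico {a : ℝ} (ha : 0 < a) (α s t : ℝ) :
    (volume.restrict (Set.Ico s t)).map (fun x : ℝ => α + a * x) =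
      a.toNNReal⁻¹ • volume.restrict (Set.Ico (α + a * s) (α + a * t)) := by
  have hpre : Set.Ico s t = (fun x : ℝ => α + a * x) ⁻¹' Set.Ico (α + a * s) (α + a * t) := by
    ext x
    simp only [Set.mem_Ico, Set.mem_preimage, add_le_add_iff_left, add_lt_add_iff_left]
    rw [mul_le_mul_iff_right₀ ha, mul_lt_mul_iff_right₀ ha]
  have hm : Measurable fun x : ℝ => α + a * x := by fun_prop
  rw [hpre, ← Measure.restrict_map hm measurableSet_Ico]
  have h1 : Measure.map (fun x : ℝ => α + a * x) volume = a.toNNReal⁻¹ • volume := by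
    have h2 : (fun x : ℝ => α + a * x) = (fun x => α + x) ∘ (fun x => a * x) := rfl
    rw [h2, ← Measure.map_map (by fun_prop) (by fun_prop), Real.map_volume_mul_left ha.ne',
      Measure.map_smul, map_add_left_eq_self, abs_of_pos (inv_pos.mpr ha)]
    rw [ENNReal.ofReal, Real.toNNReal_inv]
    rfl
  rw [h1, Measure.restrict_smul]

theorem map_coe_restrict_Ico {α β : ℝ} (hβ : β ≤ α + 1) :
    (volume.restrict (Set.Ico α β)).map (fun x : ℝ => (x : UnitAddCircle)) =
      AddCircle.haarAddCircle.restrict (circleArc α β) := by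
  rcases lt_or_ge β α with hlt | hαβ
  · simp [circleArc, Set.Ico_eq_empty_of_le hlt.le]
  have hm := (isTame_circleArc hαβ hβ).measurableSet
  have h1 := UnitAddCircle.measurePreserving_mk α
  have h2 : (volume : Measure UnitAddCircle) = AddCircle.haarAddCircle := by
    rw [AddCircle.volume_eq_smul_haarAddCircle]; simp
  rw [← h2, ← h1.map_eq, Measure.restrict_map h1.measurable hm,
    Measure.restrict_restrict (h1.measurable hm)]
  congr 1
  refine Measure.restrict_congr_set ?_
  have h4 : ∀ᵐ x : ℝ, x ≠ α ∧ x ≠ α + 1 := by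
    rw [Filter.eventually_and]
    exact ⟨Measure.ae_ne _ _, Measure.ae_ne _ _⟩
  filter_upwards [h4] with x hx
  refine propext ?_
  change x ∈ Set.Ico α β ↔ ((x : UnitAddCircle) ∈ circleArc α β ∧ x ∈ Set.Ioc α (α + 1))
  constructor
  · intro hx'
    exact ⟨⟨x, hx', rfl⟩, lt_of_le_of_ne hx'.1 hx.1.symm, hx'.2.le.trans hβ⟩
  · rintro ⟨hx1, hx2⟩
    exact ⟨hx2.1.le, (coe_mem_circleArc hβ ⟨hx2.1.le, lt_of_le_of_ne hx2.2 hx.2⟩).mp hx1⟩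

theorem circleArc_add_one (α : ℝ) : circleArc α (α + 1) = Set.univ := by
  refine Set.eq_univ_of_forall fun u => ?_
  obtain ⟨x, hx, rfl⟩ := exists_coe_eq_Ico α u
  exact ⟨x, hx, rfl⟩

/-- The representative in `[α, α + 1)` of a point of the circle. -/
noncomputable def circleRepIco (α : ℝ) (u : UnitAddCircle) : ℝ := (AddCircle.equivIco 1 α u : ℝ)

theorem circleRepIco_mem (α : ℝ) (u : UnitAddCircle) : circleRepIco α u ∈ Set.Ico α (α + 1) :=
  (AddCircle.equivIco 1 α u).2

theorem coe_circleRepIco (α : ℝ) (u : UnitAddCircle) :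
    ((circleRepIco α u : ℝ) : UnitAddCircle) = u :=
  (AddCircle.equivIco 1 α).symm_apply_apply u

theorem circleRepIco_coe {α x : ℝ} (hx : x ∈ Set.Ico α (α + 1)) : circleRepIco α x = x :=
  congrArg Subtype.val ((AddCircle.equivIco (1 : ℝ) α).apply_symm_apply ⟨x, hx⟩)

theorem measurable_circleRepIco (α : ℝ) : Measurable (circleRepIco α) :=
  measurable_subtype_coe.comp (AddCircle.measurableEquivIco 1 α).measurable

theorem map_circleRepIco (α : ℝ) :
    (AddCircle.haarAddCircle).map (circleRepIco α) = volume.restrict (Set.Ico α (α + 1)) := by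
  have h1 := map_coe_restrict_Ico (α := α) le_rfl
  rw [circleArc_add_one, Measure.restrict_univ] at h1
  rw [← h1, Measure.map_map (measurable_circleRepIco α) AddCircle.measurable_mk']
  refine Eq.trans (Measure.map_congr (g := id) ?_) Measure.map_id
  filter_upwards [ae_restrict_mem measurableSet_Ico] with x hx
  exact circleRepIco_coe hx

/-- The map of the circle onto the arc `[α, α + a)` stretching distances by `a`. -/
noncomputable def arcStretch (α a : ℝ) (u : UnitAddCircle) : UnitAddCircle :=
  ((α + a * circleRepIco 0 u : ℝ) : UnitAddCircle)

theorem measurable_arcStretch (α a : ℝ) : Measurable (arcStretch α a) :=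
  AddCircle.measurable_mk'.comp (((measurable_circleRepIco 0).const_mul a).const_add α)

theorem map_arcStretch {a : ℝ} (ha : 0 < a) (ha1 : a ≤ 1) (α : ℝ) :
    (AddCircle.haarAddCircle).map (arcStretch α a) =
      a.toNNReal⁻¹ • AddCircle.haarAddCircle.restrict (circleArc α (α + a)) := by
  have h1 : arcStretch α a = (fun x : ℝ => (x : UnitAddCircle)) ∘ (fun x : ℝ => α + a * x) ∘
    circleRepIco 0 := rfl
  have hm : Measurable fun x : ℝ => α + a * x := by fun_prop
  have hmk : Measurable fun x : ℝ => (x : UnitAddCircle) := AddCircle.measurable_mk'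
  rw [h1, ← Measure.map_map hmk (hm.comp (measurable_circleRepIco 0)),
    ← Measure.map_map hm (measurable_circleRepIco 0), map_circleRepIco, zero_add,
    map_affine_restrict_Ico ha, mul_zero, mul_one, add_zero, ← map_coe_restrict_Ico (by linarith)]
  rw [Measure.map_smul]

theorem circleRepIco_arcStretch {a : ℝ} (ha : 0 < a) (ha1 : a ≤ 1) (α : ℝ) (u : UnitAddCircle) :
    ((a⁻¹ * (circleRepIco α (arcStretch α a u) - α) : ℝ) : UnitAddCircle) = u := by
  have hr := circleRepIco_mem 0 u
  rw [arcStretch, circleRepIco_coe, add_sub_cancel_left, inv_mul_cancel_left₀ ha.ne',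
    coe_circleRepIco]
  refine ⟨by nlinarith [hr.1], ?_⟩
  have := hr.2
  nlinarith [hr.1]

end Circle

/-! ### Diagonal operators and reindexing isometries for a Hilbert basis. -/

section Diagonal

variable {ι H : Type*} [NormedAddCommGroup H] [InnerProductSpace ℂ H]

theorem memℓp_bounded_mul {m : ι → ℂ} {C : ℝ} (hm : ∀ i, ‖m i‖ ≤ C) (f : lp (fun _ : ι => ℂ) 2) :
    Memℓp (fun i => m i * f i) 2 := by
  have h1 := lp.memℓp ((C : ℂ) • f)
  have hpos : 0 < (2 : ℝ≥0∞).toReal := by norm_num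
  refine memℓp_gen (Summable.of_nonneg_of_le (fun i => by positivity) (fun i => ?_)
    (h1.summable hpos))
  refine Real.rpow_le_rpow (norm_nonneg _) ?_ hpos.le
  rw [lp.coeFn_smul, Pi.smul_apply, norm_mul, norm_smul, Complex.norm_real]
  exact mul_le_mul_of_nonneg_right ((hm i).trans (le_abs_self C)) (norm_nonneg _)

/-- The operator which is diagonal with respect to a Hilbert basis, with given eigenvalues. -/
theorem exists_diagOp (b : HilbertBasis ι ℂ H) {m : ι → ℂ} {C : ℝ} (hC : 0 ≤ C)
    (hm : ∀ i, ‖m i‖ ≤ C) : ∃ D : H →L[ℂ] H, ‖D‖ ≤ C ∧ ∀ i, D (b i) = m i • b i := by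
  classical
  let D₀ : lp (fun _ : ι => ℂ) 2 →ₗ[ℂ] lp (fun _ : ι => ℂ) 2 :=
    { toFun := fun f => ⟨fun i => m i * f i, memℓp_bounded_mul hm f⟩
      map_add' := fun f g => by ext i; exact mul_add _ _ _
      map_smul' := fun c f => by ext i; exact mul_left_comm _ _ _ }
  have hD₀ : ∀ f, ‖D₀ f‖ ≤ C * ‖f‖ := by
    intro f
    have h1 : ‖D₀ f‖ ≤ ‖(C : ℂ) • f‖ := by
      refine lp.norm_mono (by norm_num) fun i => ?_
      change ‖m i * f i‖ ≤ ‖(C : ℂ) • f i‖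
      rw [norm_mul, norm_smul, Complex.norm_real]
      exact mul_le_mul_of_nonneg_right ((hm i).trans (le_abs_self C)) (norm_nonneg _)
    rwa [norm_smul, Complex.norm_real, Real.norm_of_nonneg hC] at h1
  let D : H →ₗ[ℂ] H := b.repr.symm.toLinearEquiv.toLinearMap ∘ₗ D₀ ∘ₗ
    b.repr.toLinearEquiv.toLinearMap
  have hD : ∀ f, ‖D f‖ ≤ C * ‖f‖ := by
    intro f
    change ‖b.repr.symm (D₀ (b.repr f))‖ ≤ _
    rw [LinearIsometryEquiv.norm_map]
    exact (hD₀ _).trans_eq (by rw [LinearIsometryEquiv.norm_map])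
  refine ⟨D.mkContinuous C hD, LinearMap.mkContinuous_norm_le _ hC _, fun i => ?_⟩
  change b.repr.symm (D₀ (b.repr (b i))) = _
  rw [LinearIsometryEquiv.symm_apply_eq, map_smul, b.repr_self]
  ext j
  change m j * (lp.single 2 i (1 : ℂ) : lp (fun _ : ι => ℂ) 2) j =
    m i * (lp.single 2 i (1 : ℂ) : lp (fun _ : ι => ℂ) 2) j
  by_cases hij : j = i
  · rw [hij]
  · rw [lp.single_apply_ne 2 i _ hij, mul_zero, mul_zero]

/-- An isometry carrying one Hilbert basis into another, up to unimodular factors. Its range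
consists of the vectors whose other coefficients vanish. -/
theorem exists_reindexIsometry [CompleteSpace H] (b : HilbertBasis ι ℂ H) {σ : ι → ι} (hσ : Function.Injective σ)
    {c : ι → ℂ} (hc : ∀ i, ‖c i‖ = 1) : ∃ V : H →ₗᵢ[ℂ] H, (∀ i, V (b i) = c i • b (σ i)) ∧
      ∀ f, (∃ g, V g = f) ↔ ∀ i ∉ Set.range σ, ⟪b i, f⟫_ℂ = 0 := by
  classical
  have hon : Orthonormal ℂ fun i => c i • b (σ i) := by
    refine ⟨fun i => ?_, fun i j hij => ?_⟩
    · change ‖c i • b (σ i)‖ = 1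
      rw [norm_smul, hc, b.orthonormal.1, mul_one]
    · change ⟪c i • b (σ i), c j • b (σ j)⟫_ℂ = 0
      rw [inner_smul_left, inner_smul_right, b.orthonormal.2 (hσ.ne hij), mul_zero, mul_zero]
  let V : H →ₗᵢ[ℂ] H := hon.orthogonalFamily.linearIsometry.comp b.repr.toLinearIsometry
  have hV : ∀ i, V (b i) = c i • b (σ i) := by
    intro i
    change hon.orthogonalFamily.linearIsometry (b.repr (b i)) = _
    rw [b.repr_self, OrthogonalFamily.linearIsometry_apply_single]
    simp
  refine ⟨V, hV, fun f => ⟨?_, fun hf => ?_⟩⟩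
  · rintro ⟨g, rfl⟩ i hi
    have h1 : ((innerSL ℂ (b i)).comp V.toContinuousLinearMap) = 0 := by
      refine ContinuousLinearMap.ext_on (s := Set.range b)
        (Submodule.dense_iff_topologicalClosure_eq_top.mpr b.dense_span) ?_
      rintro _ ⟨n, rfl⟩
      change ⟪b i, V (b n)⟫_ℂ = 0
      rw [hV, inner_smul_right, b.orthonormal.2 (fun h => hi ⟨n, h.symm⟩), mul_zero]
    exact congrArg (fun A : H →L[ℂ] ℂ => A g) h1
  · have hcl : IsClosed (Set.range V) := V.isometry.isClosedEmbedding.isClosed_range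
    have hmem : ∀ s : Finset ι, ∑ i ∈ s, b.repr f i • b i ∈ Set.range V := by
      intro s
      change _ ∈ (V.toLinearMap.range : Set H)
      refine Submodule.sum_mem _ fun i _ => ?_
      by_cases hi : i ∈ Set.range σ
      · obtain ⟨n, rfl⟩ := hi
        refine Submodule.smul_mem _ _ ⟨(c n)⁻¹ • b n, ?_⟩
        change V ((c n)⁻¹ • b n) = _
        rw [map_smul, hV, smul_smul, inv_mul_cancel₀, one_smul]
        exact norm_ne_zero_iff.mp (by rw [hc]; exact one_ne_zero)
      · rw [b.repr_apply_apply, hf i hi, zero_smul]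
        exact Submodule.zero_mem _
    exact hcl.mem_of_tendsto (b.hasSum_repr f) (Filter.Eventually.of_forall hmem)

end Diagonal

/-! ### Stretching one coordinate of the torus onto an arc. -/

section ArcSpectrum

open Filter Topology

variable {d : ℕ}

theorem mFourier_update (n : Fin d → ℤ) (i : Fin d) (k : ℤ) (x : UnitAddTorus (Fin d))
    (u : UnitAddCircle) :
    UnitAddTorus.mFourier (Function.update n i k) (Function.update x i u) * fourier (n i) (x i) =
      UnitAddTorus.mFourier n x * fourier k u := by
  simp only [UnitAddTorus.mFourier, ContinuousMap.coe_mk]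
  rw [← Finset.mul_prod_erase _ _ (Finset.mem_univ i),
    ← Finset.mul_prod_erase (Finset.univ) (fun j => (fourier (n j) (x j) : ℂ)) (Finset.mem_univ i)]
  simp only [Function.update_self]
  rw [Finset.prod_congr rfl (g := fun j => (fourier (n j) (x j) : ℂ)) fun j hj => ?_]
  · ring
  · rw [Function.update_of_ne (Finset.ne_of_mem_erase hj),
      Function.update_of_ne (Finset.ne_of_mem_erase hj)]

/-- Composition with the stretching of one coordinate of the torus onto an arc. -/
theorem exists_arcStretchOp (i : Fin d) {a : ℝ} (ha : 0 < a) (ha1 : a ≤ 1) (α : ℝ) :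
    ∃ W : TorusL2 d →L[ℂ] TorusL2 d,
      (∀ f, W f =ᵐ[torusMeasure d]
        fun x => f (Function.update x i (arcStretch α a (x i)))) ∧
      Function.Surjective W ∧
      (∀ f, W f = 0 ↔ ∀ᵐ x ∂torusMeasure d, x ∈ {x : UnitAddTorus (Fin d) | x i ∈
        circleArc α (α + a)} → f x = 0) ∧
      ∀ f g : UnitAddTorus (Fin d) → ℂ, f =ᵐ[torusMeasure d] g →
        ∀ᵐ x ∂torusMeasure d, f (Function.update x i (arcStretch α a (x i))) =
          g (Function.update x i (arcStretch α a (x i))) := by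
  classical
  set arc := circleArc α (α + a) with harc
  have hm : MeasurableSet arc := (isTame_circleArc (by linarith) (by linarith)).measurableSet
  let θ : Fin d → UnitAddCircle → UnitAddCircle :=
    Function.update (fun _ => id) i (arcStretch α a)
  let r : UnitAddCircle → UnitAddCircle :=
    fun u => ((a⁻¹ * (circleRepIco α u - α) : ℝ) : UnitAddCircle)
  have hr : Measurable r := AddCircle.measurable_mk'.comp
    (((measurable_circleRepIco α).sub_const α).const_mul a⁻¹)
  let c : Fin d → NNReal := Function.update (fun _ => 1) i a.toNNReal⁻¹
  let J : Fin d → Set UnitAddCircle := Function.update (fun _ => Set.univ) i arc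
  have hθ : ∀ j, Measurable (θ j) := by
    intro j
    by_cases hj : j = i
    · subst hj; simpa [θ] using measurable_arcStretch α a
    · simpa [θ, hj] using measurable_id
  have hmap : ∀ j, (AddCircle.haarAddCircle).map (θ j) =
      c j • AddCircle.haarAddCircle.restrict (J j) := by
    intro j
    by_cases hj : j = i
    · subst hj; simpa [θ, c, J] using map_arcStretch ha ha1 α
    · simp [θ, c, J, hj]
  have hpi := map_pi_eq_smul_restrict (fun _ : Fin d => AddCircle.haarAddCircle)
    (fun _ : Fin d => AddCircle.haarAddCircle) θ hθ c J hmap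
  have hJ : Set.univ.pi J = {x : UnitAddTorus (Fin d) | x i ∈ arc} := by
    ext x
    simp only [Set.mem_univ_pi, Set.mem_ofPred_eq, J]
    constructor
    · intro h; simpa using h i
    · intro h j
      by_cases hj : j = i
      · subst hj; simpa using h
      · simp [hj]
  have hθu : (fun (x : UnitAddTorus (Fin d)) j => θ j (x j)) =
      fun x => Function.update x i (arcStretch α a (x i)) := by
    ext x j
    by_cases hj : j = i
    · subst hj; simp [θ]
    · simp [θ, hj]
  rw [hJ, hθu] at hpi
  have hc : ∏ j, c j ≠ 0 := Finset.prod_ne_zero_iff.mpr fun j _ => by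
    by_cases hj : j = i
    · subst hj; simpa [c] using ha
    · simp [c, hj]
  have hθm : Measurable fun x : UnitAddTorus (Fin d) =>
      Function.update x i (arcStretch α a (x i)) := by
    rw [← hθu]
    exact measurable_pi_lambda _ fun j => (hθ j).comp (measurable_pi_apply j)
  have hρm : Measurable fun x : UnitAddTorus (Fin d) => Function.update x i (r (x i)) := by
    refine measurable_pi_lambda _ fun j => ?_
    by_cases hj : j = i
    · subst hj; simpa [Function.comp_def] using hr.comp (measurable_pi_apply j)
    · simpa [hj] using measurable_pi_apply j
  have hinv : ∀ x : UnitAddTorus (Fin d), (fun x : UnitAddTorus (Fin d) =>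
      Function.update x i (r (x i))) (Function.update x i (arcStretch α a (x i))) = x := by
    intro x
    change Function.update _ i (r (Function.update x i (arcStretch α a (x i)) i)) = x
    rw [Function.update_idem, Function.update_self]
    simp only [r]
    rw [circleRepIco_arcStretch ha ha1, Function.update_eq_self]
  obtain ⟨W, hW1, hW2, hW3⟩ := exists_compOp hθm hc (hm.preimage (measurable_pi_apply i)) hpi hρm
    (ae_of_all _ hinv)
  exact ⟨W, hW1, hW2, hW3, fun f g hfg => ae_comp_of_map_eq hθm
    (hm.preimage (measurable_pi_apply i)) hpi (hfg.mono fun _ h _ => h)⟩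

end ArcSpectrum

/-! ### Riesz spectra of short arcs by perturbation. -/

section ArcSpectrum

open Filter Topology

variable {d : ℕ}

theorem strictMono_floor_div {a : ℝ} (ha : 0 < a) (ha1 : a ≤ 1) :
    StrictMono fun k : ℤ => ⌊k / a⌋ := by
  intro k l hkl
  have h1 : (k : ℝ) / a + 1 ≤ l / a := by
    rw [div_add_one ha.ne', div_le_div_iff_of_pos_right ha]
    have : (k : ℝ) + 1 ≤ l := by exact_mod_cast hkl
    linarith
  have h2 : ⌊(k : ℝ) / a⌋ + 1 ≤ ⌊(l : ℝ) / a⌋ := by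
    rw [← Int.floor_add_one]; exact Int.floor_le_floor h1
  change ⌊(k : ℝ) / a⌋ < ⌊(l : ℝ) / a⌋
  omega

theorem abs_mul_floor_div_sub_le {a : ℝ} (ha : 0 < a) (k : ℤ) :
    |a * ⌊k / a⌋ - k| ≤ a := by
  have h1 := Int.floor_le ((k : ℝ) / a)
  have h2 := Int.lt_floor_add_one ((k : ℝ) / a)
  rw [le_div_iff₀ ha] at h1
  rw [div_lt_iff₀ ha] at h2
  rw [abs_le]
  constructor <;> nlinarith

/-- The phase removes the position `α` of the arc and leaves the frequency `a l`, which is nearly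
the integer `k` when `l = ⌊k / a⌋`. -/
theorem fourier_arcStretch (α a : ℝ) (l : ℤ) (u : UnitAddCircle) :
    (fourier (-l) (α : UnitAddCircle) : ℂ) * fourier l (arcStretch α a u) =
      Complex.exp (2 * Real.pi * Complex.I * circleRepIco 0 u * (a * l : ℝ)) := by
  rw [arcStretch, fourier_coe_apply, fourier_coe_apply, ← Complex.exp_add]
  congr 1
  push_cast
  ring

theorem fourier_circleRepIco (k : ℤ) (u : UnitAddCircle) :
    (fourier k u : ℂ) = Complex.exp (2 * Real.pi * Complex.I * circleRepIco 0 u * k) := by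
  conv_lhs => rw [← coe_circleRepIco 0 u, fourier_coe_apply]
  congr 1
  push_cast
  ring

/-- If an operator multiplies each element of the Fourier basis by `exp (δ φ)`, with a bounded
function `φ` and small numbers `δ` depending on the element, then it is invertible. -/
theorem isUnit_of_apply_expBasis {A : TorusL2 d →L[ℂ] TorusL2 d} {φ : UnitAddTorus (Fin d) → ℂ}
    (hφ : Measurable φ) {B a : ℝ} (hB : ∀ x, ‖φ x‖ ≤ B) (δ : (Fin d → ℤ) → ℂ)
    (hδ : ∀ n, ‖δ n‖ ≤ a) (hB0 : 0 ≤ B) (ha0 : 0 ≤ a) (hr : B * a < Real.log 2)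
    (hA : ∀ n, A (expBasis d n) =ᵐ[torusMeasure d]
      fun x => Complex.exp (φ x * δ n) * expBasis d n x) : IsUnit A := by
  set r := B * a with hrdef
  have hr0 : 0 ≤ r := mul_nonneg hB0 ha0
  have hr1 : r < 1 := hr.trans (by linarith [Real.log_two_lt_d9])
  have hBq : ∀ q x, ‖φ x ^ q‖ ≤ B ^ q := fun q x => by
    rw [norm_pow]; exact pow_le_pow_left₀ (norm_nonneg _) (hB x) q
  choose D hD hDe using fun q : ℕ => exists_diagOp (expBasis d) (m := fun n => δ n ^ q)
    (C := a ^ q) (by positivity) fun n => by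
      rw [norm_pow]; exact pow_le_pow_left₀ (norm_nonneg _) (hδ n) q
  -- The power series of `exp (φ δ)` separates position from frequency: its `q`-th term is a
  -- diagonal operator followed by a multiplication, both with explicit norm bounds.
  let T : ℕ → TorusL2 d →L[ℂ] TorusL2 d := fun q =>
    ((q.factorial : ℂ)⁻¹) • (mulOp (torusMeasure d) (fun x => φ x ^ q) (hφ.pow_const q) (B ^ q)
      (hBq q) ∘L D q)
  have hT : ∀ q, ‖T q‖ ≤ r ^ q / q.factorial := by
    intro q
    rw [norm_smul, norm_inv, Complex.norm_natCast, hrdef, mul_pow, div_eq_inv_mul]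
    gcongr
    refine (ContinuousLinearMap.opNorm_comp_le _ _).trans ?_
    exact mul_le_mul (norm_mulOp_le (by positivity)) (hD q) (norm_nonneg _) (by positivity)
  have hT0 : T 0 = 1 := by
    refine clm_ext_expBasis fun n => Lp.ext ?_
    simp only [T, Nat.factorial_zero, Nat.cast_one, inv_one, one_smul,
      ContinuousLinearMap.comp_apply, hDe, pow_zero]
    filter_upwards [mulOp_ae (hφ := hφ.pow_const 0) (hC := hBq 0) (expBasis d n)] with x hx
    simp only [pow_zero, one_mul] at hx
    exact hx
  have hsum : Summable T := Summable.of_norm_bounded (Real.summable_pow_div_factorial r) hT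
  have hTe : ∀ q n, T q (expBasis d n) =ᵐ[torusMeasure d]
      fun x => (φ x * δ n) ^ q / q.factorial * expBasis d n x := by
    intro q n
    have h1 : T q (expBasis d n) = ((q.factorial : ℂ)⁻¹ * δ n ^ q) •
        mulOp (torusMeasure d) (fun x => φ x ^ q) (hφ.pow_const q) (B ^ q) (hBq q)
          (expBasis d n) := by
      simp only [T, smul_apply, ContinuousLinearMap.comp_apply, hDe, map_smul,
        smul_smul]
    rw [h1]
    filter_upwards [Lp.coeFn_smul ((q.factorial : ℂ)⁻¹ * δ n ^ q) (mulOp (torusMeasure d)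
      (fun x => φ x ^ q) (hφ.pow_const q) (B ^ q) (hBq q) (expBasis d n)),
      mulOp_ae (hφ := hφ.pow_const q) (hC := hBq q) (expBasis d n)] with x h2 h3
    rw [h2, Pi.smul_apply, h3, smul_eq_mul, mul_pow]
    ring
  have hpartial : ∀ Q n, ‖A (expBasis d n) - (∑ q ∈ Finset.range Q, T q) (expBasis d n)‖ ≤
      r ^ Q * Real.exp r * ‖expBasis d n‖ := by
    intro Q n
    refine Lp.norm_le_mul_norm_of_ae_le_mul ?_
    rw [sum_apply]
    filter_upwards [Lp.coeFn_sub (A (expBasis d n)) (∑ q ∈ Finset.range Q, T q (expBasis d n)),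
      Lp.coeFn_fun_finsetSum (Finset.range Q) (fun q => T q (expBasis d n)), hA n,
      ae_all_iff.mpr fun q => hTe q n] with x h1 h2 h3 h4
    rw [h1, Pi.sub_apply, h2, h3, Finset.sum_congr rfl fun q _ => h4 q, ← Finset.sum_mul, ← sub_mul,
      norm_mul]
    refine mul_le_mul_of_nonneg_right ?_ (norm_nonneg _)
    refine (Complex.norm_exp_sub_sum_le_norm_mul_exp _ Q).trans ?_
    have h5 : ‖φ x * δ n‖ ≤ r := by
      rw [norm_mul]; exact mul_le_mul (hB x) (hδ n) (norm_nonneg _) hB0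
    gcongr
  have hA' : A = ∑' q, T q := by
    refine clm_ext_expBasis fun n => ?_
    have h1 : Tendsto (fun Q => (∑ q ∈ Finset.range Q, T q) (expBasis d n)) atTop
        (𝓝 ((∑' q, T q) (expBasis d n))) :=
      ((ContinuousLinearMap.apply ℂ (TorusL2 d) (expBasis d n)).continuous.tendsto _).comp
        hsum.hasSum.tendsto_sum_nat
    have h2 : Tendsto (fun Q => (∑ q ∈ Finset.range Q, T q) (expBasis d n)) atTop
        (𝓝 (A (expBasis d n))) := by
      rw [tendsto_iff_norm_sub_tendsto_zero]
      have h3 : Tendsto (fun Q : ℕ => r ^ Q * Real.exp r * ‖expBasis d n‖) atTop (𝓝 0) := by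
        have := ((tendsto_pow_atTop_nhds_zero_of_lt_one hr0 hr1).mul_const (Real.exp r)).mul_const
          ‖expBasis d n‖
        simpa using this
      refine squeeze_zero (fun _ => norm_nonneg _) (fun Q => ?_) h3
      rw [norm_sub_rev]
      exact hpartial Q n
    exact tendsto_nhds_unique h2 h1
  -- The zeroth term is the identity and the others have total norm at most `exp r - 1`, less than
  -- `1` since `r < log 2`.
  have hnorm : ‖1 - A‖ ≤ Real.exp r - 1 := by
    have h1 : Tendsto (fun Q => ‖1 - ∑ q ∈ Finset.range (Q + 1), T q‖) atTop (𝓝 ‖1 - A‖) := by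
      have := hsum.hasSum.tendsto_sum_nat.comp (tendsto_add_atTop_nat 1)
      rw [← hA'] at this
      exact (tendsto_const_nhds.sub this).norm
    refine le_of_tendsto h1 (Eventually.of_forall fun Q => ?_)
    rw [Finset.sum_range_succ', hT0, sub_add_cancel_right, norm_neg]
    have h2 := Real.sum_le_exp_of_nonneg hr0 (Q + 1)
    rw [Finset.sum_range_succ'] at h2
    have h3 := norm_sum_le_of_le (Finset.range Q) fun q _ => hT (q + 1)
    norm_num at h2
    linarith
  have hlt : ‖1 - A‖ < 1 := by
    have : Real.exp r < 2 := by
      rw [← Real.exp_log (by norm_num : (0 : ℝ) < 2)]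
      exact Real.exp_lt_exp.mpr hr
    linarith
  have := isUnit_one_sub_of_norm_lt_one hlt
  rwa [sub_sub_cancel] at this

/-- A slab over a short arc has a Riesz spectrum, which depends only on the length of the arc. -/
theorem isRieszSpectrum_short_arc (i : Fin d) {a : ℝ} (ha : 0 < a) (ha1 : a ≤ 1 / 10) (α : ℝ) :
    IsRieszSpectrum {x : UnitAddTorus (Fin d) | x i ∈ circleArc α (α + a)}
      {n | n i ∈ Set.range fun k : ℤ => ⌊k / a⌋} := by
  set lam : ℤ → ℤ := fun k => ⌊k / a⌋ with hlam
  have hlaminj : Function.Injective lam := (strictMono_floor_div ha (by linarith)).injective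
  obtain ⟨W, hW, -, hWker, hWcongr⟩ := exists_arcStretchOp i ha (by linarith) α
  let σ : (Fin d → ℤ) → (Fin d → ℤ) := fun n => Function.update n i (lam (n i))
  have hσ : Function.Injective σ := by
    intro m n hmn
    ext j
    by_cases hj : j = i
    · subst hj
      have := congrFun hmn j
      simp only [σ, Function.update_self] at this
      exact hlaminj this
    · have := congrFun hmn j
      simpa [σ, hj] using this
  have hrange : Set.range σ = {n | n i ∈ Set.range lam} := by
    ext n
    constructor
    · rintro ⟨m, rfl⟩
      exact ⟨m i, by simp [σ]⟩
    · rintro ⟨k, hk⟩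
      exact ⟨Function.update n i k, by simp [σ, hk]⟩
  obtain ⟨V, hV, hVrange⟩ := exists_reindexIsometry (expBasis d) hσ
    (c := fun n => (fourier (-lam (n i)) (α : UnitAddCircle) : ℂ)) fun n => by
      rw [fourier_apply, Circle.norm_coe]
  have hVmem : ∀ f, f ∈ specSpace {n : Fin d → ℤ | n i ∈ Set.range lam} ↔ ∃ g, V g = f := by
    intro f
    rw [hVrange, mem_specSpace, hrange]
  -- `V` selects the frequencies of the spectrum, with phases cancelling `α`, and `W` stretches the
  -- arc over the circle. The composite sends each exponential to itself times a factor close to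
  -- `1`.
  have hunit : IsUnit (W ∘L V.toContinuousLinearMap) := by
    refine isUnit_of_apply_expBasis (B := 2 * Real.pi) (a := a)
      (φ := fun x => 2 * Real.pi * Complex.I * circleRepIco 0 (x i)) ?_ ?_
      (fun n => ((a * lam (n i) - n i : ℝ) : ℂ)) ?_ (by positivity) ha.le ?_ fun n => ?_
    · exact (Complex.measurable_ofReal.comp
        ((measurable_circleRepIco 0).comp (measurable_pi_apply i))).const_mul _
    · intro x
      have h1 := circleRepIco_mem 0 (x i)
      simp only [norm_mul, Complex.norm_two, Complex.norm_real, Complex.norm_I, mul_one,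
        Real.norm_of_nonneg Real.pi_pos.le, Real.norm_of_nonneg h1.1]
      exact mul_le_of_le_one_right (by positivity) (by linarith [h1.2])
    · intro n
      rw [Complex.norm_real]
      exact abs_mul_floor_div_sub_le ha (n i)
    -- The threshold `1 / 10` is used here: `2 π a ≤ π / 5 < log 2`.
    · have := Real.pi_lt_d2
      have := Real.log_two_gt_d9
      nlinarith [Real.pi_pos]
    · have h1 : W (expBasis d (σ n)) =ᵐ[torusMeasure d] fun x =>
          UnitAddTorus.mFourier (σ n) (Function.update x i (arcStretch α a (x i))) := by
        exact (hW _).trans (hWcongr _ _ (expBasis_ae (σ n)))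
      change W (V (expBasis d n)) =ᵐ[_] _
      rw [hV, map_smul]
      filter_upwards [Lp.coeFn_smul (fourier (-lam (n i)) (α : UnitAddCircle) : ℂ)
        (W (expBasis d (σ n))), h1, expBasis_ae n] with x h2 h3 h4
      rw [h2, Pi.smul_apply, h3, h4, smul_eq_mul]
      have h5 := mFourier_update n i (lam (n i)) x (arcStretch α a (x i))
      have h6 : (fourier (n i) (x i) : ℂ) ≠ 0 := by
        rw [fourier_apply]; exact Circle.coe_ne_zero _
      refine mul_right_cancel₀ h6 ?_
      rw [mul_assoc, h5, mul_left_comm, fourier_arcStretch, fourier_circleRepIco, mul_comm,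
        mul_right_comm (Complex.exp _), ← Complex.exp_add]
      congr 2
      push_cast
      ring
  obtain ⟨u, hu⟩ := hunit
  have huapp : ∀ f, (u : TorusL2 d →L[ℂ] TorusL2 d) f = W (V f) := fun f => by rw [hu]; rfl
  refine ⟨fun f => ?_, fun F hF hF0 => ?_⟩
  · refine ⟨V ((↑u⁻¹ : TorusL2 d →L[ℂ] TorusL2 d) (W f)), (hVmem _).mpr ⟨_, rfl⟩, ?_⟩
    set F := V ((↑u⁻¹ : TorusL2 d →L[ℂ] TorusL2 d) (W f)) with hFdef
    have h1 : W F = W f := by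
      rw [hFdef, ← huapp, ← mul_apply_eq_comp, Units.mul_inv]; rfl
    have h2 : W (F - f) = 0 := by rw [map_sub, h1, sub_self]
    filter_upwards [(hWker _).mp h2, Lp.coeFn_sub F f] with x h3 h4 hx
    have := h3 hx
    rw [h4, Pi.sub_apply] at this
    exact sub_eq_zero.mp this
  · obtain ⟨g, rfl⟩ := (hVmem F).mp hF
    have h1 : W (V g) = 0 := (hWker _).mpr hF0
    rw [← huapp] at h1
    have h2 : g = 0 := by
      have h3 : (↑u⁻¹ * ↑u : TorusL2 d →L[ℂ] TorusL2 d) g = 0 := by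
        rw [mul_apply_eq_comp, h1, map_zero]
      rwa [Units.inv_mul] at h3
    rw [h2, map_zero]

end ArcSpectrum

/-! ### Reduction to sections that are arcs of equal length. -/

section Step

open Filter Topology

variable {d : ℕ}

theorem compl_circleArc {α β : ℝ} (hαβ : α ≤ β) (hβ : β ≤ α + 1) :
    (circleArc α β)ᶜ = circleArc β (α + 1) := by
  ext u
  obtain ⟨x, hx, rfl⟩ := exists_coe_eq_Ico α u
  rw [Set.mem_compl_iff, coe_mem_circleArc hβ hx, not_lt]
  constructor
  · exact fun h => ⟨x, ⟨h, hx.2⟩, rfl⟩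
  · rintro ⟨y, hy, hyx⟩
    have := (AddCircle.coe_eq_coe_iff_of_mem_Ico ⟨hαβ.trans hy.1, hy.2⟩ hx).mp hyx
    exact this ▸ hy.1

open Classical in
/-- A Riesz spectrum for all arcs of length `a`, provided that `a` is close to `0` or `1`. -/
noncomputable def arcSpectrum (a : ℝ) : Set ℤ :=
  if a ≤ 1 / 10 then Set.range fun k : ℤ => ⌊k / a⌋ else (Set.range fun k : ℤ => ⌊k / (1 - a)⌋)ᶜ

theorem isRieszSpectrum_arc (i : Fin d) {α β : ℝ} (hαβ : α < β) (hβ : β < α + 1)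
    (h : β - α ≤ 1 / 10 ∨ 9 / 10 ≤ β - α) :
    IsRieszSpectrum {x : UnitAddTorus (Fin d) | x i ∈ circleArc α β}
      {n | n i ∈ arcSpectrum (β - α)} := by
  by_cases h1 : β - α ≤ 1 / 10
  · have := isRieszSpectrum_short_arc i (sub_pos.mpr hαβ) h1 α
    rw [add_sub_cancel] at this
    simp only [arcSpectrum, if_pos h1]
    exact this
  · have h2 := h.resolve_left h1
    have h3 := isRieszSpectrum_short_arc i (a := 1 - (β - α)) (by linarith) (by linarith) β
    have h4 : β + (1 - (β - α)) = α + 1 := by ring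
    rw [h4, ← compl_circleArc hαβ.le hβ.le] at h3
    have hm := (isTame_circleArc hαβ.le hβ.le).measurableSet.compl
    have h5 := h3.compl (hm.preimage (measurable_pi_apply i))
    have h6 : {x : UnitAddTorus (Fin d) | x i ∈ (circleArc α β)ᶜ}ᶜ =
        {x | x i ∈ circleArc α β} := by ext x; simp
    simp only [arcSpectrum, if_neg h1]
    rw [← h6]
    exact h5

/-- Finitely many real numbers have arbitrarily large common multiples close to integers. -/
theorem exists_nat_mul_near_int {K : Type*} [Finite K] (s : K → ℝ) (N₀ : ℕ) :
    ∃ N : ℕ, N₀ ≤ N ∧ ∀ k, ∃ z : ℤ, |N * s k - z| < 1 / 10 := by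
  have hlt : ∀ x : ℝ, ⌊10 * Int.fract x⌋₊ < 10 := fun x => by
    have h1 := Int.fract_lt_one x
    rw [Nat.floor_lt (by have := Int.fract_nonneg x; linarith)]
    push_cast; linarith
  -- Pigeonhole on tenths of the fractional parts of multiples of `N₀ * s k`: two multipliers with
  -- equal patterns differ by the one sought, and being a positive multiple of `N₀` it is large.
  let f : ℕ → K → Fin 10 := fun n k => ⟨⌊10 * Int.fract (n * N₀ * s k)⌋₊, hlt _⟩
  obtain ⟨m, n, hmn, hf⟩ := Finite.exists_ne_map_eq_of_infinite f
  wlog hlt' : m < n generalizing m n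
  · exact this n m hmn.symm hf.symm (lt_of_le_of_ne (not_lt.mp hlt') hmn.symm)
  refine ⟨(n - m) * N₀, Nat.le_mul_of_pos_left _ (by omega), fun k => ?_⟩
  refine ⟨⌊n * N₀ * s k⌋ - ⌊m * N₀ * s k⌋, ?_⟩
  have h1 : ⌊10 * Int.fract (m * N₀ * s k)⌋₊ = ⌊10 * Int.fract (n * N₀ * s k)⌋₊ := by
    have := congrFun hf k
    simpa [f] using this
  have e1 := Nat.floor_le (a := 10 * Int.fract (m * N₀ * s k))
    (by have := Int.fract_nonneg (m * N₀ * s k : ℝ); linarith)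
  have e2 := Nat.lt_floor_add_one (10 * Int.fract (m * N₀ * s k))
  have e3 := Nat.floor_le (a := 10 * Int.fract (n * N₀ * s k))
    (by have := Int.fract_nonneg (n * N₀ * s k : ℝ); linarith)
  have e4 := Nat.lt_floor_add_one (10 * Int.fract (n * N₀ * s k))
  rw [h1] at e1 e2
  have e5 : (((n - m) * N₀ : ℕ) : ℝ) * s k - ((⌊n * N₀ * s k⌋ - ⌊m * N₀ * s k⌋ : ℤ) : ℝ) =
      Int.fract (n * N₀ * s k) - Int.fract (m * N₀ * s k) := by
    rw [Int.fract, Int.fract, Nat.cast_mul, Nat.cast_sub hlt'.le]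
    push_cast
    ring
  rw [e5, abs_lt]
  constructor <;> linarith

/-- Two jumps mean an arc. Its length lies strictly between `0` and `1`, so being near an integer it
is short or long. Only the length `a` enters the spectrum, so arcs in different positions can share
it. -/
theorem isRieszSpectrum_of_ncard_eq_two (i : Fin d) {A B : Set UnitAddCircle} (h : IsTame A B)
    (h2 : (symmDiff A B).ncard = 2) {a : ℝ} (ha : AddCircle.haarAddCircle.real A = a)
    {w : ℤ} (hw : |a - w| < 1 / 10) :
    IsRieszSpectrum {x : UnitAddTorus (Fin d) | x i ∈ A} {n | n i ∈ arcSpectrum a} := by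
  obtain ⟨α, β, hαβ, hβ, rfl⟩ := h.eq_circleArc h2
  rw [volume_circleArc hαβ.le hβ.le] at ha
  subst ha
  refine isRieszSpectrum_arc i hαβ hβ ?_
  rw [abs_lt] at hw
  have h3 : (-1 : ℝ) < w := by linarith
  have h4 : (w : ℝ) < 2 := by linarith
  have h5 : -1 < w := by exact_mod_cast h3
  have h6 : w < 2 := by exact_mod_cast h4
  interval_cases w
  · left; push_cast at hw; linarith
  · right; push_cast at hw; linarith

variable {K : Type*} {lab : UnitAddTorus (Fin d) → K}

theorem card_gridPattern_sections (i : Fin d) (N : ℕ) [NeZero N] (C : K → Set UnitAddCircle)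
    (hinv : ∀ x v, lab (x + Pi.single i v) = lab x) (x : UnitAddTorus (Fin d)) :
    (gridPattern i N {x | x i ∈ C (lab x)} x).card = gridCount N (C (lab x)) (x i) := by
  classical
  unfold gridCount
  congr 1
  ext j
  rw [mem_gridPattern]
  simp [gridShift, hinv]

/-- The dilation moves a point only in the `i`-th direction and so keeps its label; level sets may
be formed section by section. -/
theorem dilation_mem_sections_iff (i : Fin d) (N : ℕ) [NeZero N] (C : K → Set UnitAddCircle)
    (hinv : ∀ x v, lab (x + Pi.single i v) = lab x) (n : ℕ) (x : UnitAddTorus (Fin d)) :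
    dilation i N x ∈ {y | y i ∈ gridLevel N n (C (lab y))} ↔
      n ≤ (gridPattern i N {x | x i ∈ C (lab x)} x).card := by
  have h1 : dilation i N x = x + Pi.single i (N • x i - x i) := by
    ext j
    rw [dilation_apply]
    by_cases hj : j = i
    · subst hj; simp
    · simp [hj]
  rw [card_gridPattern_sections i N C hinv, ← mem_gridLevel]
  change dilation i N x i ∈ gridLevel N n (C (lab (dilation i N x))) ↔ _
  rw [h1, hinv]
  simp

theorem measurableSet_sections [Finite K] (i : Fin d) (hlab : ∀ k, MeasurableSet (lab ⁻¹' {k}))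
    {C : K → Set UnitAddCircle} (hC : ∀ k, MeasurableSet (C k)) :
    MeasurableSet {x : UnitAddTorus (Fin d) | x i ∈ C (lab x)} := by
  have : {x : UnitAddTorus (Fin d) | x i ∈ C (lab x)} =
      ⋃ k, lab ⁻¹' {k} ∩ (fun x => x i) ⁻¹' C k := by
    ext x; simp
  rw [this]
  exact MeasurableSet.iUnion fun k => (hlab k).inter ((hC k).preimage (measurable_pi_apply i))

/-- `N` is taken so large that distinct measures of sections are at least `1 / N` apart, and such
that `N` times each of them is near an integer. Then at each level all nontrivial sections are arcs
of one length, close to `0` or `1`, and `exists_isRieszSpectrum_of_sections` applies. -/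
theorem exists_isRieszSpectrum_of_ncard_le_two [Finite K] (i : Fin d)
    (hlab : ∀ k, MeasurableSet (lab ⁻¹' {k})) (hinv : ∀ x v, lab (x + Pi.single i v) = lab x)
    (hcell : ∀ κ : Set K, ∃ Γ, IsRieszSpectrum (lab ⁻¹' κ) Γ) {A B : K → Set UnitAddCircle}
    (h : ∀ k, IsTame (A k) (B k)) (h2 : ∀ k, (symmDiff (A k) (B k)).ncard ≤ 2) :
    ∃ Sig, IsRieszSpectrum {x : UnitAddTorus (Fin d) | x i ∈ A (lab x)} Sig := by
  set s : K → ℝ := fun k => AddCircle.haarAddCircle.real (A k) with hs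
  obtain ⟨N₀, hN₀, hsep⟩ : ∃ N₀ : ℕ, 0 < N₀ ∧ ∀ k l, s k < s l → 1 ≤ N₀ * (s l - s k) := by
    have h1 : ∀ kl : K × K, ∀ᶠ N : ℕ in atTop, s kl.1 < s kl.2 → 1 ≤ N * (s kl.2 - s kl.1) := by
      intro kl
      by_cases hkl : s kl.1 < s kl.2
      · have := (tendsto_natCast_atTop_atTop (R := ℝ)).atTop_mul_const (sub_pos.mpr hkl)
        filter_upwards [this.eventually_ge_atTop 1] with N hN _ using hN
      · exact Eventually.of_forall fun N hN => absurd hN hkl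
    obtain ⟨N, hN1, hN2⟩ := ((eventually_gt_atTop 0).and (eventually_all.mpr h1)).exists
    exact ⟨N, hN1, fun k l => hN2 (k, l)⟩
  obtain ⟨N, hN, hnear⟩ := exists_nat_mul_near_int s N₀
  have : NeZero N := ⟨by omega⟩
  have hsep' : ∀ k l, s k < s l → 1 ≤ N * (s l - s k) := fun k l hkl => by
    refine (hsep k l hkl).trans ?_
    have : (N₀ : ℝ) ≤ N := by exact_mod_cast hN
    exact mul_le_mul_of_nonneg_right this (sub_pos.mpr hkl).le
  have hmeasA := measurableSet_sections i hlab fun k => (h k).measurableSet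
  refine exists_isRieszSpectrum_of_levels i (NeZero.ne N) hmeasA
    (fun n => {y | y i ∈ gridLevel N n (A (lab y))})
    (fun n => measurableSet_sections i hlab fun k => ((h k).gridLevel n).measurableSet)
    (fun n x => dilation_mem_sections_iff i N A hinv n x) fun n => ?_
  set ℓ : K → ℝ := fun k => AddCircle.haarAddCircle.real (gridLevel N n (A k)) with hℓ
  have hnontriv : ∀ k, symmDiff (gridLevel N n (A k)) (gridLevel N n (B k)) ≠ ∅ →
      (symmDiff (gridLevel N n (A k)) (gridLevel N n (B k))).ncard = 2 ∧
      N * s k = n - 1 + ℓ k ∧ 0 < ℓ k ∧ ℓ k < 1 := by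
    intro k hk
    have ht := (h k).gridLevel (N := N) n
    have h3 : 0 < (symmDiff (gridLevel N n (A k)) (gridLevel N n (B k))).ncard :=
      (Set.ncard_pos ht.finite).mpr (Set.nonempty_iff_ne_empty.mpr hk)
    have h4 := ncard_symmDiff_gridLevel_le (N := N) (h k) n
    have h5 := h2 k
    have h6 : (symmDiff (gridLevel N n (A k)) (gridLevel N n (B k))).ncard = 2 := by
      obtain ⟨r, hr⟩ := even_ncard_symmDiff ht
      omega
    refine ⟨h6, ?_, ?_⟩
    · refine volume_gridLevel (h k) N fun u => gridCount_mem_of_ncard_le (h k) ?_ (by omega) u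
      exact (Set.ncard_pos (h k).finite).mp (by omega)
    · obtain ⟨α, β, hαβ, hβ, heq⟩ := ht.eq_circleArc h6
      have : ℓ k = β - α := by
        simp only [hℓ, heq]; exact volume_circleArc hαβ.le hβ.le
      rw [this]
      constructor <;> linarith
  -- Both `N * s k` and `N * s l` lie strictly between `n - 1` and `n`, so they are less than `1`
  -- apart.
  have hsame : ∀ k l, symmDiff (gridLevel N n (A k)) (gridLevel N n (B k)) ≠ ∅ →
      symmDiff (gridLevel N n (A l)) (gridLevel N n (B l)) ≠ ∅ → ¬ s k < s l := by
    intro k l hk hl hkl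
    obtain ⟨-, e1, e2, -⟩ := hnontriv k hk
    obtain ⟨-, e3, -, e4⟩ := hnontriv l hl
    have := hsep' k l hkl
    rw [mul_sub, e1, e3] at this
    linarith
  have hC : ∀ k, MeasurableSet (gridLevel N n (A k)) := fun k => ((h k).gridLevel n).measurableSet
  have htriv : ∀ k, symmDiff (gridLevel N n (A k)) (gridLevel N n (B k)) = ∅ →
      gridLevel N n (A k) = ∅ ∨ gridLevel N n (A k) = Set.univ := fun k hk =>
    ((h k).gridLevel n).eq_empty_or_univ hk
  by_cases hex : ∃ k, symmDiff (gridLevel N n (A k)) (gridLevel N n (B k)) ≠ ∅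
  · obtain ⟨k₀, hk₀⟩ := hex
    refine exists_isRieszSpectrum_of_sections i lab hlab hinv hcell
      (fun k => gridLevel N n (A k)) hC (arcSpectrum (ℓ k₀)) fun k => ?_
    by_cases hk : symmDiff (gridLevel N n (A k)) (gridLevel N n (B k)) = ∅
    · exact (htriv k hk).imp_right Or.inl
    · right; right
      obtain ⟨e1, e2, -⟩ := hnontriv k hk
      obtain ⟨-, e3, -⟩ := hnontriv k₀ hk₀
      have hsk : s k = s k₀ :=
        le_antisymm (not_lt.mp (hsame k₀ k hk₀ hk)) (not_lt.mp (hsame k k₀ hk hk₀))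
      rw [hsk, e3] at e2
      obtain ⟨z, hz⟩ := hnear k₀
      -- The common length is `N * s k₀ - (n - 1)`, so it is near an integer together with `N * s
      -- k₀`.
      refine isRieszSpectrum_of_ncard_eq_two i ((h k).gridLevel n) e1
        (show ℓ k = ℓ k₀ by linarith) (w := z - (n - 1)) ?_
      rw [e3] at hz
      push_cast
      have : ℓ k₀ - (z - (n - 1)) = n - 1 + ℓ k₀ - z := by ring
      rwa [this]
  · push Not at hex
    exact exists_isRieszSpectrum_of_sections i lab hlab hinv hcell
      (fun k => gridLevel N n (A k)) hC ∅ fun k => (htriv k (hex k)).imp_right Or.inl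

/-- A set whose sections in one direction are tame and depend only on a label, which is constant in
that direction, has a Riesz spectrum, provided that the unions of the label classes do. -/
theorem exists_isRieszSpectrum_of_tame_sections [Finite K] (i : Fin d)
    (hlab : ∀ k, MeasurableSet (lab ⁻¹' {k})) (hinv : ∀ x v, lab (x + Pi.single i v) = lab x)
    (hcell : ∀ κ : Set K, ∃ Γ, IsRieszSpectrum (lab ⁻¹' κ) Γ) {A B : K → Set UnitAddCircle}
    (h : ∀ k, IsTame (A k) (B k)) :
    ∃ Sig, IsRieszSpectrum {x : UnitAddTorus (Fin d) | x i ∈ A (lab x)} Sig := by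
  cases nonempty_fintype K
  -- Induction on the total number of jumps over all labels: `N` is chosen for one offending
  -- section, and the others do not get worse.
  induction hm : ∑ k, (symmDiff (A k) (B k)).ncard using Nat.strong_induction_on
    generalizing A B with
  | _ m ih =>
    by_cases h2 : ∀ k, (symmDiff (A k) (B k)).ncard ≤ 2
    · exact exists_isRieszSpectrum_of_ncard_le_two i hlab hinv hcell h h2
    · push Not at h2
      obtain ⟨k₀, hk₀⟩ := h2
      obtain ⟨N, hN, hlt⟩ := exists_ncard_gridLevel_lt (h k₀) hk₀
      refine exists_isRieszSpectrum_of_levels i (NeZero.ne N)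
        (measurableSet_sections i hlab fun k => (h k).measurableSet)
        (fun n => {y | y i ∈ gridLevel N n (A (lab y))})
        (fun n => measurableSet_sections i hlab fun k => ((h k).gridLevel n).measurableSet)
        (fun n x => dilation_mem_sections_iff i N A hinv n x) fun n => ?_
      refine ih _ ?_ (A := fun k => gridLevel N n (A k)) (B := fun k => gridLevel N n (B k))
        (fun k => (h k).gridLevel n) rfl
      rw [← hm]
      exact Finset.sum_lt_sum (fun k _ => ncard_symmDiff_gridLevel_le (h k) n)
        ⟨k₀, Finset.mem_univ _, hlt n⟩

end Step

/-! ### Finite unions of boxes, by induction on the coordinates. -/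

section Boxes

open Filter Topology

variable {d : ℕ} {M : Type*} [Finite M]

/-- Finitely many one-sided limits hold at once, so any Boolean combination inherits them, and its
jumps are among those of the given sets. -/
theorem IsTame.of_pattern {A B : M → Set UnitAddCircle} (h : ∀ m, IsTame (A m) (B m))
    (Q : (M → Prop) → Prop) : IsTame {u | Q fun m => u ∈ A m} {u | Q fun m => u ∈ B m} where
  right u := by
    filter_upwards [eventually_all.mpr fun m => (h m).right u] with ε hε
    have : (fun m => u + (ε : UnitAddCircle) ∈ A m) = fun m => u ∈ A m :=
      funext fun m => propext (hε m)
    change Q _ ↔ Q _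
    rw [this]
  left u := by
    filter_upwards [eventually_all.mpr fun m => (h m).left u] with ε hε
    have : (fun m => u - (ε : UnitAddCircle) ∈ A m) = fun m => u ∈ B m :=
      funext fun m => propext (hε m)
    change Q _ ↔ Q _
    rw [this]
  finite := by
    refine (Set.finite_iUnion fun m => (h m).finite).subset fun u hu => ?_
    by_contra hcon
    have : (fun m => u ∈ A m) = fun m => u ∈ B m := funext fun m => propext (by
      have h1 : u ∉ symmDiff (A m) (B m) := fun hm => hcon (Set.mem_iUnion.mpr ⟨m, hm⟩)
      rw [Set.mem_symmDiff] at h1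
      tauto)
    rw [Set.mem_symmDiff] at hu
    change (Q _ ∧ ¬ Q _) ∨ (Q _ ∧ ¬ Q _) at hu
    rw [this] at hu
    tauto

/-- The conditions, among finitely many, that are satisfied by the coordinates in `I` of a point. -/
def boxPattern (A : M → Fin d → Set UnitAddCircle) (I : Finset (Fin d)) (x : UnitAddTorus (Fin d)) :
    M → Fin d → Prop := fun m j => j ∈ I ∧ x j ∈ A m j

/-- The statement covers all unions of pattern cells, not just unions of boxes, because adding a
coordinate requires Riesz spectra for arbitrary unions of the cells in the preceding ones. -/
theorem exists_isRieszSpectrum_boxPattern {A B : M → Fin d → Set UnitAddCircle}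
    (h : ∀ m j, IsTame (A m j) (B m j)) (I : Finset (Fin d)) (κ : Set (M → Fin d → Prop)) :
    ∃ Sig, IsRieszSpectrum (boxPattern A I ⁻¹' κ) Sig := by
  classical
  induction I using Finset.induction_on generalizing κ with
  | empty =>
    have hemp : ∀ x, boxPattern A ∅ x = fun _ _ => False := fun x => by
      ext m j; simp [boxPattern]
    by_cases hκ : (fun _ _ => False : M → Fin d → Prop) ∈ κ
    · have : boxPattern A ∅ ⁻¹' κ = Set.univ := Set.eq_univ_of_forall fun x => by
        rwa [Set.mem_preimage, hemp]
      exact ⟨_, this ▸ isRieszSpectrum_univ⟩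
    · have : boxPattern A ∅ ⁻¹' κ = ∅ := Set.eq_empty_of_forall_notMem fun x hx => hκ (by
        rwa [Set.mem_preimage, hemp] at hx)
      exact ⟨_, this ▸ isRieszSpectrum_empty⟩
  | insert i I hi ih =>
    have hlab : ∀ k, MeasurableSet (boxPattern A I ⁻¹' {k}) := by
      intro k
      have : boxPattern A I ⁻¹' {k} = ⋂ m, ⋂ j, {x | (j ∈ I ∧ x j ∈ A m j) = k m j} := by
        ext x
        simp only [Set.mem_preimage, Set.mem_singleton_iff, funext_iff, Set.mem_iInter]
        rfl
      rw [this]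
      have := Fintype.ofFinite M
      refine MeasurableSet.iInter fun m => MeasurableSet.iInter fun j => ?_
      have hA : MeasurableSet {x : UnitAddTorus (Fin d) | x j ∈ A m j} :=
        (h m j).measurableSet.preimage (measurable_pi_apply j)
      have h1 : MeasurableSet {x : UnitAddTorus (Fin d) | j ∈ I ∧ x j ∈ A m j} := by
        by_cases hj : j ∈ I
        · simpa [hj] using hA
        · simp [hj]
      by_cases hk : k m j
      · simpa only [hk, eq_iff_iff, iff_true] using h1
      · simp only [hk, eq_iff_iff, iff_false]
        exact h1.compl
    have hinv : ∀ x v, boxPattern A I (x + Pi.single i v) = boxPattern A I x := by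
      intro x v
      ext m j
      simp only [boxPattern]
      refine and_congr_right fun hj => ?_
      have : j ≠ i := fun h => hi (h ▸ hj)
      simp [this]
    obtain ⟨Sig, hSig⟩ := exists_isRieszSpectrum_of_tame_sections i hlab hinv ih
      (A := fun k => {u | (fun m j => k m j ∨ (j = i ∧ u ∈ A m i)) ∈ κ})
      (B := fun k => {u | (fun m j => k m j ∨ (j = i ∧ u ∈ B m i)) ∈ κ})
      (fun k => IsTame.of_pattern (fun m => h m i)
        fun q => (fun m j => k m j ∨ (j = i ∧ q m)) ∈ κ)
    refine ⟨Sig, ?_⟩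
    have : boxPattern A (insert i I) ⁻¹' κ = {x : UnitAddTorus (Fin d) | x i ∈
        {u | (fun m j => boxPattern A I x m j ∨ (j = i ∧ u ∈ A m i)) ∈ κ}} := by
      ext x
      change boxPattern A (insert i I) x ∈ κ ↔
        (fun m j => boxPattern A I x m j ∨ (j = i ∧ x i ∈ A m i)) ∈ κ
      have : boxPattern A (insert i I) x =
          fun m j => boxPattern A I x m j ∨ (j = i ∧ x i ∈ A m i) := by
        ext m j
        simp only [boxPattern, Finset.mem_insert]
        constructor
        · rintro ⟨rfl | h1, h2⟩
          · exact Or.inr ⟨rfl, h2⟩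
          · exact Or.inl ⟨h1, h2⟩
        · rintro (⟨h1, h2⟩ | ⟨rfl, h2⟩)
          · exact ⟨Or.inr h1, h2⟩
          · exact ⟨Or.inl rfl, h2⟩
      rw [this]
    rw [this]
    exact hSig

/-- A finite union of boxes in the torus, with tame sides, has a Riesz spectrum. -/
theorem exists_isRieszSpectrum_iUnion_boxes {A B : M → Fin d → Set UnitAddCircle}
    (h : ∀ m j, IsTame (A m j) (B m j)) :
    ∃ Sig, IsRieszSpectrum {x : UnitAddTorus (Fin d) | ∃ m, ∀ j, x j ∈ A m j} Sig := by
  obtain ⟨Sig, hSig⟩ := exists_isRieszSpectrum_boxPattern h Finset.univ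
    {k | ∃ m, ∀ j, k m j}
  refine ⟨Sig, ?_⟩
  have : boxPattern A Finset.univ ⁻¹' {k | ∃ m, ∀ j, k m j} =
      {x : UnitAddTorus (Fin d) | ∃ m, ∀ j, x j ∈ A m j} := by
    ext x; simp [boxPattern]
  rwa [this] at hSig

end Boxes

/-! ### From isomorphisms of Hilbert spaces to Riesz bases. -/

section RieszBasis

variable {ι U H : Type*} [NormedAddCommGroup U] [InnerProductSpace ℂ U] [CompleteSpace U]
  [NormedAddCommGroup H] [InnerProductSpace ℂ H] [CompleteSpace H]

/-- The polar decomposition of an invertible operator between Hilbert spaces. -/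
theorem exists_polar_decomposition (Φ : U ≃L[ℂ] H) :
    ∃ (Q : U ≃ₗᵢ[ℂ] H) (P : H ≃L[ℂ] H), ∀ u, Φ u = P (Q u) := by
  set A : U →L[ℂ] H := Φ.toContinuousLinearMap with hA
  set B : H →L[ℂ] U := ContinuousLinearMap.adjoint A with hB
  have hBsurj : ∀ u, ∃ y, B y = u := by
    intro u
    refine ⟨ContinuousLinearMap.adjoint Φ.symm.toContinuousLinearMap u, ?_⟩
    refine ext_inner_right ℂ fun v => ?_
    rw [hB, ContinuousLinearMap.adjoint_inner_left, ContinuousLinearMap.adjoint_inner_left]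
    simp [hA]
  have hBinj : ∀ y, B y = 0 → y = 0 := by
    intro y hy
    refine ext_inner_right ℂ fun v => ?_
    have h1 := ContinuousLinearMap.adjoint_inner_left A (Φ.symm v) y
    rw [← hB, hy, inner_zero_left] at h1
    rw [inner_zero_left, h1]
    simp [hA]
  -- `P` is the square root of `Φ Φ*` and `Q = P⁻¹ Φ`. The latter is isometric because `‖P y‖² = ⟪G
  -- y, y⟫ = ‖B y‖²`, while every `u` has the form `B y`.
  set G : H →L[ℂ] H := A ∘L B with hG
  have hGnonneg : 0 ≤ G :=
    (ContinuousLinearMap.nonneg_iff_isPositive _).mpr (ContinuousLinearMap.isPositive_self_comp_adjoint A)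
  have hGunit : IsUnit G := by
    rw [ContinuousLinearMap.isUnit_iff_bijective]
    constructor
    · refine (injective_iff_map_eq_zero G).mpr fun y hy => hBinj y ?_
      have : Φ (B y) = 0 := hy
      simpa using this
    · intro z
      obtain ⟨y, hy⟩ := hBsurj (Φ.symm z)
      exact ⟨y, by change Φ (B y) = z; rw [hy]; simp⟩
  set P : H →L[ℂ] H := CFC.sqrt G with hP
  have hPP : P * P = G := CFC.sqrt_mul_sqrt_self G hGnonneg
  have hPunit : IsUnit P := (CFC.isUnit_sqrt_iff G hGnonneg).mpr hGunit
  have hPsa : IsSelfAdjoint P := (CFC.sqrt_nonneg G).isSelfAdjoint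
  obtain ⟨hPi, hPs⟩ := ContinuousLinearMap.isUnit_iff_bijective.mp hPunit
  let T : H ≃L[ℂ] H := ContinuousLinearEquiv.ofBijective P (LinearMap.ker_eq_bot.mpr hPi)
    (LinearMap.range_eq_top.mpr hPs)
  have hT : ∀ y, T y = P y := fun y => rfl
  have hnorm : ∀ u, ‖T.symm (Φ u)‖ = ‖u‖ := by
    intro u
    obtain ⟨y, rfl⟩ := hBsurj u
    have h1 : T.symm (Φ (B y)) = P y := by
      rw [ContinuousLinearEquiv.symm_apply_eq, hT]
      change G y = (P * P) y
      rw [hPP]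
    rw [h1]
    have h2 : ⟪P y, P y⟫_ℂ = ⟪B y, B y⟫_ℂ := by
      have h3 : ⟪P y, P y⟫_ℂ = ⟪(P * P) y, y⟫_ℂ := by
        conv_rhs => rw [mul_apply_eq_comp]
        nth_rw 3 [← hPsa.adjoint_eq]
        rw [ContinuousLinearMap.adjoint_inner_left]
      rw [h3, hPP]
      change ⟪A (B y), y⟫_ℂ = _
      rw [hB, ContinuousLinearMap.adjoint_inner_right]
    rw [inner_self_eq_norm_sq_to_K, inner_self_eq_norm_sq_to_K] at h2
    have h4 : ‖P y‖ ^ 2 = ‖B y‖ ^ 2 := by exact_mod_cast h2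
    exact (sq_eq_sq₀ (norm_nonneg _) (norm_nonneg _)).mp h4
  refine ⟨⟨(Φ.trans T.symm).toLinearEquiv, hnorm⟩, T, fun u => ?_⟩
  exact (T.apply_symm_apply _).symm

/-- A Riesz basis must come from an orthonormal basis of `H` itself. The unitary part of `Φ` carries
`e` to one, and the positive part is the invertible operator. -/
theorem isRieszBasis_map (Φ : U ≃L[ℂ] H) (e : HilbertBasis ι ℂ U) :
    IsRieszBasis fun i => Φ (e i) := by
  classical
  obtain ⟨Q, P, h⟩ := exists_polar_decomposition Φ
  refine ⟨HilbertBasis.ofRepr (Q.symm.trans e.repr), P, fun i => ?_⟩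
  refine (h _).trans (congrArg P ?_)
  rw [← HilbertBasis.repr_symm_single]
  change Q (e i) = Q (e.repr.symm (lp.single 2 i 1))
  rw [e.repr_symm_single]

/-- The Fourier basis of the space of functions with given spectrum. -/
theorem exists_hilbertBasis_specSpace {d : ℕ} {Sig : Set (Fin d → ℤ)} {g : ι → Fin d → ℤ}
    (hg : Function.Injective g) (hrange : Set.range g = Sig) :
    ∃ e : HilbertBasis ι ℂ (specSpace Sig), ∀ i, (e i : TorusL2 d) = expBasis d (g i) := by
  let v : ι → specSpace Sig := fun i =>
    ⟨expBasis d (g i), expBasis_mem_specSpace (hrange ▸ Set.mem_range_self i)⟩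
  have hv : Orthonormal ℂ v := by
    refine ⟨fun i => (expBasis d).orthonormal.1 (g i), fun i j hij => ?_⟩
    exact (expBasis d).orthonormal.2 (hg.ne hij)
  have hbot : (Submodule.span ℂ (Set.range v))ᗮ = ⊥ := by
    rw [Submodule.eq_bot_iff]
    intro F hF
    rw [Submodule.mem_orthogonal] at hF
    refine Subtype.ext (expBasis_ext fun n => ?_)
    rw [Submodule.coe_zero, inner_zero_right]
    by_cases hn : n ∈ Sig
    · rw [← hrange] at hn
      obtain ⟨i, rfl⟩ := hn
      exact hF (v i) (Submodule.subset_span ⟨i, rfl⟩)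
    · exact mem_specSpace.mp F.2 n hn
  refine ⟨HilbertBasis.mkOfOrthogonalEqBot hv hbot, fun i => ?_⟩
  rw [HilbertBasis.coe_mkOfOrthogonalEqBot]

/-- A surjective operator on `L²` of the torus whose kernel consists of the functions vanishing on
`S` maps the exponentials in a Riesz spectrum of `S` to a Riesz basis. -/
theorem IsRieszSpectrum.isRieszBasis {d : ℕ} {S : Set (UnitAddTorus (Fin d))}
    {Sig : Set (Fin d → ℤ)} (hS : IsRieszSpectrum S Sig) (W : TorusL2 d →L[ℂ] H)
    (hsurj : Function.Surjective W)
    (hker : ∀ f, W f = 0 ↔ ∀ᵐ x ∂torusMeasure d, x ∈ S → f x = 0) {g : ι → Fin d → ℤ}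
    (hg : Function.Injective g) (hrange : Set.range g = Sig) :
    IsRieszBasis fun i => W (expBasis d (g i)) := by
  obtain ⟨hex, huniq⟩ := hS
  obtain ⟨e, he⟩ := exists_hilbertBasis_specSpace hg hrange
  let Wr : specSpace Sig →L[ℂ] H := W ∘L (specSpace Sig).subtypeL
  have hinj : LinearMap.ker (Wr : specSpace Sig →ₗ[ℂ] H) = ⊥ := by
    refine LinearMap.ker_eq_bot'.mpr fun F hF => Subtype.ext ?_
    exact huniq F F.2 ((hker _).mp hF)
  have hsur : LinearMap.range (Wr : specSpace Sig →ₗ[ℂ] H) = ⊤ := by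
    refine LinearMap.range_eq_top.mpr fun y => ?_
    obtain ⟨f, rfl⟩ := hsurj y
    obtain ⟨F, hF, hFf⟩ := hex f
    refine ⟨⟨F, hF⟩, ?_⟩
    change W F = W f
    rw [← sub_eq_zero, ← map_sub, hker]
    filter_upwards [hFf, Lp.coeFn_sub F f] with x h1 h2 hx
    rw [h2, Pi.sub_apply, h1 hx, sub_self]
  have := isRieszBasis_map (ContinuousLinearEquiv.ofBijective Wr hinj hsur) e
  refine (funext fun i => ?_ : (fun i => W (expBasis d (g i))) = fun i =>
    (ContinuousLinearEquiv.ofBijective Wr hinj hsur) (e i)) ▸ this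
  rw [ContinuousLinearEquiv.coeFn_ofBijective, ← he]
  rfl

end RieszBasis

/-! ### Transfer from the torus to Euclidean space. -/

section Transfer

open Filter Topology

variable {d : ℕ}

theorem coe_mem_circleArc_of_mem {b α β y : ℝ} (hα : b ≤ α) (hβ : β ≤ b + 1)
    (hy : y ∈ Set.Ico b (b + 1)) : (y : UnitAddCircle) ∈ circleArc α β ↔ y ∈ Set.Ico α β := by
  constructor
  · rintro ⟨z, hz, hzy⟩
    have := (AddCircle.coe_eq_coe_iff_of_mem_Ico ⟨hα.trans hz.1, hz.2.trans_le hβ⟩ hy).mp hzy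
    exact this ▸ hz
  · exact fun h => ⟨y, h, rfl⟩

/-- A bounded interval agrees, outside two points, with a half-open one. -/
theorem exists_Ico_of_ordConnected {I : Set ℝ} (hI : I.OrdConnected) {c e : ℝ} (hce : c ≤ e)
    (hsub : I ⊆ Set.Icc c e) : ∃ α β, c ≤ α ∧ α ≤ β ∧ β ≤ e ∧
      ∀ x, x ≠ α → x ≠ β → (x ∈ I ↔ x ∈ Set.Ico α β) := by
  rcases I.eq_empty_or_nonempty with rfl | hne
  · exact ⟨c, c, le_rfl, le_rfl, hce, by simp⟩
  have hbb : BddBelow I := ⟨c, fun x hx => (hsub hx).1⟩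
  have hba : BddAbove I := ⟨e, fun x hx => (hsub hx).2⟩
  obtain ⟨x₀, hx₀⟩ := hne
  refine ⟨sInf I, sSup I, le_csInf ⟨x₀, hx₀⟩ fun x hx => (hsub hx).1,
    (csInf_le hbb hx₀).trans (le_csSup hba hx₀), csSup_le ⟨x₀, hx₀⟩ fun x hx => (hsub hx).2,
    fun x h1 h2 => ⟨fun hx => ?_, fun hx => ?_⟩⟩
  · exact ⟨csInf_le hbb hx, lt_of_le_of_ne (le_csSup hba hx) h2⟩
  · obtain ⟨y, hy, hyx⟩ := exists_lt_of_csInf_lt ⟨x₀, hx₀⟩ (lt_of_le_of_ne hx.1 h1.symm)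
    obtain ⟨z, hz, hxz⟩ := exists_lt_of_lt_csSup ⟨x₀, hx₀⟩ hx.2
    exact hI.out hy hz ⟨hyx.le, hxz.le⟩

theorem ae_euclidean_ne (i : Fin d) (c : ℝ) :
    ∀ᵐ x : EuclideanSpace ℝ (Fin d), x i ≠ c := by
  have h1 : ∀ᵐ y : Fin d → ℝ, y i ≠ c := Measure.ae_eval_ne (fun _ : Fin d => (volume : Measure ℝ)) i c
  exact (PiLp.volume_preserving_ofLp (Fin d)).quasiMeasurePreserving.ae h1

/-- The covering of the torus by the Euclidean space, with period `M` in each direction. -/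
noncomputable def torusCover (M : ℝ) (x : EuclideanSpace ℝ (Fin d)) : UnitAddTorus (Fin d) :=
  fun i => ((x i / M : ℝ) : UnitAddCircle)

theorem measurable_torusCover (M : ℝ) : Measurable (torusCover (d := d) M) := by
  refine measurable_pi_lambda _ fun i => AddCircle.measurable_mk'.comp ?_
  fun_prop

theorem map_torusCover {M : ℝ} (hM : 0 < M) (b : ℝ) :
    ((volume : Measure (EuclideanSpace ℝ (Fin d))).restrict
      {x | ∀ i, x i ∈ Set.Ico (b * M) ((b + 1) * M)}).map (torusCover M) =
      (∏ _i : Fin d, M.toNNReal) • torusMeasure d := by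
  have h1 : (volume.restrict (Set.Ico (b * M) ((b + 1) * M))).map
      (fun x : ℝ => ((x / M : ℝ) : UnitAddCircle)) =
      M.toNNReal • AddCircle.haarAddCircle.restrict Set.univ := by
    have h2 := map_affine_restrict_Ico (inv_pos.mpr hM) 0 (b * M) ((b + 1) * M)
    have e1 : 0 + M⁻¹ * (b * M) = b := by field_simp; ring
    have e2 : 0 + M⁻¹ * ((b + 1) * M) = b + 1 := by field_simp; ring
    rw [e1, e2, Real.toNNReal_inv, inv_inv] at h2
    have h3 : (fun x : ℝ => ((x / M : ℝ) : UnitAddCircle)) =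
        (fun x : ℝ => (x : UnitAddCircle)) ∘ fun x : ℝ => 0 + M⁻¹ * x := by
      ext x; simp [div_eq_inv_mul]
    have hmk : Measurable fun x : ℝ => (x : UnitAddCircle) := AddCircle.measurable_mk'
    rw [h3, ← Measure.map_map hmk (by fun_prop), h2, Measure.map_smul,
      map_coe_restrict_Ico le_rfl, circleArc_add_one]
  have h4 := map_pi_eq_smul_restrict
    (fun _ : Fin d => volume.restrict (Set.Ico (b * M) ((b + 1) * M)))
    (fun _ : Fin d => (AddCircle.haarAddCircle : Measure UnitAddCircle))
    (fun _ x => ((x / M : ℝ) : UnitAddCircle))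
    (fun _ => AddCircle.measurable_mk'.comp (by fun_prop)) (fun _ => M.toNNReal)
    (fun _ => Set.univ) fun _ => h1
  rw [Set.pi_univ, Measure.restrict_univ, ← Measure.restrict_pi_pi] at h4
  have hmeas : MeasurableSet (Set.univ.pi fun _ : Fin d => Set.Ico (b * M) ((b + 1) * M)) :=
    MeasurableSet.univ_pi fun _ => measurableSet_Ico
  have h5 := (PiLp.volume_preserving_ofLp (Fin d)).restrict_preimage hmeas
  have h6 : {x : EuclideanSpace ℝ (Fin d) | ∀ i, x i ∈ Set.Ico (b * M) ((b + 1) * M)} =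
      WithLp.ofLp ⁻¹' (Set.univ.pi fun _ : Fin d => Set.Ico (b * M) ((b + 1) * M)) := by
    ext x; simp
  rw [h6, ← h4, volume_pi.symm, ← h5.map_eq, Measure.map_map _ h5.measurable]
  · rfl
  · exact measurable_pi_lambda _ fun i => AddCircle.measurable_mk'.comp (by fun_prop)

/-- The frequency in Euclidean space of an exponential on the torus. -/
noncomputable def scaledFreq (M : ℝ) (n : Fin d → ℤ) : EuclideanSpace ℝ (Fin d) :=
  WithLp.toLp 2 fun i => (n i : ℝ) / M

theorem scaledFreq_injective {M : ℝ} (hM : M ≠ 0) :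
    Function.Injective (scaledFreq (d := d) M) := by
  intro m n h
  ext i
  have h1 : (m i : ℝ) / M = n i / M := congrArg (fun x : EuclideanSpace ℝ (Fin d) => x i) h
  rw [div_left_inj' hM] at h1
  exact_mod_cast h1

theorem mFourier_torusCover (M : ℝ) (n : Fin d → ℤ) (x : EuclideanSpace ℝ (Fin d)) :
    UnitAddTorus.mFourier n (torusCover M x) = expFun (scaledFreq M n) x := by
  have h1 : UnitAddTorus.mFourier n (torusCover M x) =
      ∏ i, (fourier (n i) ((x i / M : ℝ) : UnitAddCircle) : ℂ) := rfl
  simp only [h1, fourier_coe_apply, ← Complex.exp_sum, expFun, PiLp.inner_apply, scaledFreq]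
  congr 1
  push_cast
  rw [Finset.mul_sum]
  refine Finset.sum_congr rfl fun i _ => ?_
  simp only [RCLike.inner_apply, conj_trivial]
  push_cast
  ring

/-- Up to a null set, `S` is the part, in a half-open cube of side `M`, of the preimage of a union
of boxes with arcs as sides. The covering map is injective on that cube and scales measure by a
constant, so composition with it carries the Riesz spectrum to `S`. -/
theorem exists_isRieszBasisOfExponentials_scaledFreq {S : Set (EuclideanSpace ℝ (Fin d))}
    (hS : ∃ (n : ℕ) (R : Fin n → Set (EuclideanSpace ℝ (Fin d))),
      (∀ k, IsRectangle (R k)) ∧ S = ⋃ k, R k) {M : ℝ} (hM : 0 < M) (b : ℝ)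
    (hbox : ∀ x ∈ S, ∀ i, x i ∈ Set.Icc (b * M) ((b + 1) * M)) :
    ∃ Sig : Set (Fin d → ℤ), IsRieszBasisOfExponentials S (scaledFreq M '' Sig) := by
  obtain ⟨n, R, hR, rfl⟩ := hS
  choose I hI hRI using hR
  have hbM : b * M ≤ (b + 1) * M := by nlinarith
  -- The sides are cut down to the cube because a rectangle that is empty through one side may have
  -- other sides reaching outside.
  choose α β hα hαβ hβ hIco using fun k i => exists_Ico_of_ordConnected
    (((hI k i).1).inter (Set.ordConnected_Icc (a := b * M) (b := (b + 1) * M))) hbM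
    Set.inter_subset_right
  set A : Fin n → Fin d → Set UnitAddCircle := fun k i => circleArc (α k i / M) (β k i / M)
  have hα' : ∀ k i, b ≤ α k i / M := fun k i => (le_div_iff₀ hM).mpr (hα k i)
  have hβ' : ∀ k i, β k i / M ≤ b + 1 := fun k i => (div_le_iff₀ hM).mpr (hβ k i)
  have hA := fun k i => isTame_circleArc (div_le_div_of_nonneg_right (hαβ k i) hM.le)
    (by linarith [hα' k i, hβ' k i])
  obtain ⟨Sig, hSig⟩ := exists_isRieszSpectrum_iUnion_boxes (A := A) hA
  set J : Set (UnitAddTorus (Fin d)) := {x | ∃ k, ∀ i, x i ∈ A k i} with hJ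
  have hJm : MeasurableSet J := by
    have : J = ⋃ k, ⋂ i, {x | x i ∈ A k i} := by ext x; simp [hJ]
    rw [this]
    exact MeasurableSet.iUnion fun k => MeasurableSet.iInter fun i =>
      (hA k i).measurableSet.preimage (measurable_pi_apply i)
  set box : Set (EuclideanSpace ℝ (Fin d)) :=
    {x | ∀ i, x i ∈ Set.Ico (b * M) ((b + 1) * M)} with hboxdef
  have hSbox : (⋃ k, R k : Set (EuclideanSpace ℝ (Fin d))) =ᵐ[volume]
      (torusCover M ⁻¹' J ∩ box : Set (EuclideanSpace ℝ (Fin d))) := by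
    have h1 : ∀ᵐ x : EuclideanSpace ℝ (Fin d), ∀ i, x i ≠ (b + 1) * M :=
      ae_all_iff.mpr fun i => ae_euclidean_ne i _
    have h2 : ∀ᵐ x : EuclideanSpace ℝ (Fin d), ∀ k i, x i ≠ α k i ∧ x i ≠ β k i :=
      ae_all_iff.mpr fun k => ae_all_iff.mpr fun i =>
        (ae_euclidean_ne i _).and (ae_euclidean_ne i _)
    filter_upwards [h1, h2] with x hx1 hx2
    refine propext ?_
    change x ∈ (⋃ k, R k) ↔ torusCover M x ∈ J ∧ x ∈ box
    have key : x ∈ box → (torusCover M x ∈ J ↔ x ∈ ⋃ k, R k) := by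
      intro hxb
      simp only [hJ, Set.mem_iUnion, hRI]
      refine exists_congr fun k => forall_congr' fun i => ?_
      have h3 : x i / M ∈ Set.Ico b (b + 1) :=
        ⟨(le_div_iff₀ hM).mpr (hxb i).1, (div_lt_iff₀ hM).mpr (hxb i).2⟩
      change ((x i / M : ℝ) : UnitAddCircle) ∈ circleArc (α k i / M) (β k i / M) ↔ _
      rw [coe_mem_circleArc_of_mem (hα' k i) (hβ' k i) h3]
      have h4 : x i / M ∈ Set.Ico (α k i / M) (β k i / M) ↔ x i ∈ Set.Ico (α k i) (β k i) := by
        simp only [Set.mem_Ico, div_le_div_iff_of_pos_right hM, div_lt_div_iff_of_pos_right hM]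
      rw [h4, ← hIco k i _ (hx2 k i).1 (hx2 k i).2]
      exact ⟨fun h => h.1, fun h => ⟨h, ⟨(hxb i).1, (hxb i).2.le⟩⟩⟩
    constructor
    · intro hx
      have hxb : x ∈ box := fun i =>
        ⟨(hbox x hx i).1, lt_of_le_of_ne (hbox x hx i).2 (hx1 i)⟩
      exact ⟨(key hxb).mpr hx, hxb⟩
    · rintro ⟨hx, hxb⟩
      exact (key hxb).mp hx
  have hcov := measurable_torusCover (d := d) M
  have hrestr : (volume.restrict (⋃ k, R k)).map (torusCover M) =
      (∏ _i : Fin d, M.toNNReal) • (torusMeasure d).restrict J := by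
    rw [Measure.restrict_congr_set hSbox, ← Measure.restrict_restrict (hcov hJm),
      ← Measure.restrict_map hcov hJm, map_torusCover hM, Measure.restrict_smul]
  have hinv : ∀ᵐ x ∂(volume.restrict (⋃ k, R k)),
      (fun u : UnitAddTorus (Fin d) => (WithLp.toLp 2 fun i => M * circleRepIco b (u i) :
        EuclideanSpace ℝ (Fin d))) (torusCover M x) = x := by
    rw [Measure.restrict_congr_set hSbox, ← Measure.restrict_restrict (hcov hJm)]
    refine ae_restrict_of_ae ?_
    have hboxm : MeasurableSet box := by
      have : box = ⋂ i, {x | x i ∈ Set.Ico (b * M) ((b + 1) * M)} := by ext x; simp [hboxdef]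
      rw [this]
      refine MeasurableSet.iInter fun i => measurableSet_Ico.preimage ?_
      fun_prop
    filter_upwards [ae_restrict_mem hboxm] with x hx
    ext i
    change M * circleRepIco b ((x i / M : ℝ) : UnitAddCircle) = x i
    rw [circleRepIco_coe ⟨(le_div_iff₀ hM).mpr (hx i).1, (div_lt_iff₀ hM).mpr (hx i).2⟩,
      mul_div_cancel₀ _ hM.ne']
  have hρ : Measurable fun u : UnitAddTorus (Fin d) =>
      (WithLp.toLp 2 fun i => M * circleRepIco b (u i) : EuclideanSpace ℝ (Fin d)) :=
    (WithLp.measurable_toLp 2 _).comp (measurable_pi_lambda _ fun i =>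
      ((measurable_circleRepIco b).comp (measurable_pi_apply i)).const_mul M)
  have hc : (∏ _i : Fin d, M.toNNReal) ≠ 0 :=
    Finset.prod_ne_zero_iff.mpr fun i _ => by simpa using hM
  obtain ⟨W, hW, hWsurj, hWker⟩ := exists_compOp hcov hc hJm hrestr hρ hinv
  have hinj := scaledFreq_injective (d := d) hM.ne'
  let g : scaledFreq M '' Sig → Fin d → ℤ := fun σ => ((Equiv.Set.image _ Sig hinj).symm σ : Sig)
  have hg : ∀ σ, scaledFreq M (g σ) = σ := fun σ => by
    have := (Equiv.Set.image _ Sig hinj).apply_symm_apply σ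
    exact congrArg Subtype.val this
  have hginj : Function.Injective g :=
    Subtype.val_injective.comp (Equiv.Set.image _ Sig hinj).symm.injective
  have hgrange : Set.range g = Sig := by
    have : g = Subtype.val ∘ (Equiv.Set.image _ Sig hinj).symm := rfl
    rw [this, Set.range_comp, Equiv.range_eq_univ, Set.image_univ, Subtype.range_coe]
  refine ⟨Sig, fun σ => W (expBasis d (g σ)), fun σ => ?_,
    hSig.isRieszBasis W hWsurj hWker hginj hgrange⟩
  have h1 : ∀ᵐ x ∂(volume.restrict (⋃ k, R k)), expBasis d (g σ) (torusCover M x) =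
      UnitAddTorus.mFourier (g σ) (torusCover M x) :=
    ae_comp_of_map_eq hcov hJm hrestr ((expBasis_ae (g σ)).mono fun _ h _ => h)
  filter_upwards [hW (expBasis d (g σ)), h1] with x h2 h3
  rw [h2, h3, mFourier_torusCover, hg]

end Transfer

theorem theorem2 (d : ℕ) (S : Set (EuclideanSpace ℝ (Fin d)))
    (hS : ∃ (n : ℕ) (R : Fin n → Set (EuclideanSpace ℝ (Fin d))),
      (∀ k, IsRectangle (R k)) ∧ S = ⋃ k, R k) :
    (∃ Sig : Set (EuclideanSpace ℝ (Fin d)), IsRieszBasisOfExponentials S Sig) ∧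
    (S ⊆ unitCube d →
      ∃ Sig : Set (EuclideanSpace ℝ (Fin d)),
        Sig ⊆ integerLattice d ∧ IsRieszBasisOfExponentials S Sig) := by
  constructor
  · obtain ⟨r, hr0, hr⟩ : ∃ r : ℝ, 0 < r ∧ ∀ x ∈ S, ∀ i, x i ∈ Set.Icc (-r) r := by
      obtain ⟨n, R, hR, rfl⟩ := hS
      choose I hI hRI using hR
      have h1 : Bornology.IsBounded (⋃ k, ⋃ i, I k i) :=
        Bornology.isBounded_iUnion.mpr fun k => Bornology.isBounded_iUnion.mpr fun i => (hI k i).2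
      obtain ⟨r, hr0, hr⟩ := h1.exists_pos_norm_le
      refine ⟨r, hr0, fun x hx i => ?_⟩
      obtain ⟨k, hk⟩ := Set.mem_iUnion.mp hx
      rw [hRI] at hk
      have := hr _ (Set.mem_iUnion.mpr ⟨k, Set.mem_iUnion.mpr ⟨i, hk i⟩⟩)
      exact abs_le.mp this
    -- The cube from `-r` to `r` in each direction.
    obtain ⟨Sig, hSig⟩ := exists_isRieszBasisOfExponentials_scaledFreq hS (M := 2 * r)
      (by positivity) (-1 / 2) fun x hx i => by
        have := hr x hx i
        constructor <;> linarith [this.1, this.2]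
    exact ⟨_, hSig⟩
  · intro hcube
    -- For the unit cube no scaling is needed, so the frequencies stay integral.
    obtain ⟨Sig, hSig⟩ := exists_isRieszBasisOfExponentials_scaledFreq hS (M := 1) one_pos 0
      fun x hx i => by simpa using hcube hx i
    refine ⟨_, ?_, hSig⟩
    rintro _ ⟨n, -, rfl⟩ i
    exact ⟨n i, by simp [scaledFreq]⟩
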